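/- Let $M$ and $N$ be smooth Riemannian manifolds (without boundary, not necessarily complete or connected) of dimensions $m$ and $n$, with Riemannian distances $d_M$, $d_N$, and let $F\colon M\to N$ be a map that is locally Lipschitz with respect to $d_M$ and $d_N$. If two points $x,y$ of $M$ (or of $N$) are joined by a unique minimal geodesic segment from $x$ to $y$, parametrized on $[0,1]$, let $\tau^x_y\colon T_xM\to T_yM$ (respectively $T_xN\to T_yN$) denote the parallel translation along it with respect to the Levi-Civita connection. For $p\in M$ let $K_F(p)$ be the set of all linear maps $G\colon T_pM\to T_{F(p)}N$ for which there is a sequence $(x_i)_{i\in\mathbb N}$ of points of $M$ at which $F$ is differentiable, such that $\tau^p_{x_i}$ and $\tau^{F(x_i)}_{F(p)}$ are defined for all $i$, $x_i\to p$, and $$\tau^{F(x_i)}_{F(p)}\circ dF_{x_i}\circ\tau^{p}_{x_i}\longrightarrow G \quad\text{in operator norm as } i\to\infty .$$ Let $\partial F(p)$ be the convex hull of $K_F(p)$ in the space of linear maps $T_pM\to T_{F(p)}N$. A point $p\in M$ is called nonsingular for $F$ in the sense of Clarke if every $g\in\partial F(p)$ satisfies $\operatorname{rank}(g)=\min\{m,n\}$,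 and singular otherwise. Then the set of all singular points of $F$ is a closed subset of $M$. -/

import Mathlib

open Set Filter Topology Manifold Bundle
open scoped ContDiff

noncomputable section

namespace Clarke

section RiemannianGeometry

variable {E : Type*} [NormedAddCommGroup E] [NormedSpace ℝ E]
  {H : Type*} [TopologicalSpace H] (I : ModelWithCorners ℝ E H)
  {M : Type*} [EMetricSpace M] [ChartedSpace H M]
  [RiemannianBundle (fun x : M ↦ TangentSpace I x)]

/-- The coefficients of the Riemannian metric in the chart `φ` around `x₀`: at the point `z` of the
image of `φ`, this is the inner product of the images of `v` and `w` under `d(φ⁻¹)_z`. -/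
def chartMetric (x₀ : M) (z v w : E) : ℝ :=
  inner ℝ (mfderiv 𝓘(ℝ, E) I (extChartAt I x₀).symm z v)
    (mfderiv 𝓘(ℝ, E) I (extChartAt I x₀).symm z w)

/-- The derivative at `z`, in the direction `u`, of the metric coefficient `g(v, w)` in the chart
around `x₀`. -/
def chartMetricDeriv (x₀ : M) (z u v w : E) : ℝ :=
  fderiv ℝ (fun z' : E ↦ chartMetric I x₀ z' v w) z u

/-- The Christoffel symbols of the first kind of the Levi-Civita connection in the chart around
`x₀`, that is, `g(∇_u v, w) = (∂_u g(v, w) + ∂_v g(u, w) - ∂_w g(u, v)) / 2` for vector fields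
`u, v, w` which are constant in the chart. -/
def christoffel (x₀ : M) (z u v w : E) : ℝ :=
  (chartMetricDeriv I x₀ z u v w + chartMetricDeriv I x₀ z v u w
    - chartMetricDeriv I x₀ z w u v) / 2

/-- The vector field `V` along the curve `γ : [0, 1] → M` is parallel for the Levi-Civita
connection. In each chart `φ` of the atlas, at each time `t ∈ [0, 1]` with `γ t` in the domain of
`φ`, the coordinate expressions `c` of `γ` and `ξ` of `V` are differentiable at `t` and satisfy
`ξ' + Γ(c', ξ) = 0`; this equation is tested by taking the `g`-inner product with every `w`. The
values of `γ` and `V` outside `[0, 1]` play no role. -/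
def IsParallelAlong (γ : ℝ → M) (V : ∀ t, TangentSpace I (γ t)) : Prop :=
  ∀ t ∈ Icc (0 : ℝ) 1, ∀ x₀ : M, γ t ∈ (chartAt H x₀).source →
    ∃ c' ξ' : E,
      HasDerivWithinAt (fun s ↦ extChartAt I x₀ (γ s)) c' (Icc 0 1) t ∧
      HasDerivWithinAt
        (fun s ↦ (mfderiv I 𝓘(ℝ, E) (extChartAt I x₀) (γ s) (V s) : E)) ξ' (Icc 0 1) t ∧
      ∀ w : E,
        chartMetric I x₀ (extChartAt I x₀ (γ t)) ξ' w
          + christoffel I x₀ (extChartAt I x₀ (γ t)) c'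
              (mfderiv I 𝓘(ℝ, E) (extChartAt I x₀) (γ t) (V t)) w = 0

/-- A geodesic parametrized by `[0, 1]`: a `C^1` curve whose velocity field is parallel along it
(such a curve is automatically smooth). -/
structure IsGeodesic (γ : ℝ → M) : Prop where
  contMDiffOn : ContMDiffOn 𝓘(ℝ, ℝ) I 1 γ (Icc 0 1)
  parallel_velocity :
    IsParallelAlong I γ (fun t ↦ mfderivWithin 𝓘(ℝ, ℝ) I γ (Icc 0 1) t (1 : ℝ))

/-- A minimal geodesic segment `γ : [0, 1] → M` emanating from `x` to `y`: a geodesic whose length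
is the distance from `x` to `y`. -/
structure IsMinimalGeodesic (x y : M) (γ : ℝ → M) : Prop where
  isGeodesic : IsGeodesic I γ
  source : γ 0 = x
  target : γ 1 = y
  length_eq : pathELength I γ 0 1 = edist x y

/-- The linear map `T : T_x M → T_y M` is the parallel translation along the unique minimal
geodesic segment from `x` to `y`. In particular, such a unique segment exists. -/
def IsParallelTranslation (x y : M) (T : TangentSpace I x →L[ℝ] TangentSpace I y) : Prop :=
  ∃ γ : ℝ → M, IsMinimalGeodesic I x y γ ∧
    (∀ γ' : ℝ → M, IsMinimalGeodesic I x y γ' → EqOn γ' γ (Icc 0 1)) ∧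
    ∀ v : TangentSpace I x, ∃ V : ∀ t, TangentSpace I (γ t), IsParallelAlong I γ V ∧
      (⟨γ 0, V 0⟩ : TangentBundle I M) = ⟨x, v⟩ ∧ (⟨γ 1, V 1⟩ : TangentBundle I M) = ⟨y, T v⟩

end RiemannianGeometry

section GeneralizedDifferential

variable {E : Type*} [NormedAddCommGroup E] [NormedSpace ℝ E]
  {H : Type*} [TopologicalSpace H] (I : ModelWithCorners ℝ E H)
  {M : Type*} [EMetricSpace M] [ChartedSpace H M]
  [RiemannianBundle (fun x : M ↦ TangentSpace I x)]
  {E' : Type*} [NormedAddCommGroup E'] [NormedSpace ℝ E']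
  {H' : Type*} [TopologicalSpace H'] (J : ModelWithCorners ℝ E' H')
  {N : Type*} [EMetricSpace N] [ChartedSpace H' N]
  [RiemannianBundle (fun y : N ↦ TangentSpace J y)]

/-- The mixture `K_F(p)` of the differential of `F` at `p`: all limits (in operator norm) of
`τ_{F(x i) → F(p)} ∘ dF_{x i} ∘ τ_{p → x i}` along sequences `x i → p` of points of
differentiability of `F`, where `τ` is the parallel translation along unique minimal geodesics. -/
def mixture (F : M → N) (p : M) : Set (TangentSpace I p →L[ℝ] TangentSpace J (F p)) :=
  {G | ∃ (x : ℕ → M)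
      (τ : ∀ i, TangentSpace I p →L[ℝ] TangentSpace I (x i))
      (σ : ∀ i, TangentSpace J (F (x i)) →L[ℝ] TangentSpace J (F p)),
    Tendsto x atTop (𝓝 p) ∧
    (∀ i, MDifferentiableAt I J F (x i)) ∧
    (∀ i, IsParallelTranslation I p (x i) (τ i)) ∧
    (∀ i, IsParallelTranslation J (F (x i)) (F p) (σ i)) ∧
    Tendsto (fun i ↦ (σ i).comp ((mfderiv I J F (x i)).comp (τ i))) atTop (𝓝 G)}

/-- The generalized differential `∂F(p)`: the convex hull of the mixture of the differential. -/
def generalizedDifferential (F : M → N) (p : M) :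
    Set (TangentSpace I p →L[ℝ] TangentSpace J (F p)) :=
  convexHull ℝ (mixture I J F p)

/-- `p` is nonsingular for `F` in the sense of Clarke: every element of the generalized
differential of `F` at `p` has maximal rank `min (dim M) (dim N)`. -/
def IsNonsingularPoint (F : M → N) (p : M) : Prop :=
  ∀ g ∈ generalizedDifferential I J F p,
    Module.finrank ℝ (g : TangentSpace I p →ₗ[ℝ] TangentSpace J (F p)).range
      = min (Module.finrank ℝ E) (Module.finrank ℝ E')

/-- The set of all singular points of `F` in the sense of Clarke. -/
def singularSet (F : M → N) : Set M :=
  {p | ¬ IsNonsingularPoint I J F p}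

end GeneralizedDifferential

end Clarke

end

noncomputable section

namespace Clarke

section Euclidean

variable {E : Type*} [NormedAddCommGroup E] [NormedSpace ℝ E]

/-- A shortcut instance: instance search for iterated operator spaces is slow. -/
@[reducible] def biformNormedAddCommGroup : NormedAddCommGroup (E →L[ℝ] E →L[ℝ] ℝ) :=
  ContinuousLinearMap.toNormedAddCommGroup

attribute [local instance] biformNormedAddCommGroup

/-- A shortcut instance: instance search for iterated operator spaces is slow. -/
@[reducible] def biformNormedSpace : NormedSpace ℝ (E →L[ℝ] E →L[ℝ] ℝ) :=
  ContinuousLinearMap.toNormedSpace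

attribute [local instance] biformNormedSpace

/-- A shortcut instance: instance search for iterated operator spaces is slow. -/
@[reducible] def biformSeminormedAddCommGroup : SeminormedAddCommGroup (E →L[ℝ] E →L[ℝ] ℝ) :=
  ContinuousLinearMap.toNormedAddCommGroup.toSeminormedAddCommGroup

attribute [local instance] biformSeminormedAddCommGroup

/-- A shortcut instance: instance search for iterated operator spaces is slow. -/
@[reducible] def biformSeminormedAddGroup : SeminormedAddGroup (E →L[ℝ] E →L[ℝ] ℝ) :=
  ContinuousLinearMap.toNormedAddCommGroup.toSeminormedAddCommGroup.toSeminormedAddGroup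

attribute [local instance] biformSeminormedAddGroup

/-- A shortcut instance: instance search for iterated operator spaces is slow. -/
@[reducible] def biformAddMonoid : AddMonoid (E →L[ℝ] E →L[ℝ] ℝ) :=
  ContinuousLinearMap.addCommGroup.toAddGroup.toAddMonoid

attribute [local instance] biformAddMonoid

/-- A shortcut instance: instance search for iterated operator spaces is slow. -/
@[reducible] def bilinNormedAddCommGroup : NormedAddCommGroup (E →L[ℝ] E →L[ℝ] E) :=
  ContinuousLinearMap.toNormedAddCommGroup

attribute [local instance] bilinNormedAddCommGroup

/-- A shortcut instance: instance search for iterated operator spaces is slow. -/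
@[reducible] def bilinNormedSpace : NormedSpace ℝ (E →L[ℝ] E →L[ℝ] E) :=
  ContinuousLinearMap.toNormedSpace

attribute [local instance] bilinNormedSpace

/-- A shortcut instance: instance search for iterated operator spaces is slow. -/
@[reducible] def bilinSeminormedAddCommGroup : SeminormedAddCommGroup (E →L[ℝ] E →L[ℝ] E) :=
  ContinuousLinearMap.toNormedAddCommGroup.toSeminormedAddCommGroup

attribute [local instance] bilinSeminormedAddCommGroup

/-- A shortcut instance: instance search for iterated operator spaces is slow. -/
@[reducible] def bilinSeminormedAddGroup : SeminormedAddGroup (E →L[ℝ] E →L[ℝ] E) :=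
  ContinuousLinearMap.toNormedAddCommGroup.toSeminormedAddCommGroup.toSeminormedAddGroup

attribute [local instance] bilinSeminormedAddGroup

/-- A shortcut instance: instance search for iterated operator spaces is slow. -/
@[reducible] def triformNormedAddCommGroup : NormedAddCommGroup (E →L[ℝ] E →L[ℝ] E →L[ℝ] ℝ) :=
  ContinuousLinearMap.toNormedAddCommGroup

attribute [local instance] triformNormedAddCommGroup

/-- A shortcut instance: instance search for iterated operator spaces is slow. -/
@[reducible] def triformNormedSpace : NormedSpace ℝ (E →L[ℝ] E →L[ℝ] E →L[ℝ] ℝ) :=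
  ContinuousLinearMap.toNormedSpace

attribute [local instance] triformNormedSpace

/-- A shortcut instance: instance search for iterated operator spaces is slow. -/
@[reducible] def triformSeminormedAddCommGroup : SeminormedAddCommGroup (E →L[ℝ] E →L[ℝ] E →L[ℝ] ℝ) :=
  ContinuousLinearMap.toNormedAddCommGroup.toSeminormedAddCommGroup

attribute [local instance] triformSeminormedAddCommGroup

/-- A shortcut instance: instance search for iterated operator spaces is slow. -/
@[reducible] def triformAddMonoid : AddMonoid (E →L[ℝ] E →L[ℝ] E →L[ℝ] ℝ) :=
  ContinuousLinearMap.addCommGroup.toAddGroup.toAddMonoid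

attribute [local instance] triformAddMonoid

/-- The Christoffel symbol of the first kind associated with the derivative `D` of a metric. -/
def leviForm (D : E →L[ℝ] E →L[ℝ] E →L[ℝ] ℝ) (u v w : E) : ℝ :=
  (D u v w + D v u w - D w u v) / 2

/-- The Christoffel symbol of the first kind as a continuous linear function of the derivative of
the metric. -/
def leviFormL : (E →L[ℝ] E →L[ℝ] E →L[ℝ] ℝ) →L[ℝ] (E →L[ℝ] E →L[ℝ] E →L[ℝ] ℝ) :=
  let fl : (E →L[ℝ] E →L[ℝ] E →L[ℝ] ℝ) →L[ℝ] (E →L[ℝ] E →L[ℝ] E →L[ℝ] ℝ) :=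
    (ContinuousLinearMap.flipₗᵢ ℝ E E (E →L[ℝ] ℝ)).toContinuousLinearEquiv
  let fl' : (E →L[ℝ] E →L[ℝ] ℝ) →L[ℝ] (E →L[ℝ] E →L[ℝ] ℝ) :=
    (ContinuousLinearMap.flipₗᵢ ℝ E E ℝ).toContinuousLinearEquiv
  (2⁻¹ : ℝ) • (ContinuousLinearMap.id ℝ _ + fl
    - (ContinuousLinearMap.compL ℝ E (E →L[ℝ] E →L[ℝ] ℝ) (E →L[ℝ] E →L[ℝ] ℝ) fl').comp fl)

set_option synthInstance.maxHeartbeats 200000 in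
lemma leviFormL_apply (D : E →L[ℝ] E →L[ℝ] E →L[ℝ] ℝ) (u v w : E) :
    leviFormL D u v w = leviForm D u v w := by
  simp [leviFormL, leviForm]
  ring

/-- Quantitative control of a Riemannian metric `g` and of its Christoffel symbols of the second
kind `B` on the ball of radius `r` around `z₀`. -/
structure MetricControl (g : E → E →L[ℝ] E →L[ℝ] ℝ) (B : E → E →L[ℝ] E →L[ℝ] E) (z₀ : E)
    (r lam C : ℝ) : Prop where
  r_pos : 0 < r
  lam_pos : 0 < lam
  C_pos : 0 < C
  hasFDerivAt : ∀ z ∈ Metric.ball z₀ r, HasFDerivAt g (fderiv ℝ g z) z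
  continuousOn_fderiv : ContinuousOn (fderiv ℝ g) (Metric.ball z₀ r)
  symm : ∀ z ∈ Metric.ball z₀ r, ∀ v w, g z v w = g z w v
  lower : ∀ z ∈ Metric.ball z₀ r, ∀ v, lam * ‖v‖ ^ 2 ≤ g z v v
  upper : ∀ z ∈ Metric.ball z₀ r, ‖g z‖ ≤ C
  lipschitz : ∀ z ∈ Metric.ball z₀ r, ∀ z' ∈ Metric.ball z₀ r, ‖g z' - g z‖ ≤ C * ‖z' - z‖
  taylor : ∀ z ∈ Metric.ball z₀ r, ∀ z' ∈ Metric.ball z₀ r,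
    ‖g z' - g z - fderiv ℝ g z (z' - z)‖ ≤ C * ‖z' - z‖ ^ 2
  christoffel_eq : ∀ z ∈ Metric.ball z₀ r, ∀ u v w, g z (B z u v) w = leviForm (fderiv ℝ g z) u v w
  christoffel_le : ∀ z ∈ Metric.ball z₀ r, ‖B z‖ ≤ C
  christoffel_lipschitz : ∀ z ∈ Metric.ball z₀ r, ∀ z' ∈ Metric.ball z₀ r,
    ‖B z' - B z‖ ≤ C * ‖z' - z‖

lemma MetricControl.mono {g : E → E →L[ℝ] E →L[ℝ] ℝ} {B : E → E →L[ℝ] E →L[ℝ] E} {z₀ : E}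
    {r lam C : ℝ} (h : MetricControl g B z₀ r lam C) {r' : ℝ} (hr' : 0 < r') (hr : r' ≤ r) :
    MetricControl g B z₀ r' lam C := by
  have hs : ∀ z ∈ Metric.ball z₀ r', z ∈ Metric.ball z₀ r := fun z hz ↦ Metric.ball_subset_ball hr hz
  exact ⟨hr', h.lam_pos, h.C_pos, fun z hz ↦ h.hasFDerivAt z (hs z hz), h.continuousOn_fderiv.mono hs,
    fun z hz ↦ h.symm z (hs z hz), fun z hz ↦ h.lower z (hs z hz), fun z hz ↦ h.upper z (hs z hz),
    fun z hz z' hz' ↦ h.lipschitz z (hs z hz) z' (hs z' hz'),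
    fun z hz z' hz' ↦ h.taylor z (hs z hz) z' (hs z' hz'),
    fun z hz ↦ h.christoffel_eq z (hs z hz), fun z hz ↦ h.christoffel_le z (hs z hz),
    fun z hz z' hz' ↦ h.christoffel_lipschitz z (hs z hz) z' (hs z' hz')⟩

/-- A coercive bilinear form on a finite-dimensional space is invertible. -/
lemma isInvertible_of_pos [FiniteDimensional ℝ E] (b : E →L[ℝ] E →L[ℝ] ℝ)
    (hb : ∀ v, v ≠ 0 → 0 < b v v) : b.IsInvertible := by
  have hinj : Function.Injective (b : E →ₗ[ℝ] (E →L[ℝ] ℝ)) := by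
    rw [← LinearMap.ker_eq_bot, LinearMap.ker_eq_bot']
    intro v hv
    by_contra hne
    have := hb v hne
    have h2 : b v = 0 := hv
    simp [h2] at this
  have hdim : Module.finrank ℝ E = Module.finrank ℝ (E →L[ℝ] ℝ) := by
    rw [← (LinearMap.toContinuousLinearMap (𝕜 := ℝ) (E := E) (F' := ℝ)).finrank_eq]
    exact (Subspace.dual_finrank_eq (K := ℝ) (V := E)).symm
  refine ⟨(LinearEquiv.ofInjectiveOfFinrankEq (b : E →ₗ[ℝ] (E →L[ℝ] ℝ)) hinj hdim).toContinuousLinearEquiv, ?_⟩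
  ext v w
  rfl

lemma exists_lower_bound_of_pos [FiniteDimensional ℝ E] (b : E →L[ℝ] E →L[ℝ] ℝ)
    (hb : ∀ v, v ≠ 0 → 0 < b v v) : ∃ lam > 0, ∀ v, lam * ‖v‖ ^ 2 ≤ b v v := by
  have hc : ContinuousOn (fun v ↦ b v v) (Metric.sphere (0 : E) 1) := by fun_prop
  rcases (Metric.sphere (0 : E) 1).eq_empty_or_nonempty with he | hne
  · refine ⟨1, one_pos, fun v ↦ ?_⟩
    have : v = 0 := by
      by_contra hv
      have : ‖v‖⁻¹ • v ∈ Metric.sphere (0 : E) 1 := by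
        simp [norm_smul, hv]
      simp [he] at this
    simp [this]
  · obtain ⟨v₀, hv₀, hmin⟩ := (isCompact_sphere (0 : E) 1).exists_isMinOn hne hc
    refine ⟨b v₀ v₀, hb _ (by rintro rfl; simp at hv₀), fun v ↦ ?_⟩
    by_cases hv : v = 0
    · simp [hv]
    have h1 : b v₀ v₀ ≤ b (‖v‖⁻¹ • v) (‖v‖⁻¹ • v) := hmin (by simp [norm_smul, hv])
    have h2 : 0 < ‖v‖ := norm_pos_iff.2 hv
    simp only [map_smul, smul_apply, smul_eq_mul] at h1
    calc b v₀ v₀ * ‖v‖ ^ 2 ≤ (‖v‖⁻¹ * (‖v‖⁻¹ * b v v)) * ‖v‖ ^ 2 := by gcongr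
      _ = b v v := by field_simp

/-- A smooth Riemannian metric is controlled near every point. -/
lemma exists_metricControl [FiniteDimensional ℝ E] {g : E → E →L[ℝ] E →L[ℝ] ℝ} {z₀ : E}
    (hg : ContDiffAt ℝ ∞ g z₀) (hsymm : ∀ᶠ z in 𝓝 z₀, ∀ v w, g z v w = g z w v)
    (hpos : ∀ v, v ≠ 0 → 0 < g z₀ v v) :
    ∃ (B : E → E →L[ℝ] E →L[ℝ] E) (r lam C : ℝ), MetricControl g B z₀ r lam C := by
  obtain ⟨lam, hlam, hlow⟩ := exists_lower_bound_of_pos (g z₀) hpos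
  have hinv := isInvertible_of_pos (g z₀) hpos
  let B : E → E →L[ℝ] E →L[ℝ] E := fun z ↦
    (ContinuousLinearMap.compL ℝ E (E →L[ℝ] ℝ) E (g z).inverse).comp (leviFormL (fderiv ℝ g z))
  have hfd : ContDiffAt ℝ ∞ (fderiv ℝ g) z₀ := hg.fderiv_right (by simp)
  have hB : ContDiffAt ℝ 1 B z₀ := by
    have h1 : ContDiffAt ℝ 1 (fun z ↦ (g z).inverse) z₀ :=
      ContDiffAt.comp z₀ hinv.contDiffAt_map_inverse (hg.of_le (by simp))
    have h2 : ContDiffAt ℝ 1 (fun z ↦ leviFormL (fderiv ℝ g z)) z₀ :=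
      leviFormL.contDiff.contDiffAt.comp z₀ (hfd.of_le (by simp))
    exact ((ContinuousLinearMap.contDiff _).contDiffAt.comp z₀ h1).clm_comp h2
  obtain ⟨K₁, s₁, hs₁, hL₁⟩ := hB.exists_lipschitzOnWith
  obtain ⟨K₂, s₂, hs₂, hL₂⟩ := (hg.of_le (by simp : (1 : ℕ∞ω) ≤ ∞)).exists_lipschitzOnWith
  obtain ⟨K₃, s₃, hs₃, hL₃⟩ := (hfd.of_le (by simp : (1 : ℕ∞ω) ≤ ∞)).exists_lipschitzOnWith
  have hgc : ContinuousAt g z₀ := hg.continuousAt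
  have e1 : ∀ᶠ z in 𝓝 z₀, ‖g z - g z₀‖ < lam / 2 := by
    have := (hgc.sub (continuousAt_const (y := g z₀))).norm
    refine this.eventually_lt continuousAt_const ?_
    simpa using half_pos hlam
  have e2 : ∀ᶠ z in 𝓝 z₀, ‖g z‖ < ‖g z₀‖ + 1 :=
    hgc.norm.eventually_lt continuousAt_const (by simp)
  have e3 : ∀ᶠ z in 𝓝 z₀, ‖B z‖ < ‖B z₀‖ + 1 :=
    hB.continuousAt.norm.eventually_lt continuousAt_const (by simp)
  have e4 : ∀ᶠ z in 𝓝 z₀, ContDiffAt ℝ 2 g z :=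
    (hg.of_le (ENat.LEInfty.out)).eventually (by simp)
  have e5 : ∀ᶠ z in 𝓝 z₀, z ∈ s₁ ∩ (s₂ ∩ s₃) := inter_mem hs₁ (inter_mem hs₂ hs₃)
  obtain ⟨r, hr, hball⟩ := Metric.eventually_nhds_iff_ball.1
    (hsymm.and (e1.and (e2.and (e3.and (e4.and e5)))))
  have hlow' : ∀ z ∈ Metric.ball z₀ r, ∀ v, lam / 2 * ‖v‖ ^ 2 ≤ g z v v := by
    intro z hz v
    have h1 := hlow v
    have h2 : ‖(g z - g z₀) v v‖ ≤ ‖g z - g z₀‖ * ‖v‖ * ‖v‖ := (g z - g z₀).le_opNorm₂ v v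
    have h3 : ‖g z - g z₀‖ * ‖v‖ * ‖v‖ ≤ lam / 2 * ‖v‖ * ‖v‖ := by
      gcongr
      exact (hball z hz).2.1.le
    have h4 := neg_abs_le ((g z - g z₀) v v)
    rw [Real.norm_eq_abs] at h2
    simp only [sub_apply] at h2 h4
    nlinarith
  set C : ℝ := K₁ + K₂ + K₃ + (‖g z₀‖ + 1) + (‖B z₀‖ + 1) with hC
  have k1 := K₁.coe_nonneg
  have k2 := K₂.coe_nonneg
  have k3 := K₃.coe_nonneg
  have k4 := norm_nonneg (g z₀)
  have k5 := norm_nonneg (B z₀)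
  refine ⟨B, r, lam / 2, C, hr, half_pos hlam, by linarith, ?_, ?_, fun z hz ↦ (hball z hz).1, hlow',
    ?_, ?_, ?_, ?_, ?_, ?_⟩
  · intro z hz
    exact ((hball z hz).2.2.2.2.1.differentiableAt (by simp)).hasFDerivAt
  · intro z hz
    exact ((hball z hz).2.2.2.2.1.fderiv_right (m := 0) (by norm_num)).continuousAt.continuousWithinAt
  · intro z hz
    linarith [(hball z hz).2.2.1]
  · intro z hz z' hz'
    have := hL₂.norm_sub_le (hball z' hz').2.2.2.2.2.2.1 (hball z hz).2.2.2.2.2.2.1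
    refine this.trans ?_
    gcongr
    linarith
  · intro z hz z' hz'
    have := (convex_segment z z').norm_image_sub_le_of_norm_hasFDerivWithin_le' (f := g)
      (f' := fderiv ℝ g) (φ := fderiv ℝ g z) (C := K₃ * ‖z' - z‖) (x := z) (y := z') ?_ ?_
      (left_mem_segment ℝ z z') (right_mem_segment ℝ z z')
    · refine this.trans ?_
      rw [mul_assoc, ← sq]
      gcongr
      linarith
    · intro y hy
      have hy' : y ∈ Metric.ball z₀ r := (convex_ball z₀ r).segment_subset hz hz' hy
      exact ((hball y hy').2.2.2.2.1.differentiableAt (by simp)).hasFDerivAt.hasFDerivWithinAt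
    · intro y hy
      have hy' : y ∈ Metric.ball z₀ r := (convex_ball z₀ r).segment_subset hz hz' hy
      refine (hL₃.norm_sub_le (hball y hy').2.2.2.2.2.2.2 (hball z hz).2.2.2.2.2.2.2).trans ?_
      gcongr
      exact norm_sub_le_of_mem_segment hy
  · intro z hz u v w
    have hi : (g z).IsInvertible := by
      refine isInvertible_of_pos _ fun v hv ↦ lt_of_lt_of_le ?_ (hlow' z hz v)
      have : 0 < ‖v‖ := norm_pos_iff.2 hv
      positivity
    have : g z (B z u v) = leviFormL (fderiv ℝ g z) u v := by
      simp only [B, ContinuousLinearMap.comp_apply, ContinuousLinearMap.compL_apply]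
      exact hi.self_apply_inverse _
    rw [this, leviFormL_apply]
  · intro z hz
    linarith [(hball z hz).2.2.2.1]
  · intro z hz z' hz'
    have := hL₁.norm_sub_le (hball z' hz').2.2.2.2.2.1 (hball z hz).2.2.2.2.2.1
    refine this.trans ?_
    gcongr
    linarith

end Euclidean

section OrdinaryDifferentialEquations

variable {E : Type*} [NormedAddCommGroup E] [NormedSpace ℝ E]

open MeasureTheory

/-- The primitive vanishing at `0` of a continuous function on `[0, 1]`. -/
def primitive [CompleteSpace E] (f : C(Icc (0 : ℝ) 1, E)) : C(Icc (0 : ℝ) 1, E) where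
  toFun t := ∫ s in (0 : ℝ)..t, IccExtend zero_le_one f s
  continuous_toFun := by
    have h : Continuous (IccExtend (zero_le_one' ℝ) f) := f.continuous.Icc_extend'
    exact (intervalIntegral.continuous_primitive
      (fun a b ↦ h.intervalIntegrable a b) 0).comp continuous_subtype_val

variable [CompleteSpace E]

lemma norm_primitive_sub_le (f g : C(Icc (0 : ℝ) 1, E)) :
    ‖primitive f - primitive g‖ ≤ ‖f - g‖ := by
  have hf : Continuous (IccExtend (zero_le_one' ℝ) f) := f.continuous.Icc_extend'
  have hg : Continuous (IccExtend (zero_le_one' ℝ) g) := g.continuous.Icc_extend'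
  refine (ContinuousMap.norm_le _ (norm_nonneg _)).2 fun t ↦ ?_
  have h1 : (primitive f - primitive g) t
      = ∫ s in (0 : ℝ)..t, (IccExtend zero_le_one f s - IccExtend zero_le_one g s) := by
    rw [intervalIntegral.integral_sub (hf.intervalIntegrable _ _) (hg.intervalIntegrable _ _)]
    rfl
  rw [h1]
  have h2 := intervalIntegral.norm_integral_le_of_norm_le_const (a := (0 : ℝ)) (b := t)
    (f := fun s ↦ IccExtend zero_le_one f s - IccExtend zero_le_one g s) (C := ‖f - g‖)
    (fun s _ ↦ (f - g).norm_coe_le_norm (projIcc 0 1 zero_le_one s))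
  refine h2.trans ?_
  have h3 : |(t : ℝ) - 0| ≤ 1 := by
    rw [sub_zero, abs_of_nonneg t.2.1]; exact t.2.2
  nlinarith [norm_nonneg (f - g)]

lemma primitive_zero : primitive (0 : C(Icc (0 : ℝ) 1, E)) = 0 := by
  ext t
  simp [primitive, IccExtend]

lemma norm_primitive_le (f : C(Icc (0 : ℝ) 1, E)) : ‖primitive f‖ ≤ ‖f‖ := by
  simpa [primitive_zero] using norm_primitive_sub_le f 0

lemma exists_fixedPoint_of_closedBall {X : Type*} [NormedAddCommGroup X] [CompleteSpace X]
    {ρ : ℝ} (hρ : 0 ≤ ρ) (T : X → X) (hT : ∀ v, ‖v‖ ≤ ρ → ‖T v‖ ≤ ρ)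
    (hL : ∀ v w, ‖v‖ ≤ ρ → ‖w‖ ≤ ρ → ‖T v - T w‖ ≤ 2⁻¹ * ‖v - w‖) :
    ∃ v, ‖v‖ ≤ ρ ∧ T v = v := by
  let S := Metric.closedBall (0 : X) ρ
  have : CompleteSpace S := (Metric.isClosed_closedBall).completeSpace_coe
  have : Nonempty S := ⟨⟨0, Metric.mem_closedBall_self hρ⟩⟩
  let T' : S → S := fun v ↦ ⟨T v, by
    have := hT v (mem_closedBall_zero_iff.1 v.2)
    simpa [S] using this⟩
  have hc : ContractingWith 2⁻¹ T' := by
    refine ⟨by rw [← NNReal.coe_lt_coe]; norm_num, LipschitzWith.of_dist_le_mul fun v w ↦ ?_⟩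
    have := hL v w (mem_closedBall_zero_iff.1 v.2) (mem_closedBall_zero_iff.1 w.2)
    rw [Subtype.dist_eq, Subtype.dist_eq, dist_eq_norm, dist_eq_norm]
    simpa [T'] using this
  refine ⟨hc.fixedPoint, mem_closedBall_zero_iff.1 (hc.fixedPoint).2, ?_⟩
  exact congrArg Subtype.val hc.fixedPoint_isFixedPt

/-- The boundary value problem `c'' = -b(c, c')`, `c 0 = z₀`, `c 1 = z₀ + d` for a force `b` which
is quadratic in the velocity has a small solution when `d` is small. -/
lemma exists_boundary_value_solution {b : E → E → E} {z₀ : E} {r C : ℝ} (hr : 0 < r) (hC : 0 < C)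
    (hb : ContinuousOn (fun p : E × E ↦ b p.1 p.2) (Metric.ball z₀ r ×ˢ univ))
    (hle : ∀ z ∈ Metric.ball z₀ r, ∀ v, ‖b z v‖ ≤ C * ‖v‖ ^ 2)
    (hlip : ∀ z ∈ Metric.ball z₀ r, ∀ z' ∈ Metric.ball z₀ r, ∀ ρ v v', ‖v‖ ≤ ρ → ‖v'‖ ≤ ρ →
      ‖b z v - b z' v'‖ ≤ C * ‖z - z'‖ * ρ ^ 2 + 2 * C * ρ * ‖v - v'‖) :
    ∃ ε > 0, ∀ d : E, ‖d‖ ≤ ε → ∃ c v : ℝ → E, c 0 = z₀ ∧ c 1 = z₀ + d ∧ Continuous v ∧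
      (∀ t, HasDerivAt c (v t) t) ∧
      (∀ t ∈ Icc (0 : ℝ) 1, HasDerivWithinAt v (-b (c t) (v t)) (Icc 0 1) t) ∧
      (∀ t, ‖v t‖ ≤ 2 * ‖d‖) ∧ (∀ t ∈ Icc (0 : ℝ) 1, c t ∈ Metric.ball z₀ r) := by
  refine ⟨min (r / 4) (min 1 (1 / (32 * C))), by positivity, fun d hd ↦ ?_⟩
  set ρ := 2 * ‖d‖ with hρ
  have hρ0 : 0 ≤ ρ := by positivity
  have hρr : ρ < r := by
    have : ‖d‖ ≤ r / 4 := hd.trans (min_le_left _ _)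
    linarith
  have hρ1 : ρ ≤ 2 := by
    have : ‖d‖ ≤ 1 := hd.trans ((min_le_right _ _).trans (min_le_left _ _))
    linarith
  have hρC : C * ρ ≤ 1 / 16 := by
    have : ‖d‖ ≤ 1 / (32 * C) := hd.trans ((min_le_right _ _).trans (min_le_right _ _))
    rw [le_div_iff₀ (by positivity)] at this
    rw [hρ]; linarith
  have hmem : ∀ v : C(Icc (0 : ℝ) 1, E), ‖v‖ ≤ ρ → ∀ t, z₀ + primitive v t ∈ Metric.ball z₀ r := by
    intro v hv t
    rw [mem_ball_iff_norm, add_sub_cancel_left]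
    exact (((primitive v).norm_coe_le_norm t).trans ((norm_primitive_le v).trans hv)).trans_lt hρr
  have hcont : ∀ v : C(Icc (0 : ℝ) 1, E), ‖v‖ ≤ ρ →
      Continuous (fun t ↦ b (z₀ + primitive v t) (v t)) := by
    intro v hv
    exact hb.comp_continuous (f := fun t ↦ (z₀ + primitive v t, v t))
      ((continuous_const.add (primitive v).continuous).prodMk v.continuous)
      (fun t ↦ ⟨hmem v hv t, mem_univ _⟩)
  classical
  let N : C(Icc (0 : ℝ) 1, E) → C(Icc (0 : ℝ) 1, E) := fun v ↦
    if h : ‖v‖ ≤ ρ then ⟨_, hcont v h⟩ else 0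
  have hN : ∀ v, ‖v‖ ≤ ρ → ∀ t, N v t = b (z₀ + primitive v t) (v t) := by
    intro v hv t
    simp [N, hv]
  have hNle : ∀ v, ‖v‖ ≤ ρ → ‖N v‖ ≤ ρ / 8 := by
    intro v hv
    refine (ContinuousMap.norm_le _ (by positivity)).2 fun t ↦ ?_
    rw [hN v hv]
    refine (hle _ (hmem v hv t) _).trans ?_
    have h1 : ‖v t‖ ≤ ρ := (v.norm_coe_le_norm t).trans hv
    calc C * ‖v t‖ ^ 2 ≤ C * ρ ^ 2 := by gcongr
      _ = (C * ρ) * ρ := by ring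
      _ ≤ 1 / 16 * ρ := by gcongr
      _ ≤ ρ / 8 := by linarith
  have hNlip : ∀ v w, ‖v‖ ≤ ρ → ‖w‖ ≤ ρ → ‖N v - N w‖ ≤ 4⁻¹ * ‖v - w‖ := by
    intro v w hv hw
    refine (ContinuousMap.norm_le _ (by positivity)).2 fun t ↦ ?_
    rw [ContinuousMap.sub_apply, hN v hv, hN w hw]
    refine (hlip _ (hmem v hv t) _ (hmem w hw t) ρ _ _ ((v.norm_coe_le_norm t).trans hv)
      ((w.norm_coe_le_norm t).trans hw)).trans ?_
    have h1 : ‖v t - w t‖ ≤ ‖v - w‖ := (v - w).norm_coe_le_norm t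
    have h2 : ‖z₀ + primitive v t - (z₀ + primitive w t)‖ ≤ ‖v - w‖ := by
      rw [add_sub_add_left_eq_sub]
      exact ((primitive v - primitive w).norm_coe_le_norm t).trans (norm_primitive_sub_le v w)
    calc _ ≤ C * ‖v - w‖ * ρ ^ 2 + 2 * C * ρ * ‖v - w‖ := by gcongr
      _ = (C * ρ) * (ρ + 2) * ‖v - w‖ := by ring
      _ ≤ 1 / 16 * (2 + 2) * ‖v - w‖ := by gcongr
      _ = 4⁻¹ * ‖v - w‖ := by ring
  let one : Icc (0 : ℝ) 1 := ⟨1, zero_le_one, le_rfl⟩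
  let T : C(Icc (0 : ℝ) 1, E) → C(Icc (0 : ℝ) 1, E) := fun v ↦
    ContinuousMap.const _ (d + primitive (primitive (N v)) one) - primitive (N v)
  obtain ⟨v, hv, hTv⟩ := exists_fixedPoint_of_closedBall hρ0 T
    (by
      intro v hv
      refine (ContinuousMap.norm_le _ hρ0).2 fun t ↦ ?_
      have h1 := ((primitive (N v)).norm_coe_le_norm t).trans ((norm_primitive_le _).trans (hNle v hv))
      have h2 := ((primitive (primitive (N v))).norm_coe_le_norm one).trans
        ((norm_primitive_le _).trans ((norm_primitive_le _).trans (hNle v hv)))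
      calc ‖T v t‖ ≤ ‖d + primitive (primitive (N v)) one‖ + ‖primitive (N v) t‖ := norm_sub_le _ _
        _ ≤ ‖d‖ + ‖primitive (primitive (N v)) one‖ + ‖primitive (N v) t‖ := by
          gcongr; exact norm_add_le _ _
        _ ≤ ρ := by linarith)
    (by
      intro v w hv hw
      refine (ContinuousMap.norm_le _ (by positivity)).2 fun t ↦ ?_
      have h0 := hNlip v w hv hw
      have h1 := ((primitive (N v) - primitive (N w)).norm_coe_le_norm t).trans
        ((norm_primitive_sub_le _ _).trans h0)
      have h2 := ((primitive (primitive (N v)) - primitive (primitive (N w))).norm_coe_le_norm one).trans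
        ((norm_primitive_sub_le _ _).trans ((norm_primitive_sub_le _ _).trans h0))
      have h3 : (T v - T w) t = (primitive (primitive (N v)) - primitive (primitive (N w))) one
          - (primitive (N v) - primitive (N w)) t := by
        simp only [T, ContinuousMap.sub_apply, ContinuousMap.const_apply]
        abel
      rw [h3]
      refine (norm_sub_le _ _).trans ?_
      linarith)
  have hvc : Continuous (IccExtend (zero_le_one' ℝ) v) := v.continuous.Icc_extend'
  have hNc : Continuous (IccExtend (zero_le_one' ℝ) (N v)) := (N v).continuous.Icc_extend'
  have hprim : ∀ f : C(Icc (0 : ℝ) 1, E), ∀ t (ht : t ∈ Icc (0 : ℝ) 1),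
      primitive f ⟨t, ht⟩ = ∫ s in (0 : ℝ)..t, IccExtend zero_le_one f s := fun f t ht ↦ rfl
  have hvt : ∀ t (ht : t ∈ Icc (0 : ℝ) 1), v ⟨t, ht⟩
      = d + primitive (primitive (N v)) one - ∫ s in (0 : ℝ)..t, IccExtend zero_le_one (N v) s := by
    intro t ht
    conv_lhs => rw [← hTv]
    rfl
  refine ⟨fun t ↦ z₀ + ∫ s in (0 : ℝ)..t, IccExtend zero_le_one v s, IccExtend zero_le_one v,
    by simp, ?_, hvc, ?_, ?_, ?_, ?_⟩
  · have h1 : ∫ s in (0 : ℝ)..1, IccExtend zero_le_one v s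
        = ∫ s in (0 : ℝ)..1, ((d + primitive (primitive (N v)) one)
          - IccExtend zero_le_one (primitive (N v)) s) := by
      refine intervalIntegral.integral_congr fun s hs ↦ ?_
      rw [uIcc_of_le zero_le_one] at hs
      simp only [IccExtend_of_mem _ _ hs]
      rw [hvt s hs, hprim]
    have h2 : ∫ s in (0 : ℝ)..1, IccExtend zero_le_one (primitive (N v)) s
        = primitive (primitive (N v)) one := rfl
    simp only
    rw [h1, intervalIntegral.integral_sub (by simp)
      ((primitive (N v)).continuous.Icc_extend'.intervalIntegrable _ _), h2]
    simp
  · intro t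
    exact (hvc.integral_hasStrictDerivAt 0 t).hasDerivAt.const_add z₀
  · intro t ht
    have h1 : HasDerivAt (fun t ↦ d + primitive (primitive (N v)) one
        - ∫ s in (0 : ℝ)..t, IccExtend zero_le_one (N v) s) (-IccExtend zero_le_one (N v) t) t :=
      (hNc.integral_hasStrictDerivAt 0 t).hasDerivAt.const_sub _
    have h2 : IccExtend zero_le_one (N v) t = b (z₀ + ∫ s in (0 : ℝ)..t, IccExtend zero_le_one v s)
        (IccExtend zero_le_one v t) := by
      rw [IccExtend_of_mem _ _ ht, IccExtend_of_mem _ _ ht, hN v hv, hprim]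
    rw [← h2]
    refine h1.hasDerivWithinAt.congr (fun s hs ↦ ?_) ?_
    · rw [IccExtend_of_mem _ _ hs, hvt s hs]
    · rw [IccExtend_of_mem _ _ ht, hvt t ht]
  · intro t
    exact (v.norm_coe_le_norm _).trans hv
  · intro t ht
    have := hmem v hv ⟨t, ht⟩
    rwa [hprim] at this

/-- The resolvent of a linear differential equation on `[0, 1]` with small coefficients. -/
lemma exists_linear_resolvent {A : ℝ → E →L[ℝ] E} (hA : ContinuousOn A (Icc 0 1))
    (hle : ∀ t ∈ Icc (0 : ℝ) 1, ‖A t‖ ≤ 2⁻¹) :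
    ∃ X : ℝ → E →L[ℝ] E, X 0 = ContinuousLinearMap.id ℝ E ∧
      ∀ t ∈ Icc (0 : ℝ) 1, HasDerivWithinAt X ((A t).comp (X t)) (Icc 0 1) t := by
  have h : IsPicardLindelof (fun t X ↦ (A t).comp X) (tmin := 0) (tmax := 1)
      ⟨0, le_rfl, zero_le_one⟩ (ContinuousLinearMap.id ℝ E) 1 0 1 1 := by
    refine ⟨fun t ht ↦ ?_, fun X _ ↦ ?_, fun t ht X hX ↦ ?_, by simp⟩
    · refine LipschitzWith.lipschitzOnWith (LipschitzWith.of_dist_le_mul fun X Y ↦ ?_)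
      rw [dist_eq_norm, dist_eq_norm, ← ContinuousLinearMap.comp_sub]
      refine (ContinuousLinearMap.opNorm_comp_le _ _).trans ?_
      have := hle t ht
      gcongr
      simp only [NNReal.coe_one]
      linarith
    · exact hA.clm_comp continuousOn_const
    · refine (ContinuousLinearMap.opNorm_comp_le _ _).trans ?_
      have h1 : ‖X‖ ≤ 2 := by
        have h2 : ‖X - ContinuousLinearMap.id ℝ E‖ ≤ 1 := by simpa [dist_eq_norm] using hX
        have h3 : ‖ContinuousLinearMap.id ℝ E‖ ≤ 1 := ContinuousLinearMap.norm_id_le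
        calc ‖X‖ = ‖(X - ContinuousLinearMap.id ℝ E) + ContinuousLinearMap.id ℝ E‖ := by simp
          _ ≤ 2 := (norm_add_le _ _).trans (by linarith)
      calc ‖A t‖ * ‖X‖ ≤ 2⁻¹ * 2 := by gcongr; exact hle t ht
        _ = ((1 : NNReal) : ℝ) := by norm_num
  obtain ⟨X, hX0, hX⟩ := h.exists_eq_forall_mem_Icc_hasDerivWithinAt₀
  exact ⟨X, hX0, hX⟩

omit [CompleteSpace E] in
lemma norm_sub_le_of_norm_deriv_le_mul_norm {ξ ξ' : ℝ → E} {κ : ℝ} (hκ : κ ≤ 2⁻¹) (hκ0 : 0 ≤ κ)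
    (hξ : ∀ t ∈ Icc (0 : ℝ) 1, HasDerivWithinAt ξ (ξ' t) (Icc 0 1) t)
    (hle : ∀ t ∈ Icc (0 : ℝ) 1, ‖ξ' t‖ ≤ κ * ‖ξ t‖) :
    ‖ξ 1 - ξ 0‖ ≤ 2 * κ * ‖ξ 0‖ := by
  have hc : ContinuousOn (fun t ↦ ‖ξ t‖) (Icc 0 1) :=
    (HasDerivWithinAt.continuousOn hξ).norm
  obtain ⟨s, hs, hmax⟩ := isCompact_Icc.exists_isMaxOn (nonempty_Icc.2 zero_le_one) hc
  have h0 : (0 : ℝ) ∈ Icc (0 : ℝ) 1 := ⟨le_rfl, zero_le_one⟩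
  have key : ∀ t ∈ Icc (0 : ℝ) 1, ‖ξ t - ξ 0‖ ≤ κ * ‖ξ s‖ := by
    intro t ht
    have := (convex_Icc (0 : ℝ) 1).norm_image_sub_le_of_norm_hasDerivWithin_le (C := κ * ‖ξ s‖) hξ
      (fun t ht ↦ (hle t ht).trans (mul_le_mul_of_nonneg_left (hmax ht) hκ0)) h0 ht
    refine this.trans ?_
    rw [sub_zero, Real.norm_eq_abs, abs_of_nonneg ht.1]
    exact mul_le_of_le_one_right (by positivity) ht.2
  have h1 : ‖ξ s‖ ≤ 2 * ‖ξ 0‖ := by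
    have h2 := key s hs
    have h3 : ‖ξ s‖ ≤ ‖ξ s - ξ 0‖ + ‖ξ 0‖ := by
      simpa using norm_add_le (ξ s - ξ 0) (ξ 0)
    nlinarith [norm_nonneg (ξ s)]
  calc ‖ξ 1 - ξ 0‖ ≤ κ * ‖ξ s‖ := key 1 ⟨zero_le_one, le_rfl⟩
    _ ≤ κ * (2 * ‖ξ 0‖) := by gcongr
    _ = 2 * κ * ‖ξ 0‖ := by ring

end OrdinaryDifferentialEquations

section Geodesics

variable {E : Type*} [NormedAddCommGroup E] [NormedSpace ℝ E]

open MeasureTheory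

attribute [local instance] biformNormedAddCommGroup biformNormedSpace biformSeminormedAddCommGroup
  biformSeminormedAddGroup biformAddMonoid bilinNormedAddCommGroup bilinNormedSpace
  bilinSeminormedAddCommGroup bilinSeminormedAddGroup triformNormedAddCommGroup
  triformNormedSpace triformSeminormedAddCommGroup triformAddMonoid

namespace MetricControl

variable {g : E → E →L[ℝ] E →L[ℝ] ℝ} {B : E → E →L[ℝ] E →L[ℝ] E} {z₀ : E} {r lam C : ℝ}

lemma abs_apply_le (h : MetricControl g B z₀ r lam C) {z : E} (hz : z ∈ Metric.ball z₀ r)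
    (u v : E) : |g z u v| ≤ C * ‖u‖ * ‖v‖ := by
  refine ((g z).le_opNorm₂ u v).trans ?_
  gcongr
  exact h.upper z hz

lemma abs_sub_apply_le (h : MetricControl g B z₀ r lam C) {z z' : E} (hz : z ∈ Metric.ball z₀ r)
    (hz' : z' ∈ Metric.ball z₀ r) (u v : E) :
    |g z' u v - g z u v| ≤ C * ‖z' - z‖ * ‖u‖ * ‖v‖ := by
  have h1 := (g z' - g z).le_opNorm₂ u v
  simp only [sub_apply, Real.norm_eq_abs] at h1
  refine h1.trans ?_
  gcongr
  exact h.lipschitz z hz z' hz'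

lemma abs_taylor_apply_le (h : MetricControl g B z₀ r lam C) {z z' : E}
    (hz : z ∈ Metric.ball z₀ r) (hz' : z' ∈ Metric.ball z₀ r) (u v : E) :
    |g z' u v - g z u v - fderiv ℝ g z (z' - z) u v| ≤ C * ‖z' - z‖ ^ 2 * ‖u‖ * ‖v‖ := by
  have h1 := (g z' - g z - fderiv ℝ g z (z' - z)).le_opNorm₂ u v
  simp only [sub_apply, Real.norm_eq_abs] at h1
  refine h1.trans ?_
  gcongr
  exact h.taylor z hz z' hz'

lemma norm_christoffel_apply_le (h : MetricControl g B z₀ r lam C) {z : E}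
    (hz : z ∈ Metric.ball z₀ r) (u v : E) : ‖B z u v‖ ≤ C * ‖u‖ * ‖v‖ := by
  refine ((B z).le_opNorm₂ u v).trans ?_
  gcongr
  exact h.christoffel_le z hz

lemma norm_christoffel_sub_apply_le (h : MetricControl g B z₀ r lam C) {z z' : E}
    (hz : z ∈ Metric.ball z₀ r) (hz' : z' ∈ Metric.ball z₀ r) (u v : E) :
    ‖B z' u v - B z u v‖ ≤ C * ‖z' - z‖ * ‖u‖ * ‖v‖ := by
  have h1 := (B z' - B z).le_opNorm₂ u v
  simp only [sub_apply] at h1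
  refine h1.trans ?_
  gcongr
  exact h.christoffel_lipschitz z hz z' hz'

lemma eq_of_apply_eq (h : MetricControl g B z₀ r lam C) {z : E} (hz : z ∈ Metric.ball z₀ r)
    {u v : E} (huv : ∀ w, g z u w = g z v w) : u = v := by
  have h1 := h.lower z hz (u - v)
  have h2 : g z (u - v) (u - v) = 0 := by
    rw [map_sub (g z), sub_apply, huv, sub_self]
  have h3 : ‖u - v‖ ^ 2 ≤ 0 := by
    have := h.lam_pos
    rw [h2] at h1
    by_contra hcon
    push Not at hcon
    nlinarith
  have h4 : ‖u - v‖ = 0 := by nlinarith [norm_nonneg (u - v), sq_nonneg ‖u - v‖]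
  exact sub_eq_zero.1 (norm_eq_zero.1 h4)

lemma continuousOn (h : MetricControl g B z₀ r lam C) : ContinuousOn g (Metric.ball z₀ r) :=
  fun z hz ↦ (h.hasFDerivAt z hz).continuousAt.continuousWithinAt

lemma continuousOn_christoffel (h : MetricControl g B z₀ r lam C) :
    ContinuousOn B (Metric.ball z₀ r) := by
  refine LipschitzOnWith.continuousOn (K := C.toNNReal)
    (LipschitzOnWith.of_dist_le_mul fun z hz z' hz' ↦ ?_)
  rw [dist_eq_norm, dist_eq_norm, Real.coe_toNNReal _ h.C_pos.le]
  exact h.christoffel_lipschitz z' hz' z hz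

/-- The derivative of the product of two vector fields along a curve. -/
lemma hasDerivWithinAt_apply (h : MetricControl g B z₀ r lam C) {c : ℝ → E} {c' : E}
    {ξ η : ℝ → E} {ξ' η' : E} {s : Set ℝ} {t : ℝ} (hc : HasDerivWithinAt c c' s t)
    (hξ : HasDerivWithinAt ξ ξ' s t) (hη : HasDerivWithinAt η η' s t)
    (hz : c t ∈ Metric.ball z₀ r) :
    HasDerivWithinAt (fun t ↦ g (c t) (ξ t) (η t))
      (fderiv ℝ g (c t) c' (ξ t) (η t) + g (c t) ξ' (η t) + g (c t) (ξ t) η') s t := by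
  have h1 : HasDerivWithinAt (fun t ↦ g (c t)) (fderiv ℝ g (c t) c') s t :=
    (h.hasFDerivAt _ hz).comp_hasDerivWithinAt t hc
  have h2 := (h1.clm_apply hξ).clm_apply hη
  convert! h2 using 1

/-- Geodesics have constant speed. -/
lemma speed_eq (h : MetricControl g B z₀ r lam C) {c v v' : ℝ → E}
    (hc : ∀ t ∈ Icc (0 : ℝ) 1, HasDerivWithinAt c (v t) (Icc 0 1) t)
    (hv : ∀ t ∈ Icc (0 : ℝ) 1, HasDerivWithinAt v (v' t) (Icc 0 1) t)
    (hz : ∀ t ∈ Icc (0 : ℝ) 1, c t ∈ Metric.ball z₀ r)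
    (hgeo : ∀ t ∈ Icc (0 : ℝ) 1, ∀ w, g (c t) (v' t) w
      + leviForm (fderiv ℝ g (c t)) (v t) (v t) w = 0) {t : ℝ} (ht : t ∈ Icc (0 : ℝ) 1) :
    g (c t) (v t) (v t) = g (c 0) (v 0) (v 0) := by
  have hd : ∀ t ∈ Icc (0 : ℝ) 1, HasDerivWithinAt (fun t ↦ g (c t) (v t) (v t)) 0 (Icc 0 1) t := by
    intro t ht
    convert! h.hasDerivWithinAt_apply (hc t ht) (hv t ht) (hv t ht) (hz t ht) using 1
    have h1 := hgeo t ht (v t)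
    rw [h.symm _ (hz t ht) (v t) (v' t)]
    simp only [leviForm] at h1
    linarith
  have := (convex_Icc (0 : ℝ) 1).norm_image_sub_le_of_norm_hasDerivWithin_le (C := 0) hd
    (by simp) (left_mem_Icc.2 zero_le_one) ht
  rw [zero_mul] at this
  exact sub_eq_zero.1 (norm_le_zero_iff.1 this)

/-- The pointwise convexity estimate for the energy density. -/
lemma energy_density_ge (h : MetricControl g B z₀ r lam C) {ρ : ℝ} (hρ : 0 ≤ ρ) {z z' v w : E}
    (hz : z ∈ Metric.ball z₀ r) (hz' : z' ∈ Metric.ball z₀ r) (hv : ‖v‖ ≤ ρ) :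
    g z v v + fderiv ℝ g z (z' - z) v v + 2 * g z v (w - v)
      + (lam - C * ρ) * ‖w - v‖ ^ 2 - (C * ρ + C * ρ ^ 2) * ‖z' - z‖ ^ 2 ≤ g z' w w := by
  set k := w - v with hk
  have hw : w = v + k := by rw [hk]; abel
  have hC := h.C_pos
  have e1 : g z' w w = g z' v v + 2 * g z' v k + g z' k k := by
    rw [hw]
    simp only [map_add, add_apply]
    rw [h.symm z' hz' k v]; ring
  have e2 := h.lower z' hz' k
  have e3 := h.abs_sub_apply_le hz hz' v k
  have e4 := h.abs_taylor_apply_le hz hz' v v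
  have e5 : C * ‖z' - z‖ * ‖v‖ * ‖k‖ ≤ C * ρ * (‖z' - z‖ ^ 2 + ‖k‖ ^ 2) / 2 := by
    have : C * ‖z' - z‖ * ‖v‖ * ‖k‖ ≤ C * ‖z' - z‖ * ρ * ‖k‖ := by gcongr
    nlinarith [mul_nonneg (mul_nonneg hC.le hρ) (sq_nonneg (‖z' - z‖ - ‖k‖))]
  have e6 : C * ‖z' - z‖ ^ 2 * ‖v‖ * ‖v‖ ≤ C * ρ ^ 2 * ‖z' - z‖ ^ 2 := by
    have : C * ‖z' - z‖ ^ 2 * ‖v‖ * ‖v‖ ≤ C * ‖z' - z‖ ^ 2 * ρ * ρ := by gcongr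
    nlinarith
  have e7 := (abs_le.1 e3).1
  have e8 := (abs_le.1 e4).1
  rw [e1]
  nlinarith

lemma sq_intervalIntegral_le {f : ℝ → ℝ} (hf : ContinuousOn f (Icc 0 1)) :
    (∫ t in (0 : ℝ)..1, f t) ^ 2 ≤ ∫ t in (0 : ℝ)..1, f t ^ 2 := by
  set a := ∫ t in (0 : ℝ)..1, f t with ha
  have hf' : ContinuousOn f (uIcc 0 1) := by rwa [uIcc_of_le zero_le_one]
  have h0 : 0 ≤ ∫ t in (0 : ℝ)..1, (f t - a) ^ 2 :=
    intervalIntegral.integral_nonneg zero_le_one fun t _ ↦ sq_nonneg _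
  have h1 : ∫ t in (0 : ℝ)..1, (f t - a) ^ 2
      = (∫ t in (0 : ℝ)..1, f t ^ 2) - 2 * a * a + a ^ 2 := by
    have : ∀ t, (f t - a) ^ 2 = f t ^ 2 - (2 * a) * f t + a ^ 2 := fun t ↦ by ring
    simp_rw [this]
    rw [intervalIntegral.integral_add, intervalIntegral.integral_sub,
      intervalIntegral.integral_const_mul]
    · simp [ha]
    · exact (hf'.pow 2).intervalIntegrable
    · exact (continuousOn_const.mul hf').intervalIntegrable
    · exact ((hf'.pow 2).sub (continuousOn_const.mul hf')).intervalIntegrable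
    · simp
  nlinarith

/-- The displacement of a curve is at most the integral of its speed. -/
lemma norm_sub_le_integral [CompleteSpace E] {η k : ℝ → E}
    (hη : ∀ t ∈ Icc (0 : ℝ) 1, HasDerivWithinAt η (k t) (Icc 0 1) t)
    (hk : ContinuousOn k (Icc 0 1)) {t : ℝ} (ht : t ∈ Icc (0 : ℝ) 1) :
    ‖η t - η 0‖ ≤ ∫ s in (0 : ℝ)..1, ‖k s‖ := by
  have hsub : uIcc 0 t ⊆ Icc (0 : ℝ) 1 := by
    rw [uIcc_of_le ht.1]; exact Icc_subset_Icc_right ht.2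
  have h1 : ∫ s in (0 : ℝ)..t, k s = η t - η 0 := by
    refine intervalIntegral.integral_eq_sub_of_hasDeriv_right
      (fun s hs ↦ ((hη s (hsub hs)).continuousWithinAt.mono hsub)) (fun s hs ↦ ?_)
      (hk.mono hsub).intervalIntegrable
    rw [min_eq_left ht.1, max_eq_right ht.1] at hs
    have hs' : s ∈ Ioo (0 : ℝ) 1 := ⟨hs.1, hs.2.trans_le ht.2⟩
    exact ((hη s (Ioo_subset_Icc_self hs')).hasDerivAt (Icc_mem_nhds hs'.1 hs'.2)).hasDerivWithinAt
  have hkn : ContinuousOn (fun s ↦ ‖k s‖) (Icc 0 1) := hk.norm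
  calc ‖η t - η 0‖ = ‖∫ s in (0 : ℝ)..t, k s‖ := by rw [h1]
    _ ≤ ∫ s in (0 : ℝ)..t, ‖k s‖ := intervalIntegral.norm_integral_le_integral_norm ht.1
    _ ≤ ∫ s in (0 : ℝ)..1, ‖k s‖ := by
      refine intervalIntegral.integral_mono_interval le_rfl ht.1 ht.2
        (Eventually.of_forall fun s ↦ norm_nonneg _) ?_
      exact ContinuousOn.intervalIntegrable (by rwa [uIcc_of_le zero_le_one])

/-- A curve which vanishes at `0` is controlled by the energy. -/
lemma sq_norm_le_integral_of_eq_zero [CompleteSpace E] {η k : ℝ → E}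
    (hη : ∀ t ∈ Icc (0 : ℝ) 1, HasDerivWithinAt η (k t) (Icc 0 1) t)
    (hk : ContinuousOn k (Icc 0 1)) (h0 : η 0 = 0) {t : ℝ} (ht : t ∈ Icc (0 : ℝ) 1) :
    ‖η t‖ ^ 2 ≤ ∫ s in (0 : ℝ)..1, ‖k s‖ ^ 2 := by
  have h := norm_sub_le_integral hη hk ht
  rw [h0, sub_zero] at h
  exact (pow_le_pow_left₀ (norm_nonneg _) h 2).trans (sq_intervalIntegral_le hk.norm)

/-- Slow geodesics minimize the energy among all curves with the same endpoints. -/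
lemma energy_add_le [CompleteSpace E] (h : MetricControl g B z₀ r lam C) {ρ : ℝ} (hρ : 0 ≤ ρ)
    (hsmall : 2 * C * ρ + C * ρ ^ 2 ≤ lam / 2) {c v v' c₁ w : ℝ → E}
    (hc : ∀ t ∈ Icc (0 : ℝ) 1, HasDerivWithinAt c (v t) (Icc 0 1) t)
    (hv : ∀ t ∈ Icc (0 : ℝ) 1, HasDerivWithinAt v (v' t) (Icc 0 1) t)
    (hz : ∀ t ∈ Icc (0 : ℝ) 1, c t ∈ Metric.ball z₀ r)
    (hgeo : ∀ t ∈ Icc (0 : ℝ) 1, ∀ w, g (c t) (v' t) w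
      + leviForm (fderiv ℝ g (c t)) (v t) (v t) w = 0)
    (hvρ : ∀ t ∈ Icc (0 : ℝ) 1, ‖v t‖ ≤ ρ)
    (hc₁ : ∀ t ∈ Icc (0 : ℝ) 1, HasDerivWithinAt c₁ (w t) (Icc 0 1) t)
    (hw : ContinuousOn w (Icc 0 1))
    (hz₁ : ∀ t ∈ Icc (0 : ℝ) 1, c₁ t ∈ Metric.ball z₀ r) (h0 : c₁ 0 = c 0) (h1 : c₁ 1 = c 1) :
    (∫ t in (0 : ℝ)..1, g (c t) (v t) (v t)) + lam / 2 * ∫ t in (0 : ℝ)..1, ‖w t - v t‖ ^ 2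
      ≤ ∫ t in (0 : ℝ)..1, g (c₁ t) (w t) (w t) := by
  have hC := h.C_pos
  have hcc : ContinuousOn c (Icc 0 1) := HasDerivWithinAt.continuousOn hc
  have hcc₁ : ContinuousOn c₁ (Icc 0 1) := HasDerivWithinAt.continuousOn hc₁
  have hvc : ContinuousOn v (Icc 0 1) := HasDerivWithinAt.continuousOn hv
  have hgc : ContinuousOn (fun t ↦ g (c t)) (Icc 0 1) := h.continuousOn.comp hcc hz
  have hgc₁ : ContinuousOn (fun t ↦ g (c₁ t)) (Icc 0 1) := h.continuousOn.comp hcc₁ hz₁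
  have hfc : ContinuousOn (fun t ↦ fderiv ℝ g (c t)) (Icc 0 1) := h.continuousOn_fderiv.comp hcc hz
  have hη : ∀ t ∈ Icc (0 : ℝ) 1, HasDerivWithinAt (fun t ↦ c₁ t - c t) (w t - v t) (Icc 0 1) t :=
    fun t ht ↦ (hc₁ t ht).sub (hc t ht)
  set S := ∫ t in (0 : ℝ)..1, ‖w t - v t‖ ^ 2 with hS
  have hηS : ∀ t ∈ Icc (0 : ℝ) 1, ‖c₁ t - c t‖ ^ 2 ≤ S := fun t ht ↦
    sq_norm_le_integral_of_eq_zero hη (hw.sub hvc) (by simp [h0]) ht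
  have hint : ∀ f : ℝ → ℝ, ContinuousOn f (Icc 0 1) → IntervalIntegrable f volume 0 1 :=
    fun f hf ↦ ContinuousOn.intervalIntegrable (by rwa [uIcc_of_le zero_le_one])
  have cA : ContinuousOn (fun t ↦ g (c t) (v t) (v t)) (Icc 0 1) :=
    (hgc.clm_apply hvc).clm_apply hvc
  have cQ : ContinuousOn (fun t ↦ fderiv ℝ g (c t) (c₁ t - c t) (v t) (v t)
      + 2 * g (c t) (v t) (w t - v t)) (Icc 0 1) :=
    (((hfc.clm_apply (hcc₁.sub hcc)).clm_apply hvc).clm_apply hvc).add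
      (continuousOn_const.mul ((hgc.clm_apply hvc).clm_apply (hw.sub hvc)))
  have cK : ContinuousOn (fun t ↦ ‖w t - v t‖ ^ 2) (Icc 0 1) := (hw.sub hvc).norm.pow 2
  have cW : ContinuousOn (fun t ↦ g (c₁ t) (w t) (w t)) (Icc 0 1) :=
    (hgc₁.clm_apply hw).clm_apply hw
  have hQ : ∫ t in (0 : ℝ)..1, (fderiv ℝ g (c t) (c₁ t - c t) (v t) (v t)
      + 2 * g (c t) (v t) (w t - v t)) = 0 := by
    have hd : ∀ t ∈ Icc (0 : ℝ) 1, HasDerivWithinAt (fun t ↦ 2 * g (c t) (v t) (c₁ t - c t))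
        (fderiv ℝ g (c t) (c₁ t - c t) (v t) (v t) + 2 * g (c t) (v t) (w t - v t))
        (Icc 0 1) t := by
      intro t ht
      convert! (h.hasDerivWithinAt_apply (hc t ht) (hv t ht) (hη t ht) (hz t ht)).const_mul 2 using 1
      have := hgeo t ht (c₁ t - c t)
      simp only [leviForm] at this
      linarith
    rw [intervalIntegral.integral_eq_sub_of_hasDeriv_right (f := fun t ↦ 2 * g (c t) (v t) (c₁ t - c t))]
    · simp [h0, h1]
    · rw [uIcc_of_le zero_le_one]
      exact HasDerivWithinAt.continuousOn hd
    · intro t ht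
      rw [min_eq_left zero_le_one, max_eq_right zero_le_one] at ht
      exact ((hd t (Ioo_subset_Icc_self ht)).hasDerivAt
        (Icc_mem_nhds ht.1 ht.2)).hasDerivWithinAt
    · exact hint _ cQ
  have hmono : ∫ t in (0 : ℝ)..1, ((g (c t) (v t) (v t)
      + (fderiv ℝ g (c t) (c₁ t - c t) (v t) (v t) + 2 * g (c t) (v t) (w t - v t)))
      + ((lam - C * ρ) * ‖w t - v t‖ ^ 2 - (C * ρ + C * ρ ^ 2) * S))
      ≤ ∫ t in (0 : ℝ)..1, g (c₁ t) (w t) (w t) := by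
    refine intervalIntegral.integral_mono_on zero_le_one (hint _ ?_) (hint _ cW) fun t ht ↦ ?_
    · exact (cA.add cQ).add ((continuousOn_const.mul cK).sub continuousOn_const)
    · have e1 := h.energy_density_ge hρ (w := w t) (hz t ht) (hz₁ t ht) (hvρ t ht)
      have e2 : (C * ρ + C * ρ ^ 2) * ‖c₁ t - c t‖ ^ 2 ≤ (C * ρ + C * ρ ^ 2) * S := by
        gcongr
        exact hηS t ht
      linarith
  rw [intervalIntegral.integral_add, intervalIntegral.integral_add (hint _ cA) (hint _ cQ), hQ,
    intervalIntegral.integral_sub, intervalIntegral.integral_const_mul, ← hS] at hmono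
  rotate_left
  · exact hint _ (continuousOn_const.mul cK)
  · exact hint _ continuousOn_const
  · exact hint _ (cA.add cQ)
  · exact hint _ ((continuousOn_const.mul cK).sub continuousOn_const)
  simp only [intervalIntegral.integral_const, sub_zero, one_smul, add_zero] at hmono
  have hS0 : 0 ≤ S := intervalIntegral.integral_nonneg zero_le_one fun t _ ↦ sq_nonneg _
  nlinarith

/-- Nearby points are joined by a slow geodesic in the chart. -/
lemma exists_geodesic [CompleteSpace E] (h : MetricControl g B z₀ r lam C) :
    ∃ ε > 0, ∀ d : E, ‖d‖ ≤ ε → ∃ c v : ℝ → E, c 0 = z₀ ∧ c 1 = z₀ + d ∧ Continuous v ∧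
      (∀ t, HasDerivAt c (v t) t) ∧
      (∀ t ∈ Icc (0 : ℝ) 1, HasDerivWithinAt v (-B (c t) (v t) (v t)) (Icc 0 1) t) ∧
      (∀ t, ‖v t‖ ≤ 2 * ‖d‖) ∧ (∀ t ∈ Icc (0 : ℝ) 1, c t ∈ Metric.ball z₀ r) := by
  have hC := h.C_pos
  refine exists_boundary_value_solution (b := fun z v ↦ B z v v) h.r_pos hC ?_ ?_ ?_
  · have h1 : ContinuousOn (fun p : E × E ↦ B p.1) (Metric.ball z₀ r ×ˢ univ) :=
      h.continuousOn_christoffel.comp continuousOn_fst (fun p hp ↦ hp.1)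
    exact (h1.clm_apply continuousOn_snd).clm_apply continuousOn_snd
  · intro z hz v
    rw [sq, ← mul_assoc]
    exact h.norm_christoffel_apply_le hz v v
  · intro z hz z' hz' ρ v v' hv hv'
    have hρ : 0 ≤ ρ := (norm_nonneg _).trans hv
    have e : B z v v - B z' v' v' = (B z v v - B z' v v) + (B z' (v - v') v + B z' v' (v - v')) := by
      simp only [map_sub, sub_apply]; abel
    rw [e]
    refine (norm_add_le _ _).trans (add_le_add ?_ ((norm_add_le _ _).trans ?_))
    · refine (h.norm_christoffel_sub_apply_le hz' hz v v).trans ?_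
      rw [sq, ← mul_assoc]
      gcongr
    · have e1 := h.norm_christoffel_apply_le hz' (v - v') v
      have e2 := h.norm_christoffel_apply_le hz' v' (v - v')
      have e3 : C * ‖v - v'‖ * ‖v‖ ≤ C * ‖v - v'‖ * ρ := by gcongr
      have e4 : C * ‖v'‖ * ‖v - v'‖ ≤ C * ρ * ‖v - v'‖ := by gcongr
      nlinarith

/-- The Christoffel equation determines the derivative of a parallel field. -/
lemma eq_neg_christoffel (h : MetricControl g B z₀ r lam C) {z u v v' : E}
    (hz : z ∈ Metric.ball z₀ r)
    (heq : ∀ w, g z v' w + leviForm (fderiv ℝ g z) u v w = 0) : v' = -B z u v := by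
  refine h.eq_of_apply_eq hz fun w ↦ ?_
  rw [map_neg, neg_apply, h.christoffel_eq z hz]
  linarith [heq w]

lemma christoffel_equation (h : MetricControl g B z₀ r lam C) {z u v : E}
    (hz : z ∈ Metric.ball z₀ r) (w : E) :
    g z (-B z u v) w + leviForm (fderiv ℝ g z) u v w = 0 := by
  rw [map_neg, neg_apply, h.christoffel_eq z hz]
  ring

/-- Existence of the parallel translation along slow curves. -/
lemma exists_parallel_resolvent [CompleteSpace E] (h : MetricControl g B z₀ r lam C)
    {c v : ℝ → E} {ρ : ℝ} (hρ : C * ρ ≤ 2⁻¹)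
    (hc : ContinuousOn c (Icc 0 1)) (hv : ContinuousOn v (Icc 0 1))
    (hz : ∀ t ∈ Icc (0 : ℝ) 1, c t ∈ Metric.ball z₀ r)
    (hvρ : ∀ t ∈ Icc (0 : ℝ) 1, ‖v t‖ ≤ ρ) :
    ∃ X : ℝ → E →L[ℝ] E, X 0 = ContinuousLinearMap.id ℝ E ∧
      ∀ t ∈ Icc (0 : ℝ) 1, HasDerivWithinAt X (-(B (c t) (v t)).comp (X t)) (Icc 0 1) t := by
  have hC := h.C_pos
  obtain ⟨X, hX0, hX⟩ := exists_linear_resolvent (A := fun t ↦ -B (c t) (v t))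
    ((h.continuousOn_christoffel.comp hc hz).clm_apply hv).neg (fun t ht ↦ by
      rw [norm_neg]
      refine ((B (c t)).le_opNorm _).trans (le_trans ?_ hρ)
      gcongr
      · exact h.christoffel_le _ (hz t ht)
      · exact hvρ t ht)
  exact ⟨X, hX0, hX⟩

/-- A parallel field along a slow curve is almost constant in the chart. -/
lemma norm_parallel_sub_le (h : MetricControl g B z₀ r lam C)
    {c v ξ ξ' : ℝ → E} {ρ : ℝ} (hρ0 : 0 ≤ ρ) (hρ : C * ρ ≤ 2⁻¹)
    (hz : ∀ t ∈ Icc (0 : ℝ) 1, c t ∈ Metric.ball z₀ r)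
    (hvρ : ∀ t ∈ Icc (0 : ℝ) 1, ‖v t‖ ≤ ρ)
    (hξ : ∀ t ∈ Icc (0 : ℝ) 1, HasDerivWithinAt ξ (ξ' t) (Icc 0 1) t)
    (heq : ∀ t ∈ Icc (0 : ℝ) 1, ∀ w, g (c t) (ξ' t) w
      + leviForm (fderiv ℝ g (c t)) (v t) (ξ t) w = 0) :
    ‖ξ 1 - ξ 0‖ ≤ 2 * (C * ρ) * ‖ξ 0‖ := by
  have hC := h.C_pos
  refine norm_sub_le_of_norm_deriv_le_mul_norm hρ (by positivity) hξ fun t ht ↦ ?_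
  rw [h.eq_neg_christoffel (hz t ht) (heq t ht), norm_neg]
  refine (h.norm_christoffel_apply_le (hz t ht) _ _).trans ?_
  gcongr
  exact hvρ t ht

end MetricControl

/-- A `C^1` curve admits reparametrizations of almost constant speed. -/
lemma exists_reparametrization {f : ℝ → ℝ} (hf : ContinuousOn f (Icc 0 1))
    (hf0 : ∀ t ∈ Icc (0 : ℝ) 1, 0 ≤ f t) {δ : ℝ} (hδ : 0 < δ) :
    ∃ σ σ' : ℝ → ℝ, σ 0 = 0 ∧ σ 1 = 1 ∧ Continuous σ' ∧ (∀ t, HasDerivAt σ (σ' t) t) ∧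
      MapsTo σ (Icc 0 1) (Icc 0 1) ∧
      ∀ t ∈ Icc (0 : ℝ) 1, 0 ≤ σ' t ∧ σ' t * f (σ t) ≤ (∫ s in (0 : ℝ)..1, f s) + δ := by
  let F : ℝ → ℝ := IccExtend zero_le_one ((Icc (0 : ℝ) 1).domRestrict f)
  have hF : Continuous F := (continuousOn_iff_continuous_domRestrict.1 hf).Icc_extend'
  have hFf : ∀ t ∈ Icc (0 : ℝ) 1, F t = f t := fun t ht ↦ by
    simp only [F]
    rw [IccExtend_of_mem _ _ ht]
    rfl
  have hF0 : ∀ t, 0 ≤ F t := fun t ↦ hf0 _ (projIcc 0 1 zero_le_one t).2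
  set L := ∫ s in (0 : ℝ)..1, f s with hL
  have hLF : ∫ s in (0 : ℝ)..1, F s = L := by
    refine intervalIntegral.integral_congr fun s hs ↦ hFf s ?_
    rwa [uIcc_of_le zero_le_one] at hs
  have hL0 : 0 ≤ L := intervalIntegral.integral_nonneg zero_le_one hf0
  let s : ℝ → ℝ := fun t ↦ ∫ u in (0 : ℝ)..t, (F u + δ) / (L + δ)
  have hcont : Continuous (fun u ↦ (F u + δ) / (L + δ)) := by fun_prop
  have hs : ∀ t, HasDerivAt s ((F t + δ) / (L + δ)) t := fun t ↦
    (hcont.integral_hasStrictDerivAt 0 t).hasDerivAt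
  have hs' : ∀ t, δ / (L + δ) ≤ (F t + δ) / (L + δ) := fun t ↦ by
    gcongr
    linarith [hF0 t]
  have hpos : 0 < δ / (L + δ) := by positivity
  have hmono : StrictMono s := strictMono_of_deriv_pos fun t ↦ by
    rw [(hs t).deriv]; exact hpos.trans_le (hs' t)
  have hsc : Continuous s := continuous_iff_continuousAt.2 fun t ↦ (hs t).continuousAt
  have hs0 : s 0 = 0 := by simp [s]
  have hs1 : s 1 = 1 := by
    simp only [s]
    rw [intervalIntegral.integral_div, intervalIntegral.integral_add (hF.intervalIntegrable _ _)
      (by simp), hLF]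
    simp only [intervalIntegral.integral_const, sub_zero, one_smul]
    exact div_self (by positivity)
  have hlin : ∀ a b, a ≤ b → δ / (L + δ) * (b - a) ≤ s b - s a := by
    intro a b hab
    exact mul_sub_le_image_sub_of_le_deriv (fun t ↦ (hs t).differentiableAt)
      (fun t ↦ by rw [(hs t).deriv]; exact hs' t) hab
  have hsurj : Function.Surjective s := by
    refine hsc.surjective ?_ ?_
    · refine tendsto_atTop_mono' atTop (f₁ := fun t ↦ δ / (L + δ) * t) ?_
        (tendsto_id.const_mul_atTop hpos)
      filter_upwards [eventually_ge_atTop 0] with t ht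
      have := hlin 0 t ht
      rw [hs0] at this
      linarith
    · refine tendsto_atBot_mono' atBot (f₁ := fun t ↦ δ / (L + δ) * t) ?_
        (tendsto_id.const_mul_atBot hpos)
      filter_upwards [eventually_le_atBot 0] with t ht
      have := hlin t 0 ht
      rw [hs0] at this
      linarith
  let e := hmono.orderIsoOfSurjective s hsurj
  have he : ∀ t, s (e.symm t) = t := fun t ↦ e.apply_symm_apply t
  have he' : ∀ t, e.symm (s t) = t := fun t ↦ e.symm_apply_apply t
  have hec : Continuous e.symm := e.symm.continuous
  have h0 : e.symm 0 = 0 := by simpa [hs0] using he' 0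
  have h1 : e.symm 1 = 1 := by simpa [hs1] using he' 1
  refine ⟨e.symm, fun t ↦ ((F (e.symm t) + δ) / (L + δ))⁻¹, ?_, ?_, ?_, ?_, ?_, ?_⟩
  · exact h0
  · exact h1
  · refine Continuous.inv₀ (hcont.comp hec) fun t ↦ ?_
    exact (hpos.trans_le (hs' _)).ne'
  · intro t
    exact HasDerivAt.of_local_left_inverse hec.continuousAt (hs _) (hpos.trans_le (hs' _)).ne'
      (Eventually.of_forall he)
  · intro t ht
    exact ⟨h0 ▸ e.symm.monotone ht.1, h1 ▸ e.symm.monotone ht.2⟩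
  · intro t ht
    have hm : e.symm t ∈ Icc (0 : ℝ) 1 := ⟨h0 ▸ e.symm.monotone ht.1, h1 ▸ e.symm.monotone ht.2⟩
    have hp : 0 < F (e.symm t) + δ := by linarith [hF0 (e.symm t)]
    refine ⟨by positivity, ?_⟩
    simp only
    rw [← hFf _ hm, inv_div, div_mul_eq_mul_div, div_le_iff₀ hp]
    gcongr
    linarith

end Geodesics

section Charts

variable {E : Type*} [NormedAddCommGroup E] [NormedSpace ℝ E]
  {H : Type*} [TopologicalSpace H] (I : ModelWithCorners ℝ E H)
  {M : Type*} [TopologicalSpace M] [ChartedSpace H M]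

/-- The derivative at `y` of the chart around `x₀`, as an endomorphism of the model space. -/
def chartDeriv (x₀ y : M) : E →L[ℝ] E := mfderiv I 𝓘(ℝ, E) (extChartAt I x₀) y

/-- The derivative at `z` of the inverse of the chart around `x₀`. -/
def chartSymmDeriv (x₀ : M) (z : E) : E →L[ℝ] E := mfderiv 𝓘(ℝ, E) I (extChartAt I x₀).symm z

variable [I.Boundaryless] [IsManifold I ∞ M]

omit [IsManifold I ∞ M] in
lemma mfderivWithin_range_eq_mfderiv (x₀ : M) (z : E) :
    mfderivWithin 𝓘(ℝ, E) I (extChartAt I x₀).symm (range I) z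
      = mfderiv 𝓘(ℝ, E) I (extChartAt I x₀).symm z := by
  rw [I.range_eq_univ, mfderivWithin_univ]

lemma chartDeriv_comp_chartSymmDeriv {x₀ : M} {z : E} (hz : z ∈ (extChartAt I x₀).target) :
    (chartDeriv I x₀ ((extChartAt I x₀).symm z)).comp (chartSymmDeriv I x₀ z)
      = ContinuousLinearMap.id ℝ E := by
  have := mfderiv_extChartAt_comp_mfderivWithin_extChartAt_symm hz
  rw [mfderivWithin_range_eq_mfderiv] at this
  exact this

lemma chartDeriv_chartSymmDeriv_apply {x₀ : M} {z : E} (hz : z ∈ (extChartAt I x₀).target) (v : E) :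
    chartDeriv I x₀ ((extChartAt I x₀).symm z) (chartSymmDeriv I x₀ z v) = v :=
  congrArg (fun f : E →L[ℝ] E ↦ f v) (chartDeriv_comp_chartSymmDeriv I hz)

lemma chartSymmDeriv_comp_chartDeriv {x₀ y : M} (hy : y ∈ (extChartAt I x₀).source) :
    (chartSymmDeriv I x₀ (extChartAt I x₀ y)).comp (chartDeriv I x₀ y)
      = ContinuousLinearMap.id ℝ E := by
  have := mfderivWithin_extChartAt_symm_comp_mfderiv_extChartAt' hy
  rw [mfderivWithin_range_eq_mfderiv] at this
  exact this

lemma chartSymmDeriv_chartDeriv_apply {x₀ y : M} (hy : y ∈ (extChartAt I x₀).source) (v : E) :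
    chartSymmDeriv I x₀ (extChartAt I x₀ y) (chartDeriv I x₀ y v) = v :=
  congrArg (fun f : E →L[ℝ] E ↦ f v) (chartSymmDeriv_comp_chartDeriv I hy)

lemma chartDeriv_chartSymmDeriv_apply' {x₀ y : M} (hy : y ∈ (extChartAt I x₀).source) (v : E) :
    chartDeriv I x₀ y (chartSymmDeriv I x₀ (extChartAt I x₀ y) v) = v := by
  have := chartDeriv_chartSymmDeriv_apply I ((extChartAt I x₀).map_source hy) v
  rwa [(extChartAt I x₀).left_inv hy] at this

lemma chartSymmDeriv_injective {x₀ : M} {z : E} (hz : z ∈ (extChartAt I x₀).target) :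
    Function.Injective (chartSymmDeriv I x₀ z) :=
  Function.LeftInverse.injective (chartDeriv_chartSymmDeriv_apply I hz)

/-- The transition map from the chart around `x₀` to the chart around `x₁`. -/
def transition (x₀ x₁ : M) : E → E := fun z ↦ extChartAt I x₁ ((extChartAt I x₀).symm z)

/-- The domain of the transition map. -/
def transitionDomain (x₀ x₁ : M) : Set E :=
  (extChartAt I x₀).target ∩ (extChartAt I x₀).symm ⁻¹' (extChartAt I x₁).source

omit [IsManifold I ∞ M] in
lemma isOpen_transitionDomain (x₀ x₁ : M) : IsOpen (transitionDomain I x₀ x₁) :=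
  (continuousOn_extChartAt_symm x₀).isOpen_inter_preimage (isOpen_extChartAt_target x₀)
    (isOpen_extChartAt_source x₁)

omit [I.Boundaryless] in
lemma contDiffOn_transition (x₀ x₁ : M) :
    ContDiffOn ℝ ∞ (transition I x₀ x₁) (transitionDomain I x₀ x₁) := by
  rw [← contMDiffOn_iff_contDiffOn]
  refine (contMDiffOn_extChartAt (I := I) (x := x₁) (n := ∞)).comp
    ((contMDiffOn_extChartAt_symm x₀).mono inter_subset_left) ?_
  intro z hz
  have := hz.2
  rwa [mem_preimage, extChartAt_source] at this

lemma fderiv_transition {x₀ x₁ : M} {z : E} (hz : z ∈ transitionDomain I x₀ x₁) :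
    fderiv ℝ (transition I x₀ x₁) z
      = (chartDeriv I x₁ ((extChartAt I x₀).symm z)).comp (chartSymmDeriv I x₀ z) := by
  have h1 : MDifferentiableAt I 𝓘(ℝ, E) (extChartAt I x₁) ((extChartAt I x₀).symm z) := by
    refine mdifferentiableAt_extChartAt ?_
    have := hz.2
    rwa [mem_preimage, extChartAt_source] at this
  have h2 : MDifferentiableAt 𝓘(ℝ, E) I (extChartAt I x₀).symm z := by
    have := mdifferentiableWithinAt_extChartAt_symm hz.1
    rwa [I.range_eq_univ, mdifferentiableWithinAt_univ] at this
  have := mfderiv_comp z h1 h2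
  rw [mfderiv_eq_fderiv] at this
  exact this

lemma chartSymmDeriv_transition {x₀ x₁ : M} {z : E} (hz : z ∈ transitionDomain I x₀ x₁) (v : E) :
    chartSymmDeriv I x₁ (transition I x₀ x₁ z) (fderiv ℝ (transition I x₀ x₁) z v)
      = chartSymmDeriv I x₀ z v := by
  rw [fderiv_transition I hz]
  exact chartSymmDeriv_chartDeriv_apply I hz.2 _

lemma contMDiffOn_chartSymmDeriv (x₀ : M) (v : E) :
    ContMDiffOn 𝓘(ℝ, E) (I.prod 𝓘(ℝ, E)) ∞
      (fun z ↦ (⟨(extChartAt I x₀).symm z, chartSymmDeriv I x₀ z v⟩ : TangentBundle I M))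
      (extChartAt I x₀).target := by
  have hopen : IsOpen (extChartAt I x₀).target := isOpen_extChartAt_target x₀
  have h1 := (contMDiffOn_extChartAt_symm (I := I) (n := ∞) x₀).contMDiffOn_tangentMapWithin
    (m := ∞) (by simp) hopen.uniqueMDiffOn
  have h2 : ContMDiffOn 𝓘(ℝ, E) (𝓘(ℝ, E).prod 𝓘(ℝ, E)) ∞
      (fun z : E ↦ (⟨z, v⟩ : TangentBundle 𝓘(ℝ, E) E)) (extChartAt I x₀).target := by
    exact contMDiffOn_vectorSpace_iff_contDiffOn (V := fun _ ↦ (v : E)) |>.2 contDiffOn_const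
  have h3 := h1.comp h2 (fun z hz ↦ hz)
  refine h3.congr fun z hz ↦ ?_
  simp only [Function.comp_apply, tangentMapWithin]
  rw [mfderivWithin_of_isOpen hopen hz]
  rfl

end Charts

section ChartMetric

variable {E : Type*} [NormedAddCommGroup E] [NormedSpace ℝ E]

attribute [local instance] biformNormedAddCommGroup biformNormedSpace biformSeminormedAddCommGroup
  biformSeminormedAddGroup biformAddMonoid bilinNormedAddCommGroup bilinNormedSpace
  bilinSeminormedAddCommGroup bilinSeminormedAddGroup triformNormedAddCommGroup
  triformNormedSpace triformSeminormedAddCommGroup triformAddMonoid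

variable [FiniteDimensional ℝ E]
  {H : Type*} [TopologicalSpace H] (I : ModelWithCorners ℝ E H)
  {M : Type*} [EMetricSpace M] [ChartedSpace H M]
  [RiemannianBundle (fun x : M ↦ TangentSpace I x)]

omit [FiniteDimensional ℝ E] in
lemma chartMetric_add_left (x₀ : M) (z u v w : E) :
    chartMetric I x₀ z (u + v) w = chartMetric I x₀ z u w + chartMetric I x₀ z v w := by
  have h := map_add (mfderiv 𝓘(ℝ, E) I (extChartAt I x₀).symm z) u v
  exact (congrArg (fun a ↦ inner ℝ a (mfderiv 𝓘(ℝ, E) I (extChartAt I x₀).symm z w)) h).trans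
    (inner_add_left (E := TangentSpace I ((extChartAt I x₀).symm z)) _ _ _)

omit [FiniteDimensional ℝ E] in
lemma chartMetric_smul_left (x₀ : M) (z : E) (a : ℝ) (u w : E) :
    chartMetric I x₀ z (a • u) w = a * chartMetric I x₀ z u w := by
  have h := map_smul (mfderiv 𝓘(ℝ, E) I (extChartAt I x₀).symm z) a u
  exact (congrArg (fun a ↦ inner ℝ a (mfderiv 𝓘(ℝ, E) I (extChartAt I x₀).symm z w)) h).trans
    (real_inner_smul_left (F := TangentSpace I ((extChartAt I x₀).symm z)) _ _ _)

omit [FiniteDimensional ℝ E] in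
lemma chartMetric_symm (x₀ : M) (z v w : E) :
    chartMetric I x₀ z v w = chartMetric I x₀ z w v :=
  real_inner_comm (F := TangentSpace I ((extChartAt I x₀).symm z)) _ _

/-- The metric in the chart around `x₀` as a function with values in bilinear forms. -/
def coordMetric (x₀ : M) (z : E) : E →L[ℝ] E →L[ℝ] ℝ :=
  (LinearMap.mk₂ ℝ (chartMetric I x₀ z) (chartMetric_add_left I x₀ z)
    (chartMetric_smul_left I x₀ z)
    (fun u v w ↦ by
      rw [chartMetric_symm, chartMetric_add_left, chartMetric_symm I x₀ z v,
        chartMetric_symm I x₀ z w])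
    (fun a u v ↦ by
      rw [chartMetric_symm, chartMetric_smul_left, chartMetric_symm I x₀ z v,
        smul_eq_mul])).toContinuousBilinearMap

lemma coordMetric_apply (x₀ : M) (z v w : E) :
    coordMetric I x₀ z v w = chartMetric I x₀ z v w := rfl

lemma coordMetric_symm (x₀ : M) (z v w : E) :
    coordMetric I x₀ z v w = coordMetric I x₀ z w v :=
  chartMetric_symm I x₀ z v w

variable [I.Boundaryless] [IsManifold I ∞ M]

lemma coordMetric_pos {x₀ : M} {z : E} (hz : z ∈ (extChartAt I x₀).target) {v : E} (hv : v ≠ 0) :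
    0 < coordMetric I x₀ z v v := by
  refine (real_inner_self_pos (F := TangentSpace I ((extChartAt I x₀).symm z))).2 fun h ↦ hv ?_
  exact chartSymmDeriv_injective I hz (h.trans (map_zero (chartSymmDeriv I x₀ z)).symm)

variable [IsContMDiffRiemannianBundle I ∞ E (fun x : M ↦ TangentSpace I x)]

lemma contDiffOn_coordMetric (x₀ : M) :
    ContDiffOn ℝ ∞ (coordMetric I x₀) (extChartAt I x₀).target := by
  rw [contDiffOn_clm_apply]
  intro v
  rw [contDiffOn_clm_apply]
  intro w
  rw [← contMDiffOn_iff_contDiffOn]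
  let V : E → ∀ z : E, TangentSpace I ((extChartAt I x₀).symm z) :=
    fun v z ↦ chartSymmDeriv I x₀ z v
  exact ContMDiffOn.inner_bundle (v := V v) (w := V w) (contMDiffOn_chartSymmDeriv I x₀ v)
    (contMDiffOn_chartSymmDeriv I x₀ w)

lemma chartMetricDeriv_eq {x₀ : M} {z : E} (hz : z ∈ (extChartAt I x₀).target) (u v w : E) :
    chartMetricDeriv I x₀ z u v w = fderiv ℝ (coordMetric I x₀) z u v w := by
  have h1 : HasFDerivAt (coordMetric I x₀) (fderiv ℝ (coordMetric I x₀) z) z :=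
    (((contDiffOn_coordMetric I x₀).contDiffAt
      ((isOpen_extChartAt_target x₀).mem_nhds hz)).differentiableAt (by simp)).hasFDerivAt
  have h2 := (h1.clm_apply (hasFDerivAt_const v z)).clm_apply (hasFDerivAt_const w z)
  have h3 : chartMetricDeriv I x₀ z u v w
      = fderiv ℝ (fun z ↦ coordMetric I x₀ z v w) z u := rfl
  rw [h3, h2.fderiv]
  simp

lemma christoffel_eq_leviForm {x₀ : M} {z : E} (hz : z ∈ (extChartAt I x₀).target) (u v w : E) :
    christoffel I x₀ z u v w = leviForm (fderiv ℝ (coordMetric I x₀) z) u v w := by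
  simp only [christoffel, leviForm, chartMetricDeriv_eq I hz]

omit [IsContMDiffRiemannianBundle I ∞ E (fun x : M ↦ TangentSpace I x)] in
lemma coordMetric_transition {x₀ x₁ : M} {z : E} (hz : z ∈ transitionDomain I x₀ x₁) (v w : E) :
    coordMetric I x₁ (transition I x₀ x₁ z) (fderiv ℝ (transition I x₀ x₁) z v)
      (fderiv ℝ (transition I x₀ x₁) z w) = coordMetric I x₀ z v w := by
  have key : ∀ (y y' : M) (hy : y = y') (a b : TangentSpace I y) (a' b' : TangentSpace I y'),
      (a : E) = a' → (b : E) = b' → inner ℝ a b = inner ℝ a' b' := by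
    rintro y _ rfl a b a' b' ha hb
    rw [show a = a' from ha, show b = b' from hb]
  refine key _ _ ?_ _ _ _ _ (chartSymmDeriv_transition I hz v) (chartSymmDeriv_transition I hz w)
  exact (extChartAt I x₁).left_inv hz.2

end ChartMetric

section Pullback

variable {E : Type*} [NormedAddCommGroup E] [NormedSpace ℝ E]

attribute [local instance] biformNormedAddCommGroup biformNormedSpace biformSeminormedAddCommGroup
  biformSeminormedAddGroup biformAddMonoid bilinNormedAddCommGroup bilinNormedSpace
  bilinSeminormedAddCommGroup bilinSeminormedAddGroup triformNormedAddCommGroup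
  triformNormedSpace triformSeminormedAddCommGroup triformAddMonoid

variable {g₀ g₁ : E → E →L[ℝ] E →L[ℝ] ℝ} {ψ : E → E} {z : E}

lemma fderiv_pullback (hψ : ContDiffAt ℝ 2 ψ z) (hg₁ : DifferentiableAt ℝ g₁ (ψ z))
    (hg₀ : DifferentiableAt ℝ g₀ z)
    (heq : ∀ᶠ y in 𝓝 z, ∀ v w, g₁ (ψ y) (fderiv ℝ ψ y v) (fderiv ℝ ψ y w) = g₀ y v w) (u v w : E) :
    fderiv ℝ g₀ z u v w
      = fderiv ℝ g₁ (ψ z) (fderiv ℝ ψ z u) (fderiv ℝ ψ z v) (fderiv ℝ ψ z w)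
        + g₁ (ψ z) (fderiv ℝ (fderiv ℝ ψ) z u v) (fderiv ℝ ψ z w)
        + g₁ (ψ z) (fderiv ℝ ψ z v) (fderiv ℝ (fderiv ℝ ψ) z u w) := by
  have hψ1 : HasFDerivAt ψ (fderiv ℝ ψ z) z := (hψ.differentiableAt (by simp)).hasFDerivAt
  have hψ2 : HasFDerivAt (fderiv ℝ ψ) (fderiv ℝ (fderiv ℝ ψ) z) z :=
    ((hψ.fderiv_right (m := 1) (by norm_num)).differentiableAt (by simp)).hasFDerivAt
  have h0 : HasFDerivAt (fun y ↦ g₀ y v w) _ z :=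
    (hg₀.hasFDerivAt.clm_apply (hasFDerivAt_const v z)).clm_apply (hasFDerivAt_const w z)
  have h1 : HasFDerivAt (fun y ↦ g₁ (ψ y) (fderiv ℝ ψ y v) (fderiv ℝ ψ y w)) _ z :=
    ((hg₁.hasFDerivAt.comp z hψ1).clm_apply (hψ2.clm_apply (hasFDerivAt_const v z))).clm_apply
      (hψ2.clm_apply (hasFDerivAt_const w z))
  have h2 := h0.unique (h1.congr_of_eventuallyEq (heq.mono fun y hy ↦ (hy v w).symm))
  have h3 := congrArg (fun f : E →L[ℝ] ℝ ↦ f u) h2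
  simp at h3
  rw [h3]
  ring

lemma leviForm_pullback (hψ : ContDiffAt ℝ 2 ψ z) (hg₁ : DifferentiableAt ℝ g₁ (ψ z))
    (hg₀ : DifferentiableAt ℝ g₀ z) (hsymm : ∀ v w, g₁ (ψ z) v w = g₁ (ψ z) w v)
    (heq : ∀ᶠ y in 𝓝 z, ∀ v w, g₁ (ψ y) (fderiv ℝ ψ y v) (fderiv ℝ ψ y w) = g₀ y v w) (u v w : E) :
    leviForm (fderiv ℝ g₀ z) u v w
      = leviForm (fderiv ℝ g₁ (ψ z)) (fderiv ℝ ψ z u) (fderiv ℝ ψ z v) (fderiv ℝ ψ z w)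
        + g₁ (ψ z) (fderiv ℝ (fderiv ℝ ψ) z u v) (fderiv ℝ ψ z w) := by
  have hs : IsSymmSndFDerivAt ℝ ψ z := hψ.isSymmSndFDerivAt (by simp)
  simp only [leviForm, fderiv_pullback hψ hg₁ hg₀ heq]
  rw [hs.eq v u, hs.eq w u, hs.eq w v,
    hsymm (fderiv ℝ ψ z v) (fderiv ℝ (fderiv ℝ ψ) z u w),
    hsymm (fderiv ℝ ψ z u) (fderiv ℝ (fderiv ℝ ψ) z v w)]
  ring

end Pullback

section Parallel

variable {E : Type*} [NormedAddCommGroup E] [NormedSpace ℝ E]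

attribute [local instance] biformNormedAddCommGroup biformNormedSpace biformSeminormedAddCommGroup
  biformSeminormedAddGroup biformAddMonoid bilinNormedAddCommGroup bilinNormedSpace
  bilinSeminormedAddCommGroup bilinSeminormedAddGroup triformNormedAddCommGroup
  triformNormedSpace triformSeminormedAddCommGroup triformAddMonoid

variable [FiniteDimensional ℝ E]
  {H : Type*} [TopologicalSpace H] {I : ModelWithCorners ℝ E H}
  {M : Type*} [EMetricSpace M] [ChartedSpace H M]
  [RiemannianBundle (fun x : M ↦ TangentSpace I x)]
  [I.Boundaryless] [IsManifold I ∞ M]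
  [IsContMDiffRiemannianBundle I ∞ E (fun x : M ↦ TangentSpace I x)]

lemma differentiableAt_coordMetric {x₀ : M} {z : E} (hz : z ∈ (extChartAt I x₀).target) :
    DifferentiableAt ℝ (coordMetric I x₀) z :=
  ((contDiffOn_coordMetric I x₀).contDiffAt
    ((isOpen_extChartAt_target x₀).mem_nhds hz)).differentiableAt (by simp)

lemma christoffel_transition {x₀ x₁ : M} {z : E} (hz : z ∈ transitionDomain I x₀ x₁) (u v w : E) :
    leviForm (fderiv ℝ (coordMetric I x₀) z) u v w
      = leviForm (fderiv ℝ (coordMetric I x₁) (transition I x₀ x₁ z))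
          (fderiv ℝ (transition I x₀ x₁) z u) (fderiv ℝ (transition I x₀ x₁) z v)
          (fderiv ℝ (transition I x₀ x₁) z w)
        + coordMetric I x₁ (transition I x₀ x₁ z)
          (fderiv ℝ (fderiv ℝ (transition I x₀ x₁)) z u v) (fderiv ℝ (transition I x₀ x₁) z w) := by
  have hnhds : transitionDomain I x₀ x₁ ∈ 𝓝 z := (isOpen_transitionDomain I x₀ x₁).mem_nhds hz
  refine leviForm_pullback ?_ ?_ ?_ (coordMetric_symm I x₁ _) ?_ u v w
  · exact ((contDiffOn_transition I x₀ x₁).contDiffAt hnhds).of_le ENat.LEInfty.out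
  · exact differentiableAt_coordMetric ((extChartAt I x₁).map_source hz.2)
  · exact differentiableAt_coordMetric hz.1
  · filter_upwards [hnhds] with y hy using coordMetric_transition I hy

/-- The equation of parallel fields in the chart around `x₀`. -/
def ParallelEquationAt (x₀ : M) (γ : ℝ → M) (V : ∀ t, TangentSpace I (γ t)) (t : ℝ) (c' ξ' : E) :
    Prop :=
  HasDerivWithinAt (fun s ↦ extChartAt I x₀ (γ s)) c' (Icc 0 1) t ∧
    HasDerivWithinAt (fun s ↦ chartDeriv I x₀ (γ s) (V s)) ξ' (Icc 0 1) t ∧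
    ∀ w : E, coordMetric I x₀ (extChartAt I x₀ (γ t)) ξ' w
      + leviForm (fderiv ℝ (coordMetric I x₀) (extChartAt I x₀ (γ t))) c'
          (chartDeriv I x₀ (γ t) (V t)) w = 0

lemma isParallelAlong_iff {γ : ℝ → M} {V : ∀ t, TangentSpace I (γ t)} :
    IsParallelAlong I γ V ↔ ∀ t ∈ Icc (0 : ℝ) 1, ∀ x₀ : M, γ t ∈ (extChartAt I x₀).source →
      ∃ c' ξ' : E, ParallelEquationAt x₀ γ V t c' ξ' := by
  refine forall₂_congr fun t ht ↦ forall_congr' fun x₀ ↦ ?_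
  rw [extChartAt_source]
  refine forall_congr' fun hx ↦ exists₂_congr fun c' ξ' ↦ and_congr_right fun _ ↦
    and_congr_right fun _ ↦ forall_congr' fun w ↦ ?_
  have hz : extChartAt I x₀ (γ t) ∈ (extChartAt I x₀).target :=
    (extChartAt I x₀).map_source (by rwa [extChartAt_source])
  rw [← christoffel_eq_leviForm I hz, coordMetric_apply]
  rfl

/-- The equation of parallel fields does not depend on the chart. -/
lemma ParallelEquationAt.change_chart {x₀ x₁ : M} {γ : ℝ → M} {V : ∀ t, TangentSpace I (γ t)}
    {t : ℝ} (ht : t ∈ Icc (0 : ℝ) 1) {c' ξ' : E} (h : ParallelEquationAt x₀ γ V t c' ξ')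
    (hγ : ∀ s ∈ Icc (0 : ℝ) 1, γ s ∈ (extChartAt I x₀).source)
    (hx₁ : γ t ∈ (extChartAt I x₁).source) :
    ∃ d' η' : E, ParallelEquationAt x₁ γ V t d' η' := by
  obtain ⟨hc, hξ, heq⟩ := h
  set c : ℝ → E := fun s ↦ extChartAt I x₀ (γ s) with hc_def
  set ξ : ℝ → E := fun s ↦ chartDeriv I x₀ (γ s) (V s) with hξ_def
  have hinv : ∀ s ∈ Icc (0 : ℝ) 1, (extChartAt I x₀).symm (c s) = γ s := fun s hs ↦
    (extChartAt I x₀).left_inv (hγ s hs)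
  have hz : c t ∈ transitionDomain I x₀ x₁ :=
    ⟨(extChartAt I x₀).map_source (hγ t ht), by rwa [mem_preimage, hinv t ht]⟩
  have hnhds : transitionDomain I x₀ x₁ ∈ 𝓝 (c t) := (isOpen_transitionDomain I x₀ x₁).mem_nhds hz
  have hψ : ContDiffAt ℝ 2 (transition I x₀ x₁) (c t) :=
    ((contDiffOn_transition I x₀ x₁).contDiffAt hnhds).of_le ENat.LEInfty.out
  have hψ1 : HasFDerivAt (transition I x₀ x₁) (fderiv ℝ (transition I x₀ x₁) (c t)) (c t) :=
    (hψ.differentiableAt (by simp)).hasFDerivAt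
  have hψ2 : HasFDerivAt (fderiv ℝ (transition I x₀ x₁))
      (fderiv ℝ (fderiv ℝ (transition I x₀ x₁)) (c t)) (c t) :=
    ((hψ.fderiv_right (m := 1) (by norm_num)).differentiableAt (by simp)).hasFDerivAt
  have hev : ∀ᶠ s in 𝓝[Icc (0 : ℝ) 1] t, c s ∈ transitionDomain I x₀ x₁ :=
    hc.continuousWithinAt.eventually_mem hnhds
  have e1 : ∀ s ∈ Icc (0 : ℝ) 1, extChartAt I x₁ (γ s) = transition I x₀ x₁ (c s) := by
    intro s hs
    rw [transition, hinv s hs]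
  have e2 : ∀ s ∈ Icc (0 : ℝ) 1, c s ∈ transitionDomain I x₀ x₁ → ∀ a : E,
      chartDeriv I x₁ (γ s) a = fderiv ℝ (transition I x₀ x₁) (c s) (chartDeriv I x₀ (γ s) a) := by
    intro s hs hcs a
    rw [fderiv_transition I hcs, ContinuousLinearMap.comp_apply, hinv s hs]
    congr 1
    exact (chartSymmDeriv_chartDeriv_apply I (hγ s hs) a).symm
  refine ⟨fderiv ℝ (transition I x₀ x₁) (c t) c',
    fderiv ℝ (fderiv ℝ (transition I x₀ x₁)) (c t) c' (ξ t)
      + fderiv ℝ (transition I x₀ x₁) (c t) ξ', ?_, ?_, ?_⟩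
  · exact (hψ1.comp_hasDerivWithinAt t hc).congr e1 (e1 t ht)
  · have h1 := (hψ2.comp_hasDerivWithinAt t hc).clm_apply hξ
    refine h1.congr_of_eventuallyEq ?_ (e2 t ht hz (V t))
    filter_upwards [hev, self_mem_nhdsWithin] with s hs hs' using e2 s hs' hs (V s)
  · intro w
    obtain ⟨w₀, rfl⟩ : ∃ w₀, fderiv ℝ (transition I x₀ x₁) (c t) w₀ = w := by
      refine ⟨chartDeriv I x₀ (γ t) (chartSymmDeriv I x₁ (extChartAt I x₁ (γ t)) w), ?_⟩
      rw [← e2 t ht hz]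
      exact chartDeriv_chartSymmDeriv_apply' I hx₁ w
    rw [e1 t ht, e2 t ht hz (V t), map_add, add_apply, coordMetric_transition I hz]
    have h1 := heq w₀
    rw [christoffel_transition hz] at h1
    linarith

lemma isParallelAlong_of_chart {x₀ : M} {γ : ℝ → M} {V : ∀ t, TangentSpace I (γ t)} {c' ξ' : ℝ → E}
    (hγ : ∀ s ∈ Icc (0 : ℝ) 1, γ s ∈ (extChartAt I x₀).source)
    (h : ∀ t ∈ Icc (0 : ℝ) 1, ParallelEquationAt x₀ γ V t (c' t) (ξ' t)) :
    IsParallelAlong I γ V :=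
  isParallelAlong_iff.2 fun t ht _ hx₁ ↦ (h t ht).change_chart ht hγ hx₁

lemma IsParallelAlong.exists_chart {x₀ : M} {γ : ℝ → M} {V : ∀ t, TangentSpace I (γ t)}
    (h : IsParallelAlong I γ V) (hγ : ∀ s ∈ Icc (0 : ℝ) 1, γ s ∈ (extChartAt I x₀).source) :
    ∃ c' ξ' : ℝ → E, ∀ t ∈ Icc (0 : ℝ) 1, ParallelEquationAt x₀ γ V t (c' t) (ξ' t) := by
  have h1 : ∀ t : ℝ, ∃ c' ξ' : E, t ∈ Icc (0 : ℝ) 1 → ParallelEquationAt x₀ γ V t c' ξ' := by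
    intro t
    by_cases ht : t ∈ Icc (0 : ℝ) 1
    · obtain ⟨c', ξ', h'⟩ := isParallelAlong_iff.1 h t ht x₀ (hγ t ht)
      exact ⟨c', ξ', fun _ ↦ h'⟩
    · exact ⟨0, 0, fun h' ↦ absurd h' ht⟩
  choose c' ξ' h2 using h1
  exact ⟨c', ξ', fun t ht ↦ h2 t ht⟩

omit [FiniteDimensional ℝ E] [I.Boundaryless] [IsManifold I ∞ M]
  [IsContMDiffRiemannianBundle I ∞ E (fun x : M ↦ TangentSpace I x)] in
lemma IsParallelAlong.congr {γ : ℝ → M} {V W : ∀ t, TangentSpace I (γ t)}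
    (h : IsParallelAlong I γ V) (hVW : ∀ t ∈ Icc (0 : ℝ) 1, W t = V t) : IsParallelAlong I γ W := by
  intro t ht x₀ hx₀
  obtain ⟨c', ξ', hc, hξ, heq⟩ := h t ht x₀ hx₀
  refine ⟨c', ξ', hc, hξ.congr (fun s hs ↦ by rw [hVW s hs]) (by rw [hVW t ht]), fun w ↦ ?_⟩
  rw [hVW t ht]
  exact heq w

omit [IsContMDiffRiemannianBundle I ∞ E (fun x : M ↦ TangentSpace I x)] [I.Boundaryless]
  [IsManifold I ∞ M] [FiniteDimensional ℝ E] [RiemannianBundle (fun x : M ↦ TangentSpace I x)] in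
lemma hasDerivWithinAt_comp_one_sub {c : ℝ → E} {c' : E} {t : ℝ}
    (hc : HasDerivWithinAt c c' (Icc 0 1) (1 - t)) :
    HasDerivWithinAt (fun s ↦ c (1 - s)) (-c') (Icc 0 1) t := by
  have h1 : HasDerivWithinAt (fun s : ℝ ↦ 1 - s) (-1) (Icc 0 1) t :=
    ((hasDerivAt_id t).const_sub 1).hasDerivWithinAt
  have h2 := hc.scomp t h1 (fun s hs ↦ ⟨by linarith [hs.2], by linarith [hs.1]⟩)
  simpa [Function.comp_def] using h2

lemma IsParallelAlong.reverse {γ : ℝ → M} {V : ∀ t, TangentSpace I (γ t)}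
    (h : IsParallelAlong I γ V) :
    IsParallelAlong I (fun t ↦ γ (1 - t)) (fun t ↦ V (1 - t)) := by
  rw [isParallelAlong_iff] at h ⊢
  intro t ht x₀ hx₀
  have ht' : 1 - t ∈ Icc (0 : ℝ) 1 := ⟨by linarith [ht.2], by linarith [ht.1]⟩
  obtain ⟨c', ξ', hc, hξ, heq⟩ := h (1 - t) ht' x₀ hx₀
  refine ⟨-c', -ξ', hasDerivWithinAt_comp_one_sub hc, hasDerivWithinAt_comp_one_sub hξ,
    fun w ↦ ?_⟩
  have := heq w
  simp only [leviForm, map_neg, neg_apply] at this ⊢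
  linarith

lemma IsParallelAlong.neg {γ : ℝ → M} {V : ∀ t, TangentSpace I (γ t)}
    (h : IsParallelAlong I γ V) : IsParallelAlong I γ (fun t ↦ -V t) := by
  rw [isParallelAlong_iff] at h ⊢
  intro t ht x₀ hx₀
  obtain ⟨c', ξ', hc, hξ, heq⟩ := h t ht x₀ hx₀
  have e : ∀ s, chartDeriv I x₀ (γ s) (-V s) = -chartDeriv I x₀ (γ s) (V s) := fun s ↦
    map_neg (chartDeriv I x₀ (γ s)) (V s)
  refine ⟨c', -ξ', hc, ?_, fun w ↦ ?_⟩
  · exact hξ.neg.congr (fun s _ ↦ e s) (e t)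
  · have := heq w
    rw [e]
    simp only [leviForm, map_neg, neg_apply] at this ⊢
    linarith

end Parallel

section Length

variable {E : Type*} [NormedAddCommGroup E] [NormedSpace ℝ E]

open MeasureTheory

attribute [local instance] biformNormedAddCommGroup biformNormedSpace biformSeminormedAddCommGroup
  biformSeminormedAddGroup biformAddMonoid bilinNormedAddCommGroup bilinNormedSpace
  bilinSeminormedAddCommGroup bilinSeminormedAddGroup triformNormedAddCommGroup
  triformNormedSpace triformSeminormedAddCommGroup triformAddMonoid

namespace MetricControl

variable {g : E → E →L[ℝ] E →L[ℝ] ℝ} {B : E → E →L[ℝ] E →L[ℝ] E} {z₀ : E} {r lam C : ℝ}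

lemma apply_self_nonneg (h : MetricControl g B z₀ r lam C) {z : E} (hz : z ∈ Metric.ball z₀ r)
    (v : E) : 0 ≤ g z v v :=
  le_trans (mul_nonneg h.lam_pos.le (sq_nonneg _)) (h.lower z hz v)

lemma continuousOn_energy_density (h : MetricControl g B z₀ r lam C) {c w : ℝ → E} {s : Set ℝ}
    (hc : ContinuousOn c s) (hw : ContinuousOn w s) (hz : ∀ t ∈ s, c t ∈ Metric.ball z₀ r) :
    ContinuousOn (fun t ↦ g (c t) (w t) (w t)) s :=
  ((h.continuousOn.comp hc hz).clm_apply hw).clm_apply hw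

/-- Slow geodesics minimize the energy below the squared length of any other curve. -/
lemma energy_le_length_sq [CompleteSpace E] (h : MetricControl g B z₀ r lam C) {ρ : ℝ} (hρ : 0 ≤ ρ)
    (hsmall : 2 * C * ρ + C * ρ ^ 2 ≤ lam / 2) {c v v' c₁ w : ℝ → E}
    (hc : ∀ t ∈ Icc (0 : ℝ) 1, HasDerivWithinAt c (v t) (Icc 0 1) t)
    (hv : ∀ t ∈ Icc (0 : ℝ) 1, HasDerivWithinAt v (v' t) (Icc 0 1) t)
    (hz : ∀ t ∈ Icc (0 : ℝ) 1, c t ∈ Metric.ball z₀ r)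
    (hgeo : ∀ t ∈ Icc (0 : ℝ) 1, ∀ w, g (c t) (v' t) w
      + leviForm (fderiv ℝ g (c t)) (v t) (v t) w = 0)
    (hvρ : ∀ t ∈ Icc (0 : ℝ) 1, ‖v t‖ ≤ ρ)
    (hc₁ : ∀ t ∈ Icc (0 : ℝ) 1, HasDerivWithinAt c₁ (w t) (Icc 0 1) t)
    (hw : ContinuousOn w (Icc 0 1))
    (hz₁ : ∀ t ∈ Icc (0 : ℝ) 1, c₁ t ∈ Metric.ball z₀ r) (h0 : c₁ 0 = c 0) (h1 : c₁ 1 = c 1) :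
    ∫ t in (0 : ℝ)..1, g (c t) (v t) (v t) ≤ (∫ t in (0 : ℝ)..1, √(g (c₁ t) (w t) (w t))) ^ 2 := by
  set L := ∫ t in (0 : ℝ)..1, √(g (c₁ t) (w t) (w t)) with hL
  have hL0 : 0 ≤ L := intervalIntegral.integral_nonneg zero_le_one fun t _ ↦ Real.sqrt_nonneg _
  have key : ∀ δ > 0, ∫ t in (0 : ℝ)..1, g (c t) (v t) (v t) ≤ (L + δ) ^ 2 := by
    intro δ hδ
    have hcc₁ : ContinuousOn c₁ (Icc 0 1) := HasDerivWithinAt.continuousOn hc₁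
    obtain ⟨σ, σ', hσ0, hσ1, hσc', hσd, hσm, hσ⟩ := exists_reparametrization
      (f := fun t ↦ √(g (c₁ t) (w t) (w t))) (h.continuousOn_energy_density hcc₁ hw hz₁).sqrt
      (fun t _ ↦ Real.sqrt_nonneg _) hδ
    have hσc : ContinuousOn σ (Icc 0 1) :=
      (continuous_iff_continuousAt.2 fun t ↦ (hσd t).continuousAt).continuousOn
    have hwσ : ContinuousOn (fun t ↦ σ' t • w (σ t)) (Icc 0 1) :=
      hσc'.continuousOn.smul (hw.comp hσc hσm)
    have hd : ∀ t ∈ Icc (0 : ℝ) 1,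
        HasDerivWithinAt (fun t ↦ c₁ (σ t)) (σ' t • w (σ t)) (Icc 0 1) t := fun t ht ↦
      (hc₁ (σ t) (hσm ht)).scomp t (hσd t).hasDerivWithinAt hσm
    have hzσ : ∀ t ∈ Icc (0 : ℝ) 1, c₁ (σ t) ∈ Metric.ball z₀ r := fun t ht ↦ hz₁ _ (hσm ht)
    have e1 := h.energy_add_le hρ hsmall hc hv hz hgeo hvρ hd hwσ hzσ (by rw [hσ0, h0])
      (by rw [hσ1, h1])
    have e2 : 0 ≤ lam / 2 * ∫ t in (0 : ℝ)..1, ‖σ' t • w (σ t) - v t‖ ^ 2 :=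
      mul_nonneg (by linarith [h.lam_pos])
        (intervalIntegral.integral_nonneg zero_le_one fun t _ ↦ sq_nonneg _)
    have e3 : ∫ t in (0 : ℝ)..1, g (c₁ (σ t)) (σ' t • w (σ t)) (σ' t • w (σ t))
        ≤ ∫ t in (0 : ℝ)..1, (L + δ) ^ 2 := by
      refine intervalIntegral.integral_mono_on zero_le_one ?_ (by simp) fun t ht ↦ ?_
      · refine ContinuousOn.intervalIntegrable ?_
        rw [uIcc_of_le zero_le_one]
        exact h.continuousOn_energy_density (hcc₁.comp hσc hσm) hwσ hzσ
      · have e4 : g (c₁ (σ t)) (σ' t • w (σ t)) (σ' t • w (σ t))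
            = (σ' t * √(g (c₁ (σ t)) (w (σ t)) (w (σ t)))) ^ 2 := by
          rw [mul_pow, Real.sq_sqrt (h.apply_self_nonneg (hzσ t ht) _)]
          simp only [map_smul, smul_apply, smul_eq_mul]
          ring
        rw [e4]
        exact pow_le_pow_left₀ (mul_nonneg (hσ t ht).1 (Real.sqrt_nonneg _)) (hσ t ht).2 2
    simp only [intervalIntegral.integral_const, sub_zero, one_smul] at e3
    linarith
  have hlim : Tendsto (fun δ : ℝ ↦ (L + δ) ^ 2) (𝓝[>] 0) (𝓝 (L ^ 2)) := by
    have : ContinuousAt (fun δ : ℝ ↦ (L + δ) ^ 2) 0 := by fun_prop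
    have h2 := this.tendsto
    simp only [add_zero] at h2
    exact h2.mono_left nhdsWithin_le_nhds
  exact ge_of_tendsto hlim (by filter_upwards [self_mem_nhdsWithin] with δ hδ using key δ hδ)

lemma length_sq_le_energy (h : MetricControl g B z₀ r lam C) {c w : ℝ → E}
    (hc : ContinuousOn c (Icc 0 1)) (hw : ContinuousOn w (Icc 0 1))
    (hz : ∀ t ∈ Icc (0 : ℝ) 1, c t ∈ Metric.ball z₀ r) :
    (∫ t in (0 : ℝ)..1, √(g (c t) (w t) (w t))) ^ 2 ≤ ∫ t in (0 : ℝ)..1, g (c t) (w t) (w t) := by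
  refine (sq_intervalIntegral_le (h.continuousOn_energy_density hc hw hz).sqrt).trans (le_of_eq ?_)
  refine intervalIntegral.integral_congr fun t ht ↦ ?_
  rw [uIcc_of_le zero_le_one] at ht
  exact Real.sq_sqrt (h.apply_self_nonneg (hz t ht) _)

/-- A geodesic which is not longer than a slow geodesic with the same endpoints coincides
with it. -/
lemma eqOn_of_length_le [CompleteSpace E] (h : MetricControl g B z₀ r lam C) {ρ : ℝ} (hρ : 0 ≤ ρ)
    (hsmall : 2 * C * ρ + C * ρ ^ 2 ≤ lam / 2) {c v v' c₁ w w' : ℝ → E}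
    (hc : ∀ t ∈ Icc (0 : ℝ) 1, HasDerivWithinAt c (v t) (Icc 0 1) t)
    (hv : ∀ t ∈ Icc (0 : ℝ) 1, HasDerivWithinAt v (v' t) (Icc 0 1) t)
    (hz : ∀ t ∈ Icc (0 : ℝ) 1, c t ∈ Metric.ball z₀ r)
    (hgeo : ∀ t ∈ Icc (0 : ℝ) 1, ∀ w, g (c t) (v' t) w
      + leviForm (fderiv ℝ g (c t)) (v t) (v t) w = 0)
    (hvρ : ∀ t ∈ Icc (0 : ℝ) 1, ‖v t‖ ≤ ρ)
    (hc₁ : ∀ t ∈ Icc (0 : ℝ) 1, HasDerivWithinAt c₁ (w t) (Icc 0 1) t)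
    (hw : ∀ t ∈ Icc (0 : ℝ) 1, HasDerivWithinAt w (w' t) (Icc 0 1) t)
    (hz₁ : ∀ t ∈ Icc (0 : ℝ) 1, c₁ t ∈ Metric.ball z₀ r)
    (hgeo₁ : ∀ t ∈ Icc (0 : ℝ) 1, ∀ u, g (c₁ t) (w' t) u
      + leviForm (fderiv ℝ g (c₁ t)) (w t) (w t) u = 0)
    (h0 : c₁ 0 = c 0) (h1 : c₁ 1 = c 1)
    (hle : ∫ t in (0 : ℝ)..1, √(g (c₁ t) (w t) (w t)) ≤ ∫ t in (0 : ℝ)..1, √(g (c t) (v t) (v t))) :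
    EqOn c₁ c (Icc 0 1) := by
  have hcc : ContinuousOn c (Icc 0 1) := HasDerivWithinAt.continuousOn hc
  have hvc : ContinuousOn v (Icc 0 1) := HasDerivWithinAt.continuousOn hv
  have hwc : ContinuousOn w (Icc 0 1) := HasDerivWithinAt.continuousOn hw
  have e1 := h.energy_add_le hρ hsmall hc hv hz hgeo hvρ hc₁ hwc hz₁ h0 h1
  have e2 := h.length_sq_le_energy hcc hvc hz
  have h00 : (0 : ℝ) ∈ Icc (0 : ℝ) 1 := ⟨le_rfl, zero_le_one⟩
  have e3 : ∫ t in (0 : ℝ)..1, g (c₁ t) (w t) (w t) = g (c₁ 0) (w 0) (w 0) := by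
    rw [intervalIntegral.integral_congr (g := fun _ ↦ g (c₁ 0) (w 0) (w 0))]
    · simp
    · intro t ht
      rw [uIcc_of_le zero_le_one] at ht
      exact h.speed_eq hc₁ hw hz₁ hgeo₁ ht
  have e4 : ∫ t in (0 : ℝ)..1, √(g (c₁ t) (w t) (w t)) = √(g (c₁ 0) (w 0) (w 0)) := by
    rw [intervalIntegral.integral_congr (g := fun _ ↦ √(g (c₁ 0) (w 0) (w 0)))]
    · simp
    · intro t ht
      rw [uIcc_of_le zero_le_one] at ht
      simp only
      rw [h.speed_eq hc₁ hw hz₁ hgeo₁ ht]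
  have e5 : √(g (c₁ 0) (w 0) (w 0)) ^ 2 = g (c₁ 0) (w 0) (w 0) :=
    Real.sq_sqrt (h.apply_self_nonneg (hz₁ 0 h00) _)
  have e6 := pow_le_pow_left₀ (Real.sqrt_nonneg _) (e4 ▸ hle) 2
  have hS : ∫ t in (0 : ℝ)..1, ‖w t - v t‖ ^ 2 ≤ 0 := by
    have := h.lam_pos
    by_contra hcon
    push Not at hcon
    have : 0 < lam / 2 * ∫ t in (0 : ℝ)..1, ‖w t - v t‖ ^ 2 := by positivity
    linarith
  intro t ht
  have e7 := (sq_norm_le_integral_of_eq_zero (η := fun t ↦ c₁ t - c t)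
    (fun t ht ↦ (hc₁ t ht).sub (hc t ht)) (hwc.sub hvc) (by simp [h0]) ht).trans hS
  have e8 : ‖c₁ t - c t‖ = 0 := by nlinarith [norm_nonneg (c₁ t - c t), sq_nonneg ‖c₁ t - c t‖]
  exact sub_eq_zero.1 (norm_eq_zero.1 e8)

end MetricControl

variable [FiniteDimensional ℝ E]
  {H : Type*} [TopologicalSpace H] {I : ModelWithCorners ℝ E H}
  {M : Type*} [EMetricSpace M] [ChartedSpace H M]
  [RiemannianBundle (fun x : M ↦ TangentSpace I x)]
  [I.Boundaryless] [IsManifold I ∞ M]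

omit [I.Boundaryless] [FiniteDimensional ℝ E] [RiemannianBundle (fun x : M ↦ TangentSpace I x)] in
/-- The coordinate expression of a `C^1` curve and of its velocity. -/
lemma exists_coord_velocity {x₀ : M} {γ : ℝ → M}
    (hγ : ContMDiffOn 𝓘(ℝ, ℝ) I 1 γ (Icc 0 1))
    (hs : ∀ t ∈ Icc (0 : ℝ) 1, γ t ∈ (extChartAt I x₀).source) :
    ∃ w : ℝ → E, ContinuousOn w (Icc 0 1) ∧ ∀ t ∈ Icc (0 : ℝ) 1,
      HasDerivWithinAt (fun s ↦ extChartAt I x₀ (γ s)) (w t) (Icc 0 1) t ∧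
      chartDeriv I x₀ (γ t) (mfderivWithin 𝓘(ℝ, ℝ) I γ (Icc 0 1) t (1 : ℝ)) = w t := by
  have hu : UniqueDiffOn ℝ (Icc (0 : ℝ) 1) := uniqueDiffOn_Icc zero_lt_one
  have hs' : ∀ t ∈ Icc (0 : ℝ) 1, γ t ∈ (chartAt H x₀).source := fun t ht ↦ by
    simpa [extChartAt_source] using hs t ht
  have hc : ContDiffOn ℝ 1 (fun s ↦ extChartAt I x₀ (γ s)) (Icc 0 1) := by
    rw [← contMDiffOn_iff_contDiffOn]
    exact contMDiffOn_extChartAt.comp hγ hs'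
  refine ⟨derivWithin (fun s ↦ extChartAt I x₀ (γ s)) (Icc 0 1),
    hc.continuousOn_derivWithin hu le_rfl, fun t ht ↦ ⟨?_, ?_⟩⟩
  · exact ((hc.differentiableOn one_ne_zero) t ht).hasDerivWithinAt
  · have h1 : mfderivWithin 𝓘(ℝ, ℝ) 𝓘(ℝ, E) (fun s ↦ extChartAt I x₀ (γ s)) (Icc 0 1) t
        = (mfderiv I 𝓘(ℝ, E) (extChartAt I x₀) (γ t)).comp
          (mfderivWithin 𝓘(ℝ, ℝ) I γ (Icc 0 1) t) := by
      refine mfderiv_comp_mfderivWithin t (mdifferentiableAt_extChartAt (hs' t ht))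
        (hγ.mdifferentiableOn one_ne_zero t ht) ?_
      exact (hu t ht).uniqueMDiffWithinAt
    rw [mfderivWithin_eq_fderivWithin] at h1
    rw [← fderivWithin_derivWithin, h1]
    rfl

omit [I.Boundaryless] [FiniteDimensional ℝ E] [IsManifold I ∞ M] in
lemma inner_congr_point {y y' : M} (hy : y = y') {a b : TangentSpace I y} {a' b' : TangentSpace I y'}
    (ha : (a : E) = a') (hb : (b : E) = b') : inner ℝ a b = inner ℝ a' b' := by
  subst hy
  rw [show a = a' from ha, show b = b' from hb]

/-- The norm of a tangent vector in terms of the metric in a chart. -/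
lemma enorm_eq_sqrt_coordMetric {x₀ y : M} (hy : y ∈ (extChartAt I x₀).source)
    (a : TangentSpace I y) :
    ‖a‖ₑ = ENNReal.ofReal
      √(coordMetric I x₀ (extChartAt I x₀ y) (chartDeriv I x₀ y a) (chartDeriv I x₀ y a)) := by
  rw [← ofReal_norm]
  congr 1
  rw [norm_eq_sqrt_real_inner]
  congr 1
  exact inner_congr_point ((extChartAt I x₀).left_inv hy).symm
    (chartSymmDeriv_chartDeriv_apply I hy a).symm (chartSymmDeriv_chartDeriv_apply I hy a).symm

/-- The length of a curve computed in a chart. -/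
lemma pathELength_eq_ofReal {B : E → E →L[ℝ] E →L[ℝ] E} {x₀ : M} {r lam C : ℝ}
    (h : MetricControl (coordMetric I x₀) B (extChartAt I x₀ x₀) r lam C) {γ : ℝ → M} {w : ℝ → E}
    (hs : ∀ t ∈ Icc (0 : ℝ) 1, γ t ∈ (extChartAt I x₀).source)
    (hz : ∀ t ∈ Icc (0 : ℝ) 1, extChartAt I x₀ (γ t) ∈ Metric.ball (extChartAt I x₀ x₀) r)
    (hc : ContinuousOn (fun t ↦ extChartAt I x₀ (γ t)) (Icc 0 1)) (hwc : ContinuousOn w (Icc 0 1))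
    (hw : ∀ t ∈ Icc (0 : ℝ) 1,
      chartDeriv I x₀ (γ t) (mfderivWithin 𝓘(ℝ, ℝ) I γ (Icc 0 1) t (1 : ℝ)) = w t) :
    pathELength I γ 0 1 = ENNReal.ofReal
      (∫ t in (0 : ℝ)..1, √(coordMetric I x₀ (extChartAt I x₀ (γ t)) (w t) (w t))) := by
  rw [pathELength_eq_lintegral_mfderivWithin_Icc]
  have hcont : ContinuousOn (fun t ↦ √(coordMetric I x₀ (extChartAt I x₀ (γ t)) (w t) (w t)))
      (Icc 0 1) := (h.continuousOn_energy_density hc hwc hz).sqrt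
  rw [intervalIntegral.integral_of_le zero_le_one, ← integral_Icc_eq_integral_Ioc,
    ofReal_integral_eq_lintegral_ofReal (hcont.integrableOn_compact isCompact_Icc)
      (Eventually.of_forall fun t ↦ Real.sqrt_nonneg _)]
  refine setLIntegral_congr_fun measurableSet_Icc fun t ht ↦ ?_
  exact (enorm_eq_sqrt_coordMetric (hs t ht) _).trans (congrArg (fun u : E ↦
    ENNReal.ofReal √(coordMetric I x₀ (extChartAt I x₀ (γ t)) u u)) (hw t ht))

omit [FiniteDimensional ℝ E] [I.Boundaryless] in
lemma edist_le_pathELength [IsRiemannianManifold I M]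
    [IsContMDiffRiemannianBundle I ∞ E (fun x : M ↦ TangentSpace I x)] {γ : ℝ → M}
    (hγ : ContMDiffOn 𝓘(ℝ, ℝ) I 1 γ (Icc 0 1)) {t : ℝ} (ht : t ∈ Icc (0 : ℝ) 1) :
    edist (γ 0) (γ t) ≤ pathELength I γ 0 1 := by
  rw [IsRiemannianManifold.out (I := I) (γ 0) (γ t)]
  exact (riemannianEDist_le_pathELength (hγ.mono (Icc_subset_Icc_right ht.2)) rfl rfl ht.1).trans
    (pathELength_mono le_rfl ht.2)

end Length

section LocalGeometry

variable {E : Type*} [NormedAddCommGroup E] [NormedSpace ℝ E]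

open MeasureTheory

attribute [local instance] biformNormedAddCommGroup biformNormedSpace biformSeminormedAddCommGroup
  biformSeminormedAddGroup biformAddMonoid bilinNormedAddCommGroup bilinNormedSpace
  bilinSeminormedAddCommGroup bilinSeminormedAddGroup triformNormedAddCommGroup
  triformNormedSpace triformSeminormedAddCommGroup triformAddMonoid

variable [FiniteDimensional ℝ E]
  {H : Type*} [TopologicalSpace H] {I : ModelWithCorners ℝ E H}
  {M : Type*} [EMetricSpace M] [ChartedSpace H M]
  [RiemannianBundle (fun x : M ↦ TangentSpace I x)]
  [I.Boundaryless] [IsManifold I ∞ M]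
  [IsContMDiffRiemannianBundle I ∞ E (fun x : M ↦ TangentSpace I x)]

/-- The chart around `p` has a controlled metric on a ball of radius `r`, whose preimage contains
the ball of radius `R` around `p`. -/
structure ChartControl (I : ModelWithCorners ℝ E H) [RiemannianBundle (fun x : M ↦ TangentSpace I x)]
    (p : M) (B : E → E →L[ℝ] E →L[ℝ] E) (r lam C R : ℝ) : Prop where
  metric : MetricControl (coordMetric I p) B (extChartAt I p p) r lam C
  ball_subset : Metric.ball (extChartAt I p p) r ⊆ (extChartAt I p).target
  R_pos : 0 < R
  mem_source : ∀ y, edist p y < ENNReal.ofReal R → y ∈ (extChartAt I p).source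
  mem_ball : ∀ y, edist p y < ENNReal.ofReal R →
    extChartAt I p y ∈ Metric.ball (extChartAt I p p) r

lemma exists_chartControl (p : M) : ∃ (B : E → E →L[ℝ] E →L[ℝ] E) (r lam C R : ℝ),
    ChartControl I p B r lam C R := by
  have hp : extChartAt I p p ∈ (extChartAt I p).target := mem_extChartAt_target p
  have hopen : (extChartAt I p).target ∈ 𝓝 (extChartAt I p p) :=
    (isOpen_extChartAt_target p).mem_nhds hp
  obtain ⟨B, r, lam, C, h⟩ := exists_metricControl (g := coordMetric I p) (z₀ := extChartAt I p p)
    ((contDiffOn_coordMetric I p).contDiffAt hopen)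
    (Eventually.of_forall fun z ↦ coordMetric_symm I p z) (fun v hv ↦ coordMetric_pos I hp hv)
  obtain ⟨r', hr', hsub⟩ := Metric.mem_nhds_iff.1 hopen
  have hr : 0 < min r r' := lt_min h.r_pos hr'
  have h1 : ∀ᶠ y in 𝓝 p, y ∈ (extChartAt I p).source ∧
      extChartAt I p y ∈ Metric.ball (extChartAt I p p) (min r r') :=
    Filter.Eventually.and (extChartAt_source_mem_nhds p)
      ((continuousAt_extChartAt p).eventually_mem (Metric.ball_mem_nhds _ hr))
  obtain ⟨R, hR, hRsub⟩ := EMetric.mem_nhds_iff.1 h1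
  obtain ⟨R', hR', hR'R⟩ := ENNReal.lt_iff_exists_real_btwn.1 hR
  have hR'0 : 0 < R' := ENNReal.ofReal_pos.1 hR'R.1
  have h2 : ∀ y, edist p y < ENNReal.ofReal R' → y ∈ (extChartAt I p).source ∧
      extChartAt I p y ∈ Metric.ball (extChartAt I p p) (min r r') := fun y hy ↦
    hRsub (by rw [Metric.mem_eball, edist_comm]; exact hy.trans hR'R.2)
  exact ⟨B, min r r', lam, C, R', h.mono hr (min_le_left _ _),
    (Metric.ball_subset_ball (min_le_right _ _)).trans hsub, hR'0, fun y hy ↦ (h2 y hy).1,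
    fun y hy ↦ (h2 y hy).2⟩

/-- The coordinate expression of a geodesic. -/
lemma IsGeodesic.exists_coord {x₀ : M} {γ : ℝ → M} (hγ : IsGeodesic I γ)
    (hs : ∀ t ∈ Icc (0 : ℝ) 1, γ t ∈ (extChartAt I x₀).source) :
    ∃ w w' : ℝ → E,
      (∀ t ∈ Icc (0 : ℝ) 1, HasDerivWithinAt (fun s ↦ extChartAt I x₀ (γ s)) (w t) (Icc 0 1) t) ∧
      (∀ t ∈ Icc (0 : ℝ) 1, HasDerivWithinAt w (w' t) (Icc 0 1) t) ∧
      (∀ t ∈ Icc (0 : ℝ) 1,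
        chartDeriv I x₀ (γ t) (mfderivWithin 𝓘(ℝ, ℝ) I γ (Icc 0 1) t (1 : ℝ)) = w t) ∧
      (∀ t ∈ Icc (0 : ℝ) 1, ∀ u, coordMetric I x₀ (extChartAt I x₀ (γ t)) (w' t) u
        + leviForm (fderiv ℝ (coordMetric I x₀) (extChartAt I x₀ (γ t))) (w t) (w t) u = 0) := by
  obtain ⟨w, hwc, hw⟩ := exists_coord_velocity hγ.contMDiffOn hs
  obtain ⟨c', w', h⟩ := hγ.parallel_velocity.exists_chart hs
  refine ⟨w, w', fun t ht ↦ (hw t ht).1, fun t ht ↦ ?_, fun t ht ↦ (hw t ht).2, fun t ht u ↦ ?_⟩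
  · exact (h t ht).2.1.congr (fun s hs ↦ (hw s hs).2.symm) (hw t ht).2.symm
  · have h1 : c' t = w t :=
      (uniqueDiffOn_Icc zero_lt_one t ht).eq_deriv _ (h t ht).1 (hw t ht).1
    have h2 := (h t ht).2.2 u
    rw [h1] at h2
    have h3 := (hw t ht).2
    rw [← h3] at h2 ⊢
    exact h2

/-- The coordinate expression of a parallel field. -/
lemma IsParallelAlong.exists_coord {x₀ : M} {γ : ℝ → M} {V : ∀ t, TangentSpace I (γ t)}
    (hV : IsParallelAlong I γ V) (hs : ∀ t ∈ Icc (0 : ℝ) 1, γ t ∈ (extChartAt I x₀).source)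
    {w : ℝ → E} (hw : ∀ t ∈ Icc (0 : ℝ) 1,
      HasDerivWithinAt (fun s ↦ extChartAt I x₀ (γ s)) (w t) (Icc 0 1) t) :
    ∃ ξ' : ℝ → E,
      (∀ t ∈ Icc (0 : ℝ) 1,
        HasDerivWithinAt (fun s ↦ chartDeriv I x₀ (γ s) (V s)) (ξ' t) (Icc 0 1) t) ∧
      (∀ t ∈ Icc (0 : ℝ) 1, ∀ u, coordMetric I x₀ (extChartAt I x₀ (γ t)) (ξ' t) u
        + leviForm (fderiv ℝ (coordMetric I x₀) (extChartAt I x₀ (γ t))) (w t)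
          (chartDeriv I x₀ (γ t) (V t)) u = 0) := by
  obtain ⟨c', ξ', h⟩ := hV.exists_chart hs
  refine ⟨ξ', fun t ht ↦ (h t ht).2.1, fun t ht u ↦ ?_⟩
  have h1 : c' t = w t := (uniqueDiffOn_Icc zero_lt_one t ht).eq_deriv _ (h t ht).1 (hw t ht)
  rw [← h1]
  exact (h t ht).2.2 u

namespace ChartControl

variable {p : M} {B : E → E →L[ℝ] E →L[ℝ] E} {r lam C R : ℝ}

omit [I.Boundaryless] in
/-- Short curves starting near `p` stay in the chart around `p`. -/
lemma mem_of_short [IsRiemannianManifold I M] (h : ChartControl I p B r lam C R) {γ : ℝ → M}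
    (hγ : ContMDiffOn 𝓘(ℝ, ℝ) I 1 γ (Icc 0 1))
    (hlen : edist p (γ 0) + pathELength I γ 0 1 < ENNReal.ofReal R) {t : ℝ}
    (ht : t ∈ Icc (0 : ℝ) 1) :
    γ t ∈ (extChartAt I p).source ∧ extChartAt I p (γ t) ∈ Metric.ball (extChartAt I p p) r := by
  have h1 : edist p (γ t) < ENNReal.ofReal R := by
    refine ((edist_triangle _ (γ 0) _).trans ?_).trans_lt hlen
    gcongr
    exact edist_le_pathELength hγ ht
  exact ⟨h.mem_source _ h1, h.mem_ball _ h1⟩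

/-- Parallel translation exists along slow curves in the chart. -/
lemma exists_parallel (h : ChartControl I p B r lam C R) {γ : ℝ → M} {w : ℝ → E} {ρ : ℝ}
    (hρ : C * ρ ≤ 2⁻¹) (hs : ∀ t ∈ Icc (0 : ℝ) 1, γ t ∈ (extChartAt I p).source)
    (hz : ∀ t ∈ Icc (0 : ℝ) 1, extChartAt I p (γ t) ∈ Metric.ball (extChartAt I p p) r)
    (hw : ∀ t ∈ Icc (0 : ℝ) 1, HasDerivWithinAt (fun s ↦ extChartAt I p (γ s)) (w t) (Icc 0 1) t)
    (hwc : ContinuousOn w (Icc 0 1)) (hwρ : ∀ t ∈ Icc (0 : ℝ) 1, ‖w t‖ ≤ ρ) :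
    ∃ T : E →L[ℝ] E, ∀ v : E, ∃ V : ∀ t, TangentSpace I (γ t), IsParallelAlong I γ V ∧
      (V 0 : E) = v ∧ (V 1 : E) = T v := by
  have : CompleteSpace E := FiniteDimensional.complete ℝ E
  obtain ⟨X, hX0, hX⟩ := h.metric.exists_parallel_resolvent hρ (HasDerivWithinAt.continuousOn hw)
    hwc hz hwρ
  refine ⟨(chartSymmDeriv I p (extChartAt I p (γ 1))).comp ((X 1).comp (chartDeriv I p (γ 0))),
    fun v ↦ ⟨fun t ↦ chartSymmDeriv I p (extChartAt I p (γ t)) (X t (chartDeriv I p (γ 0) v)),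
    ?_, ?_, rfl⟩⟩
  · have e : ∀ t ∈ Icc (0 : ℝ) 1, chartDeriv I p (γ t) (chartSymmDeriv I p (extChartAt I p (γ t))
        (X t (chartDeriv I p (γ 0) v))) = X t (chartDeriv I p (γ 0) v) := fun t ht ↦
      chartDeriv_chartSymmDeriv_apply' I (hs t ht) _
    refine isParallelAlong_of_chart (x₀ := p) hs (c' := w)
      (ξ' := fun t ↦ -B (extChartAt I p (γ t)) (w t) (X t (chartDeriv I p (γ 0) v)))
      fun t ht ↦ ⟨hw t ht, ?_, fun u ↦ ?_⟩
    · refine HasDerivWithinAt.congr ?_ e (e t ht)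
      have := (hX t ht).clm_apply (hasDerivWithinAt_const t (Icc 0 1) (chartDeriv I p (γ 0) v))
      simpa using this
    · rw [e t ht]
      exact h.metric.christoffel_equation (hz t ht) u
  · change chartSymmDeriv I p (extChartAt I p (γ 0)) (X 0 (chartDeriv I p (γ 0) v)) = v
    rw [hX0]
    exact chartSymmDeriv_chartDeriv_apply I (hs 0 ⟨le_rfl, zero_le_one⟩) v

end ChartControl

variable [IsRiemannianManifold I M]

/-- Points near `p` are joined to `p` by a unique minimal geodesic, along which parallel
translation exists in both directions. -/
lemma eventually_exists_minimalGeodesic (I : ModelWithCorners ℝ E H)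
    [RiemannianBundle (fun x : M ↦ TangentSpace I x)] [I.Boundaryless] [IsManifold I ∞ M]
    [IsContMDiffRiemannianBundle I ∞ E (fun x : M ↦ TangentSpace I x)]
    [IsRiemannianManifold I M] (p : M) :
    ∀ᶠ x in 𝓝 p, ∃ γ : ℝ → M, IsMinimalGeodesic I p x γ ∧
      (∀ γ' : ℝ → M, IsMinimalGeodesic I p x γ' → EqOn γ' γ (Icc 0 1)) ∧
      (∃ T : E →L[ℝ] E, ∀ v : E, ∃ V : ∀ t, TangentSpace I (γ t), IsParallelAlong I γ V ∧
        (V 0 : E) = v ∧ (V 1 : E) = T v) ∧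
      (∃ T : E →L[ℝ] E, ∀ v : E, ∃ V : ∀ t, TangentSpace I (γ (1 - t)),
        IsParallelAlong I (fun t ↦ γ (1 - t)) V ∧ (V 0 : E) = v ∧ (V 1 : E) = T v) := by
  have : CompleteSpace E := FiniteDimensional.complete ℝ E
  obtain ⟨B, r, lam, C, R, h⟩ := exists_chartControl (I := I) p
  have hC := h.metric.C_pos
  have hlam := h.metric.lam_pos
  obtain ⟨ε, hε, hgeo⟩ := h.metric.exists_geodesic
  obtain ⟨ρ, hρ, hρ1, hρ2⟩ : ∃ ρ > 0, 2 * C * ρ + C * ρ ^ 2 ≤ lam / 2 ∧ C * ρ ≤ 2⁻¹ := by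
    have h1 : ∀ᶠ ρ in 𝓝[>] (0 : ℝ), 2 * C * ρ + C * ρ ^ 2 < lam / 2 :=
      nhdsWithin_le_nhds (ContinuousAt.eventually_lt (by fun_prop) (by fun_prop)
        (by simpa using hlam))
    have h2 : ∀ᶠ ρ in 𝓝[>] (0 : ℝ), C * ρ < 2⁻¹ :=
      nhdsWithin_le_nhds (ContinuousAt.eventually_lt (by fun_prop) (by fun_prop) (by simp))
    obtain ⟨ρ, hρ⟩ := (h1.and (h2.and self_mem_nhdsWithin)).exists
    exact ⟨ρ, hρ.2.2, hρ.1.le, hρ.2.1.le⟩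
  have hev1 : ∀ᶠ x in 𝓝 p, edist p x < ENNReal.ofReal R := by
    filter_upwards [Metric.eball_mem_nhds p (ENNReal.ofReal_pos.2 h.R_pos)] with x hx
    rwa [Metric.mem_eball, edist_comm] at hx
  have hev2 : ∀ᶠ x in 𝓝 p, ‖extChartAt I p x - extChartAt I p p‖ < min ε (ρ / 2) := by
    have : ContinuousAt (fun x ↦ ‖extChartAt I p x - extChartAt I p p‖) p :=
      ((continuousAt_extChartAt p).sub continuousAt_const).norm
    refine this.eventually_lt continuousAt_const ?_
    simpa using ⟨hε, hρ⟩
  filter_upwards [hev1, hev2] with x hx hxd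
  obtain ⟨c, v, hc0, hc1, hvc, hcd, hvd, hvle, hcball⟩ := hgeo (extChartAt I p x - extChartAt I p p)
    (hxd.le.trans (min_le_left _ _))
  rw [add_sub_cancel] at hc1
  have hvρ : ∀ t, ‖v t‖ ≤ ρ := fun t ↦ (hvle t).trans (by
    have := hxd.le.trans (min_le_right _ _)
    linarith)
  have hu : UniqueDiffOn ℝ (Icc (0 : ℝ) 1) := uniqueDiffOn_Icc zero_lt_one
  have hcc : Continuous c := continuous_iff_continuousAt.2 fun t ↦ (hcd t).continuousAt
  have hcw : ∀ t ∈ Icc (0 : ℝ) 1, HasDerivWithinAt c (v t) (Icc 0 1) t :=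
    fun t _ ↦ (hcd t).hasDerivWithinAt
  have hct : ∀ t ∈ Icc (0 : ℝ) 1, c t ∈ (extChartAt I p).target := fun t ht ↦
    h.ball_subset (hcball t ht)
  have heq : ∀ t ∈ Icc (0 : ℝ) 1, ∀ w, coordMetric I p (c t) (-B (c t) (v t) (v t)) w
      + leviForm (fderiv ℝ (coordMetric I p) (c t)) (v t) (v t) w = 0 := fun t ht w ↦
    h.metric.christoffel_equation (hcball t ht) w
  set γ : ℝ → M := fun t ↦ (extChartAt I p).symm (c t) with hγdef
  have hγc : ∀ t ∈ Icc (0 : ℝ) 1, extChartAt I p (γ t) = c t := fun t ht ↦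
    (extChartAt I p).right_inv (hct t ht)
  have hγs : ∀ t ∈ Icc (0 : ℝ) 1, γ t ∈ (extChartAt I p).source := fun t ht ↦
    (extChartAt I p).map_target (hct t ht)
  have hγball : ∀ t ∈ Icc (0 : ℝ) 1, extChartAt I p (γ t) ∈ Metric.ball (extChartAt I p p) r :=
    fun t ht ↦ (hγc t ht).symm ▸ hcball t ht
  have hγ0 : γ 0 = p := by
    rw [hγdef]; simp only [hc0]; exact extChartAt_to_inv p
  have hγ1 : γ 1 = x := by
    rw [hγdef]; simp only [hc1]; exact (extChartAt I p).left_inv (h.mem_source x hx)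
  have hγd : ∀ t ∈ Icc (0 : ℝ) 1,
      HasDerivWithinAt (fun s ↦ extChartAt I p (γ s)) (v t) (Icc 0 1) t := fun t ht ↦
    (hcw t ht).congr hγc (hγc t ht)
  have hγsm : ContMDiffOn 𝓘(ℝ, ℝ) I 1 γ (Icc 0 1) := by
    have h1 : ContDiff ℝ 1 c := by
      rw [contDiff_one_iff_deriv]
      refine ⟨fun t ↦ (hcd t).differentiableAt, ?_⟩
      rwa [show deriv c = v from funext fun t ↦ (hcd t).deriv]
    exact ((contMDiffOn_extChartAt_symm (I := I) (n := 1) p).comp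
      (contMDiff_iff_contDiff.2 h1).contMDiffOn hct)
  have hγv : ∀ t ∈ Icc (0 : ℝ) 1,
      chartDeriv I p (γ t) (mfderivWithin 𝓘(ℝ, ℝ) I γ (Icc 0 1) t (1 : ℝ)) = v t := by
    obtain ⟨w, _, hw⟩ := exists_coord_velocity hγsm hγs
    intro t ht
    rw [(hw t ht).2]
    exact (hu t ht).eq_deriv _ (hw t ht).1 (hγd t ht)
  have hgeod : IsGeodesic I γ := by
    refine ⟨hγsm, isParallelAlong_of_chart (x₀ := p) hγs (c' := v)
      (ξ' := fun t ↦ -B (c t) (v t) (v t)) fun t ht ↦ ⟨hγd t ht, ?_, fun w ↦ ?_⟩⟩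
    · exact (hvd t ht).congr hγv (hγv t ht)
    · rw [hγv t ht, hγc t ht]
      exact heq t ht w
  have hγcc : ContinuousOn (fun t ↦ extChartAt I p (γ t)) (Icc 0 1) :=
    HasDerivWithinAt.continuousOn hγd
  have hlen := pathELength_eq_ofReal h.metric hγs hγball hγcc hvc.continuousOn hγv
  have hlen' : ∫ t in (0 : ℝ)..1, √(coordMetric I p (extChartAt I p (γ t)) (v t) (v t))
      = ∫ t in (0 : ℝ)..1, √(coordMetric I p (c t) (v t) (v t)) := by
    refine intervalIntegral.integral_congr fun t ht ↦ ?_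
    rw [uIcc_of_le zero_le_one] at ht
    simp only [hγc t ht]
  rw [hlen'] at hlen
  have hmin : pathELength I γ 0 1 = edist p x := by
    refine le_antisymm ?_ ?_
    · refine le_of_forall_gt fun a ha ↦ ?_
      have h1 : riemannianEDist I p x < min a (ENNReal.ofReal R) := by
        rw [← IsRiemannianManifold.out (I := I) p x]
        exact lt_min ha hx
      obtain ⟨γ₁, h0, h1', hsm, hl⟩ := exists_lt_of_riemannianEDist_lt h1
      have hmem := fun t (ht : t ∈ Icc (0 : ℝ) 1) ↦ h.mem_of_short hsm
        (by rw [h0, edist_self, zero_add]; exact hl.trans_le (min_le_right _ _)) ht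
      obtain ⟨w, hwc, hw⟩ := exists_coord_velocity hsm fun t ht ↦ (hmem t ht).1
      have hl₁ := pathELength_eq_ofReal h.metric (fun t ht ↦ (hmem t ht).1)
        (fun t ht ↦ (hmem t ht).2) (HasDerivWithinAt.continuousOn fun t ht ↦ (hw t ht).1) hwc
        fun t ht ↦ (hw t ht).2
      refine lt_of_le_of_lt ?_ (hl.trans_le (min_le_left _ _))
      rw [hlen, hl₁]
      refine ENNReal.ofReal_le_ofReal (le_of_sq_le_sq ?_
        (intervalIntegral.integral_nonneg zero_le_one fun t _ ↦ Real.sqrt_nonneg _))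
      refine (h.metric.length_sq_le_energy hcc.continuousOn hvc.continuousOn hcball).trans ?_
      exact h.metric.energy_le_length_sq hρ.le hρ1 hcw hvd hcball heq (fun t _ ↦ hvρ t)
        (fun t ht ↦ (hw t ht).1) hwc (fun t ht ↦ (hmem t ht).2) (by rw [h0, hc0])
        (by rw [h1', hc1])
    · have := edist_le_pathELength hγsm (right_mem_Icc.2 zero_le_one)
      rwa [hγ0, hγ1] at this
  refine ⟨γ, ⟨hgeod, hγ0, hγ1, hmin⟩, fun γ' hγ' ↦ ?_, ?_, ?_⟩
  · have hmem := fun t (ht : t ∈ Icc (0 : ℝ) 1) ↦ h.mem_of_short hγ'.isGeodesic.contMDiffOn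
        (by rw [hγ'.source, edist_self, zero_add, hγ'.length_eq]; exact hx) ht
    obtain ⟨w, w', hw, hw', hwv, hweq⟩ := hγ'.isGeodesic.exists_coord fun t ht ↦ (hmem t ht).1
    have hl₁ := pathELength_eq_ofReal h.metric (fun t ht ↦ (hmem t ht).1)
      (fun t ht ↦ (hmem t ht).2) (HasDerivWithinAt.continuousOn hw)
      (HasDerivWithinAt.continuousOn hw') hwv
    have hle : ∫ t in (0 : ℝ)..1, √(coordMetric I p (extChartAt I p (γ' t)) (w t) (w t))
        ≤ ∫ t in (0 : ℝ)..1, √(coordMetric I p (c t) (v t) (v t)) := by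
      refine (ENNReal.ofReal_le_ofReal_iff (intervalIntegral.integral_nonneg zero_le_one
        fun t _ ↦ Real.sqrt_nonneg _)).1 ?_
      rw [← hl₁, ← hlen, hγ'.length_eq, hmin]
    have hEq := h.metric.eqOn_of_length_le hρ.le hρ1 hcw hvd hcball heq (fun t _ ↦ hvρ t) hw hw'
      (fun t ht ↦ (hmem t ht).2) hweq (by rw [hγ'.source, hc0]) (by rw [hγ'.target, hc1]) hle
    intro t ht
    rw [hγdef]
    simp only
    rw [← hEq ht, (extChartAt I p).left_inv (hmem t ht).1]
  · exact h.exists_parallel hρ2 hγs hγball hγd hvc.continuousOn fun t _ ↦ hvρ t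
  · have hrev : ∀ t ∈ Icc (0 : ℝ) 1, 1 - t ∈ Icc (0 : ℝ) 1 := fun t ht ↦
      ⟨by linarith [ht.2], by linarith [ht.1]⟩
    refine h.exists_parallel (w := fun t ↦ -v (1 - t)) hρ2 (fun t ht ↦ hγs _ (hrev t ht))
      (fun t ht ↦ hγball _ (hrev t ht))
      (fun t ht ↦ hasDerivWithinAt_comp_one_sub (hγd _ (hrev t ht))) (by fun_prop)
      fun t _ ↦ by rw [norm_neg]; exact hvρ _

end LocalGeometry

section Translation

variable {E : Type*} [NormedAddCommGroup E] [NormedSpace ℝ E]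

open MeasureTheory

attribute [local instance] biformNormedAddCommGroup biformNormedSpace biformSeminormedAddCommGroup
  biformSeminormedAddGroup biformAddMonoid bilinNormedAddCommGroup bilinNormedSpace
  bilinSeminormedAddCommGroup bilinSeminormedAddGroup triformNormedAddCommGroup
  triformNormedSpace triformSeminormedAddCommGroup triformAddMonoid

variable [FiniteDimensional ℝ E]
  {H : Type*} [TopologicalSpace H] {I : ModelWithCorners ℝ E H}
  {M : Type*} [EMetricSpace M] [ChartedSpace H M]
  [RiemannianBundle (fun x : M ↦ TangentSpace I x)]
  [I.Boundaryless] [IsManifold I ∞ M]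
  [IsContMDiffRiemannianBundle I ∞ E (fun x : M ↦ TangentSpace I x)]

omit [FiniteDimensional ℝ E] [I.Boundaryless] [IsManifold I ∞ M]
  [IsContMDiffRiemannianBundle I ∞ E (fun x : M ↦ TangentSpace I x)]
  [RiemannianBundle (fun x : M ↦ TangentSpace I x)] in
lemma totalSpace_mk_eq {y y' : M} (hy : y = y') {a : TangentSpace I y} {b : TangentSpace I y'}
    (h : (a : E) = b) : (⟨y, a⟩ : TangentBundle I M) = ⟨y', b⟩ := by
  subst hy
  rw [show a = b from h]

omit [FiniteDimensional ℝ E] [IsManifold I ∞ M] [I.Boundaryless]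
  [IsContMDiffRiemannianBundle I ∞ E (fun x : M ↦ TangentSpace I x)]
  [RiemannianBundle (fun x : M ↦ TangentSpace I x)] in
lemma mfderivWithin_comp_one_sub {γ : ℝ → M} (hγ : ContMDiffOn 𝓘(ℝ, ℝ) I 1 γ (Icc 0 1)) {t : ℝ}
    (ht : t ∈ Icc (0 : ℝ) 1) :
    mfderivWithin 𝓘(ℝ, ℝ) I (fun s ↦ γ (1 - s)) (Icc 0 1) t (1 : ℝ)
      = -mfderivWithin 𝓘(ℝ, ℝ) I γ (Icc 0 1) (1 - t) (1 : ℝ) := by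
  have ht' : 1 - t ∈ Icc (0 : ℝ) 1 := ⟨by linarith [ht.2], by linarith [ht.1]⟩
  have h1 : HasFDerivWithinAt (fun s : ℝ ↦ 1 - s) (-ContinuousLinearMap.id ℝ ℝ) (Icc 0 1) t :=
    ((hasFDerivAt_id t).const_sub 1).hasFDerivWithinAt
  have h2 := HasMFDerivWithinAt.comp t
    (hγ.mdifferentiableOn one_ne_zero (1 - t) ht').hasMFDerivWithinAt
    h1.hasMFDerivWithinAt (fun s hs ↦ ⟨by linarith [hs.2], by linarith [hs.1]⟩)
  have h3 := h2.mfderivWithin (uniqueDiffOn_Icc zero_lt_one t ht).uniqueMDiffWithinAt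
  refine (congrArg (fun f : ℝ →L[ℝ] E ↦ f 1) h3).trans ?_
  exact map_neg (mfderivWithin 𝓘(ℝ, ℝ) I γ (Icc 0 1) (1 - t)) (1 : ℝ)

/-- The reverse of a minimal geodesic is a minimal geodesic. -/
lemma IsMinimalGeodesic.reverse {x y : M} {γ : ℝ → M} (h : IsMinimalGeodesic I x y γ) :
    IsMinimalGeodesic I y x (fun t ↦ γ (1 - t)) := by
  have hγ := h.isGeodesic.contMDiffOn
  have hmaps : MapsTo (fun s : ℝ ↦ 1 - s) (Icc 0 1) (Icc 0 1) := fun s hs ↦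
    ⟨by linarith [hs.2], by linarith [hs.1]⟩
  refine ⟨⟨?_, ?_⟩, by simpa using h.target, by simpa using h.source, ?_⟩
  · have h1 : ContMDiffOn 𝓘(ℝ, ℝ) 𝓘(ℝ, ℝ) 1 (fun s : ℝ ↦ 1 - s) (Icc 0 1) :=
      contMDiffOn_iff_contDiffOn.2 (by fun_prop)
    exact hγ.comp h1 hmaps
  · exact h.isGeodesic.parallel_velocity.reverse.neg.congr fun t ht ↦
      mfderivWithin_comp_one_sub hγ ht
  · have h1 := pathELength_comp_of_antitoneOn (I := I) (γ := γ) (f := fun s : ℝ ↦ 1 - s)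
      zero_le_one (a := 0) (b := 1) (fun s _ t _ hst ↦ sub_le_sub_left hst 1) (by fun_prop)
      (by simpa using hγ.mdifferentiableOn one_ne_zero)
    simp only [sub_self, sub_zero] at h1
    rw [edist_comm, ← h.length_eq]
    exact h1

section Existence

variable (I) [IsRiemannianManifold I M]

lemma eventually_exists_isParallelTranslation (p : M) :
    ∀ᶠ x in 𝓝 p, (∃ T, IsParallelTranslation I p x T) ∧ ∃ T, IsParallelTranslation I x p T := by
  filter_upwards [eventually_exists_minimalGeodesic I p] with x hx
  obtain ⟨γ, hγ, hu, ⟨T, hT⟩, T', hT'⟩ := hx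
  refine ⟨⟨T, γ, hγ, hu, fun v ↦ ?_⟩, ⟨T', fun t ↦ γ (1 - t), hγ.reverse, fun γ' hγ' t ht ↦ ?_,
    fun v ↦ ?_⟩⟩
  · obtain ⟨V, hV, h0, h1⟩ := hT v
    exact ⟨V, hV, totalSpace_mk_eq hγ.source h0, totalSpace_mk_eq hγ.target h1⟩
  · have ht' : 1 - t ∈ Icc (0 : ℝ) 1 := ⟨by linarith [ht.2], by linarith [ht.1]⟩
    simpa using hu _ hγ'.reverse ht'
  · obtain ⟨V, hV, h0, h1⟩ := hT' v
    exact ⟨V, hV, totalSpace_mk_eq hγ.reverse.source h0, totalSpace_mk_eq hγ.reverse.target h1⟩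

end Existence

omit [FiniteDimensional ℝ E] [I.Boundaryless] [IsManifold I ∞ M]
  [IsContMDiffRiemannianBundle I ∞ E (fun x : M ↦ TangentSpace I x)]
  [RiemannianBundle (fun x : M ↦ TangentSpace I x)] in
lemma chartDeriv_congr_totalSpace (x₀ : M) {y y' : M} {a : TangentSpace I y} {b : TangentSpace I y'}
    (h : (⟨y, a⟩ : TangentBundle I M) = ⟨y', b⟩) : chartDeriv I x₀ y a = chartDeriv I x₀ y' b :=
  congrArg (fun q : TangentBundle I M ↦ chartDeriv I x₀ q.proj q.snd) h

variable [IsRiemannianManifold I M]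

namespace ChartControl

variable {p : M} {B : E → E →L[ℝ] E →L[ℝ] E} {r lam C R : ℝ}

/-- In a chart, parallel translation along short minimal geodesics is close to the identity. -/
lemma norm_parallelTranslation_sub_id_le (h : ChartControl I p B r lam C R) {ρ : ℝ} (hρ0 : 0 ≤ ρ)
    (hρ : C * ρ ≤ 2⁻¹) {x y : M} (hR : edist p x + edist x y < ENNReal.ofReal R)
    (hxy : edist x y ≤ ENNReal.ofReal (√lam * ρ))
    {T : E →L[ℝ] E} (hT : IsParallelTranslation I x y T) :
    ‖(chartDeriv I p y).comp (T.comp (chartSymmDeriv I p (extChartAt I p x)))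
      - ContinuousLinearMap.id ℝ E‖ ≤ 2 * (C * ρ) := by
  have hlam := h.metric.lam_pos
  have hC := h.metric.C_pos
  obtain ⟨γ, hγ, -, hpar⟩ := hT
  have hmem := fun t (ht : t ∈ Icc (0 : ℝ) 1) ↦ h.mem_of_short hγ.isGeodesic.contMDiffOn
    (by rwa [hγ.source, hγ.length_eq]) ht
  obtain ⟨w, w', hw, hw', hwv, hweq⟩ := hγ.isGeodesic.exists_coord fun t ht ↦ (hmem t ht).1
  have hspeed := fun t (ht : t ∈ Icc (0 : ℝ) 1) ↦
    h.metric.speed_eq hw hw' (fun t ht ↦ (hmem t ht).2) hweq ht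
  have hlen := pathELength_eq_ofReal h.metric (fun t ht ↦ (hmem t ht).1)
    (fun t ht ↦ (hmem t ht).2) (HasDerivWithinAt.continuousOn hw)
    (HasDerivWithinAt.continuousOn hw') hwv
  have hint : ∫ t in (0 : ℝ)..1, √(coordMetric I p (extChartAt I p (γ t)) (w t) (w t))
      = √(coordMetric I p (extChartAt I p (γ 0)) (w 0) (w 0)) := by
    rw [intervalIntegral.integral_congr (g := fun _ ↦
      √(coordMetric I p (extChartAt I p (γ 0)) (w 0) (w 0)))]
    · simp
    · intro t ht
      rw [uIcc_of_le zero_le_one] at ht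
      simp only [hspeed t ht]
  rw [hint, hγ.length_eq] at hlen
  rw [hlen, ENNReal.ofReal_le_ofReal_iff (by positivity)] at hxy
  have hwρ : ∀ t ∈ Icc (0 : ℝ) 1, ‖w t‖ ≤ ρ := by
    intro t ht
    have h1 := h.metric.lower _ (hmem t ht).2 (w t)
    rw [hspeed t ht] at h1
    have h2 : √lam * ‖w t‖ ≤ √lam * ρ := by
      refine le_trans ?_ hxy
      rw [← Real.sqrt_sq (norm_nonneg (w t)), ← Real.sqrt_mul hlam.le]
      exact Real.sqrt_le_sqrt h1
    exact le_of_mul_le_mul_left h2 (Real.sqrt_pos.2 hlam)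
  have hx : x ∈ (extChartAt I p).source := hγ.source ▸ (hmem 0 ⟨le_rfl, zero_le_one⟩).1
  refine ContinuousLinearMap.opNorm_le_bound _ (by positivity) fun u ↦ ?_
  obtain ⟨V, hV, h0, h1⟩ := hpar (chartSymmDeriv I p (extChartAt I p x) u)
  obtain ⟨ξ', hξ, heq⟩ := hV.exists_coord (fun t ht ↦ (hmem t ht).1) hw
  have hle := h.metric.norm_parallel_sub_le hρ0 hρ (fun t ht ↦ (hmem t ht).2) hwρ hξ heq
  have e0 := (chartDeriv_congr_totalSpace p h0).trans (chartDeriv_chartSymmDeriv_apply' I hx u)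
  have e1 := chartDeriv_congr_totalSpace p h1
  rw [e0, e1] at hle
  exact hle

/-- The Riemannian distance is bounded by a multiple of the distance in a chart. -/
lemma edist_le (h : ChartControl I p B r lam C R) {x y : M}
    (hx : x ∈ (extChartAt I p).source) (hy : y ∈ (extChartAt I p).source)
    (hxr : extChartAt I p x ∈ Metric.ball (extChartAt I p p) r)
    (hyr : extChartAt I p y ∈ Metric.ball (extChartAt I p p) r) :
    edist x y ≤ ENNReal.ofReal (√C * ‖extChartAt I p y - extChartAt I p x‖) := by
  have hC := h.metric.C_pos
  set z := extChartAt I p x with hz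
  set u := extChartAt I p y - z with hu
  set c : ℝ → E := fun t ↦ z + t • u with hc
  set γ : ℝ → M := fun t ↦ (extChartAt I p).symm (c t) with hγ
  have hcball : ∀ t ∈ Icc (0 : ℝ) 1, c t ∈ Metric.ball (extChartAt I p p) r := fun t ht ↦
    (convex_ball _ _).add_smul_sub_mem hxr hyr ht
  have hct : ∀ t ∈ Icc (0 : ℝ) 1, c t ∈ (extChartAt I p).target := fun t ht ↦
    h.ball_subset (hcball t ht)
  have hγc : ∀ t ∈ Icc (0 : ℝ) 1, extChartAt I p (γ t) = c t := fun t ht ↦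
    (extChartAt I p).right_inv (hct t ht)
  have hγs : ∀ t ∈ Icc (0 : ℝ) 1, γ t ∈ (extChartAt I p).source := fun t ht ↦
    (extChartAt I p).map_target (hct t ht)
  have hγ0 : γ 0 = x := by
    simp only [hγ, hc, zero_smul, add_zero]
    exact (extChartAt I p).left_inv hx
  have hγ1 : γ 1 = y := by
    simp only [hγ, hc, hu, one_smul, add_sub_cancel]
    exact (extChartAt I p).left_inv hy
  have hγsm : ContMDiffOn 𝓘(ℝ, ℝ) I 1 γ (Icc 0 1) := by
    have h1 : ContDiff ℝ 1 c := by fun_prop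
    exact ((contMDiffOn_extChartAt_symm (I := I) (n := 1) p).comp
      (contMDiff_iff_contDiff.2 h1).contMDiffOn hct)
  obtain ⟨w, hwc, hw⟩ := exists_coord_velocity hγsm hγs
  have hwu : ∀ t ∈ Icc (0 : ℝ) 1, w t = u := by
    intro t ht
    refine (uniqueDiffOn_Icc zero_lt_one t ht).eq_deriv _ (hw t ht).1 ?_
    refine HasDerivWithinAt.congr ?_ hγc (hγc t ht)
    have := (((hasDerivAt_id t).smul_const u).const_add z).hasDerivWithinAt (s := Icc 0 1)
    rwa [one_smul] at this
  have hball : ∀ t ∈ Icc (0 : ℝ) 1, extChartAt I p (γ t) ∈ Metric.ball (extChartAt I p p) r :=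
    fun t ht ↦ (hγc t ht).symm ▸ hcball t ht
  have hlen := pathELength_eq_ofReal h.metric hγs hball
    (HasDerivWithinAt.continuousOn fun t ht ↦ (hw t ht).1) hwc fun t ht ↦ (hw t ht).2
  have hle := edist_le_pathELength hγsm (right_mem_Icc.2 zero_le_one)
  rw [hγ0, hγ1, hlen] at hle
  refine hle.trans (ENNReal.ofReal_le_ofReal ?_)
  have hb : ∀ t ∈ Icc (0 : ℝ) 1,
      √(coordMetric I p (extChartAt I p (γ t)) (w t) (w t)) ≤ √C * ‖u‖ := by
    intro t ht
    rw [hwu t ht]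
    refine Real.sqrt_le_iff.2 ⟨by positivity, ?_⟩
    rw [mul_pow, Real.sq_sqrt hC.le]
    have := h.metric.abs_apply_le (hball t ht) u u
    linarith [le_abs_self (coordMetric I p (extChartAt I p (γ t)) u u)]
  have hn := intervalIntegral.norm_integral_le_of_norm_le_const (a := 0) (b := 1)
    (C := √C * ‖u‖) (f := fun t ↦ √(coordMetric I p (extChartAt I p (γ t)) (w t) (w t)))
    fun t ht ↦ by
      rw [uIoc_of_le zero_le_one] at ht
      rw [Real.norm_of_nonneg (Real.sqrt_nonneg _)]
      exact hb t ⟨ht.1.le, ht.2⟩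
  simp only [sub_zero, abs_one, mul_one] at hn
  exact (le_abs_self _).trans hn

/-- The distance in a chart is bounded by a multiple of the Riemannian distance. -/
lemma le_edist (h : ChartControl I p B r lam C R) {x y : M}
    (hR : edist p x + edist x y < ENNReal.ofReal R) :
    ENNReal.ofReal (√lam * ‖extChartAt I p y - extChartAt I p x‖) ≤ edist x y := by
  have : CompleteSpace E := FiniteDimensional.complete ℝ E
  have hlam := h.metric.lam_pos
  have hR' : edist x y < ENNReal.ofReal R - edist p x := by
    rw [lt_tsub_iff_left]; exact hR
  refine le_of_forall_gt fun a ha ↦ ?_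
  have h1 : riemannianEDist I x y < min a (ENNReal.ofReal R - edist p x) := by
    rw [← IsRiemannianManifold.out (I := I) x y]
    exact lt_min ha hR'
  obtain ⟨γ, h0, h1', hsm, hl⟩ := exists_lt_of_riemannianEDist_lt h1
  have hmem := fun t (ht : t ∈ Icc (0 : ℝ) 1) ↦ h.mem_of_short hsm
    (by rw [h0]; exact lt_tsub_iff_left.1 (hl.trans_le (min_le_right _ _))) ht
  obtain ⟨w, hwc, hw⟩ := exists_coord_velocity hsm fun t ht ↦ (hmem t ht).1
  have hcc := HasDerivWithinAt.continuousOn fun t ht ↦ (hw t ht).1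
  have hlen := pathELength_eq_ofReal h.metric (fun t ht ↦ (hmem t ht).1)
    (fun t ht ↦ (hmem t ht).2) hcc hwc fun t ht ↦ (hw t ht).2
  refine lt_of_le_of_lt ?_ (hl.trans_le (min_le_left _ _))
  rw [hlen]
  refine ENNReal.ofReal_le_ofReal ?_
  have h2 := MetricControl.norm_sub_le_integral (fun t ht ↦ (hw t ht).1) hwc (right_mem_Icc.2 zero_le_one)
  rw [h0, h1'] at h2
  calc √lam * ‖extChartAt I p y - extChartAt I p x‖ ≤ √lam * ∫ s in (0 : ℝ)..1, ‖w s‖ := by gcongr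
    _ = ∫ s in (0 : ℝ)..1, √lam * ‖w s‖ := by rw [intervalIntegral.integral_const_mul]
    _ ≤ _ := by
      refine intervalIntegral.integral_mono_on zero_le_one ?_ ?_ fun t ht ↦ ?_
      · exact (continuousOn_const.mul hwc.norm).intervalIntegrable_of_Icc zero_le_one
      · exact (h.metric.continuousOn_energy_density hcc hwc
          fun t ht ↦ (hmem t ht).2).sqrt.intervalIntegrable_of_Icc zero_le_one
      · rw [← Real.sqrt_sq (norm_nonneg (w t)), ← Real.sqrt_mul hlam.le]
        exact Real.sqrt_le_sqrt (h.metric.lower _ (hmem t ht).2 (w t))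

end ChartControl

variable (I)

/-- Near `p`, in the chart around `p`, parallel translation is close to the identity. -/
lemma exists_nhds_norm_parallelTranslation_sub_id_le (p : M) {ε : ℝ} (hε : 0 < ε) :
    ∃ U ∈ 𝓝 p, U ⊆ (extChartAt I p).source ∧ ∀ x ∈ U, ∀ y ∈ U, ∀ T : E →L[ℝ] E,
      IsParallelTranslation I x y T →
      ‖(chartDeriv I p y).comp (T.comp (chartSymmDeriv I p (extChartAt I p x)))
        - ContinuousLinearMap.id ℝ E‖ ≤ ε := by
  obtain ⟨B, r, lam, C, R, h⟩ := exists_chartControl (I := I) p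
  have hC := h.metric.C_pos
  have hlam := h.metric.lam_pos
  have hR := h.R_pos
  set ρ : ℝ := min 2⁻¹ (ε / 2) / C with hρ
  have hρ0 : 0 < ρ := by positivity
  have hCρ : C * ρ = min 2⁻¹ (ε / 2) := by rw [hρ]; field_simp
  set δ : ℝ := min (R / 4) (√lam * ρ / 2) with hδ
  have hδ0 : 0 < δ := by positivity
  have hδ1 : δ ≤ R / 4 := min_le_left _ _
  have hδ2 : δ ≤ √lam * ρ / 2 := min_le_right _ _
  refine ⟨Metric.eball p (ENNReal.ofReal δ), Metric.eball_mem_nhds p (ENNReal.ofReal_pos.2 hδ0),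
    fun x hx ↦ ?_, fun x hx y hy T hT ↦ ?_⟩
  · rw [Metric.mem_eball, edist_comm] at hx
    exact h.mem_source x (hx.trans_le (ENNReal.ofReal_le_ofReal (by linarith)))
  · rw [Metric.mem_eball] at hx hy
    have hxy : edist x y ≤ ENNReal.ofReal (δ + δ) := by
      rw [ENNReal.ofReal_add hδ0.le hδ0.le]
      refine (edist_triangle x p y).trans (add_le_add hx.le ?_)
      rw [edist_comm]; exact hy.le
    refine (h.norm_parallelTranslation_sub_id_le hρ0.le (hCρ.trans_le (min_le_left _ _)) ?_ ?_
      hT).trans ?_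
    · calc edist p x + edist x y ≤ ENNReal.ofReal δ + ENNReal.ofReal (δ + δ) := by
            rw [edist_comm p]; exact add_le_add hx.le hxy
        _ = ENNReal.ofReal (δ + (δ + δ)) := (ENNReal.ofReal_add hδ0.le (by linarith)).symm
        _ < ENNReal.ofReal R := (ENNReal.ofReal_lt_ofReal_iff hR).2 (by linarith)
    · exact hxy.trans (ENNReal.ofReal_le_ofReal (by linarith))
    · rw [hCρ]
      linarith [min_le_right (2⁻¹ : ℝ) (ε / 2)]

/-- Near `p`, the Riemannian distance and the distance in the chart around `p` are comparable. -/
lemma exists_nhds_edist_comparison (p : M) : ∃ U ∈ 𝓝 p, ∃ K : NNReal, ∀ x ∈ U, ∀ y ∈ U,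
    edist x y ≤ K * edist (extChartAt I p x) (extChartAt I p y) ∧
      edist (extChartAt I p x) (extChartAt I p y) ≤ K * edist x y := by
  obtain ⟨B, r, lam, C, R, h⟩ := exists_chartControl (I := I) p
  have hC := h.metric.C_pos
  have hlam := h.metric.lam_pos
  have hR := h.R_pos
  set δ : ℝ := R / 4 with hδ
  have hδ0 : 0 < δ := by positivity
  set K : ℝ := max √C (√lam)⁻¹ with hK
  have hlam' : 0 < √lam := Real.sqrt_pos.2 hlam
  have e : ∀ x y : M, edist (extChartAt I p x) (extChartAt I p y)
      = ENNReal.ofReal ‖extChartAt I p y - extChartAt I p x‖ := fun x y ↦ by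
    rw [edist_comm, edist_dist, dist_eq_norm]
  refine ⟨Metric.eball p (ENNReal.ofReal δ), Metric.eball_mem_nhds p (ENNReal.ofReal_pos.2 hδ0),
    K.toNNReal, fun x hx y hy ↦ ?_⟩
  rw [Metric.mem_eball] at hx hy
  have hR1 : ENNReal.ofReal δ < ENNReal.ofReal R :=
    (ENNReal.ofReal_lt_ofReal_iff hR).2 (by linarith)
  have hx' : edist p x < ENNReal.ofReal R := by rw [edist_comm]; exact hx.trans hR1
  have hy' : edist p y < ENNReal.ofReal R := by rw [edist_comm]; exact hy.trans hR1
  have hxy : edist x y ≤ ENNReal.ofReal (δ + δ) := by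
    rw [ENNReal.ofReal_add hδ0.le hδ0.le]
    refine (edist_triangle x p y).trans (add_le_add hx.le ?_)
    rw [edist_comm]; exact hy.le
  have hsum : edist p x + edist x y < ENNReal.ofReal R := by
    calc edist p x + edist x y ≤ ENNReal.ofReal δ + ENNReal.ofReal (δ + δ) := by
          rw [edist_comm p]; exact add_le_add hx.le hxy
      _ = ENNReal.ofReal (δ + (δ + δ)) := (ENNReal.ofReal_add hδ0.le (by linarith)).symm
      _ < ENNReal.ofReal R := (ENNReal.ofReal_lt_ofReal_iff hR).2 (by linarith)
  rw [e]
  constructor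
  · refine (h.edist_le (h.mem_source x hx') (h.mem_source y hy') (h.mem_ball x hx')
      (h.mem_ball y hy')).trans ?_
    rw [ENNReal.ofReal_mul (Real.sqrt_nonneg _)]
    gcongr
    exact ENNReal.ofReal_le_ofReal (le_max_left _ _)
  · have h1 := h.le_edist hsum
    have h2 : ‖extChartAt I p y - extChartAt I p x‖
        = (√lam)⁻¹ * (√lam * ‖extChartAt I p y - extChartAt I p x‖) := by field_simp
    rw [h2, ENNReal.ofReal_mul (by positivity)]
    gcongr
    exact ENNReal.ofReal_le_ofReal (le_max_right _ _)

end Translation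

section ConvexHull

variable {V : Type*} [NormedAddCommGroup V] [NormedSpace ℝ V] [FiniteDimensional ℝ V]

/-- In finite dimension, the convex hull of a compact set is compact. -/
lemma isCompact_convexHull_of_isCompact {s : Set V} (hs : IsCompact s) :
    IsCompact (convexHull ℝ s) := by
  rcases s.eq_empty_or_nonempty with rfl | ⟨x₀, hx₀⟩
  · simp
  let n := Module.finrank ℝ V + 1
  let f : (Fin n → ℝ) × (Fin n → V) → V := fun q ↦ ∑ i, q.1 i • q.2 i
  have hf : Continuous f := by fun_prop
  have hK : IsCompact (stdSimplex ℝ (Fin n) ×ˢ univ.pi fun _ : Fin n ↦ s) :=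
    (isCompact_stdSimplex ℝ (Fin n)).prod (isCompact_univ_pi fun _ ↦ hs)
  convert hK.image hf
  refine Subset.antisymm (fun x hx ↦ ?_) ?_
  · obtain ⟨ι, _, z, w, hz, hind, hw, hw1, rfl⟩ := eq_pos_convex_span_of_mem_convexHull hx
    have hcard : Fintype.card ι ≤ n :=
      hind.card_le_finrank_succ.trans (Nat.succ_le_succ (Submodule.finrank_le _))
    obtain ⟨e⟩ : Nonempty (ι ↪ Fin n) :=
      Function.Embedding.nonempty_of_card_le (by simpa using hcard)
    have hout : ∀ j ∉ range e, Function.extend e w 0 j = 0 := fun j hj ↦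
      Function.extend_apply' _ _ _ hj
    refine ⟨(Function.extend e w 0, Function.extend e z fun _ ↦ x₀), ⟨⟨fun j ↦ ?_, ?_⟩,
      fun j _ ↦ ?_⟩, ?_⟩
    · by_cases hj : j ∈ range e
      · obtain ⟨i, rfl⟩ := hj
        simpa [e.injective.extend_apply] using (hw i).le
      · exact (hout j hj).ge
    · rw [← hw1]
      refine (Finset.sum_of_injOn e e.injective.injOn (by simp) (fun j _ hj ↦ hout j ?_) ?_).symm
      · simpa using hj
      · simp [e.injective.extend_apply]
    · by_cases hj : j ∈ range e
      · obtain ⟨i, rfl⟩ := hj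
        simpa [e.injective.extend_apply] using hz (mem_range_self i)
      · have h1 := Function.extend_apply' (f := e) z (fun _ ↦ x₀) j hj
        simp only at h1 ⊢
        rw [h1]
        exact hx₀
    · refine (Finset.sum_of_injOn e e.injective.injOn (by simp) (fun j _ hj ↦ ?_) ?_).symm
      · simp only
        rw [hout j (by simpa using hj), zero_smul]
      · simp [e.injective.extend_apply]
  · rintro _ ⟨⟨w, z⟩, ⟨⟨hw, hw1⟩, hz⟩, rfl⟩
    exact (convex_convexHull ℝ s).sum_mem (fun i _ ↦ hw i) hw1
      fun i _ ↦ subset_convexHull ℝ s (hz i (mem_univ i))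

end ConvexHull

section ClusterValues

variable {X V : Type*} [TopologicalSpace V]

/-- A function with values in a compact set is eventually in every neighbourhood of the set of its
cluster values. -/
lemma eventually_mem_of_isCompact {L : Filter X} {D : X → V} {s U : Set V} (hs : IsCompact s)
    (hD : ∀ᶠ x in L, D x ∈ s) (hU : IsOpen U) (hsub : ∀ G, MapClusterPt G L D → G ∈ U) :
    ∀ᶠ x in L, D x ∈ U := by
  by_contra hcon
  have hfreq : ∃ᶠ x in L, D x ∈ s ∩ Uᶜ :=
    ((not_eventually.1 hcon).and_eventually hD).mono fun x hx ↦ ⟨hx.2, hx.1⟩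
  obtain ⟨G, hG, hcl⟩ :=
    (hs.inter_right hU.isClosed_compl).exists_mapClusterPt_of_frequently hfreq
  exact hG.2 (hsub G hcl)

lemma exists_seq_of_mapClusterPt [FirstCountableTopology V] {L : Filter X} [L.IsCountablyGenerated]
    {D : X → V} {G : V} (h : MapClusterPt G L D) :
    ∃ x : ℕ → X, Tendsto x atTop L ∧ Tendsto (D ∘ x) atTop (𝓝 G) := by
  have : NeBot (comap D (𝓝 G) ⊓ L) := neBot_inf_comap_iff_map'.2 h
  obtain ⟨x, hx⟩ := exists_seq_tendsto (comap D (𝓝 G) ⊓ L)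
  exact ⟨x, hx.mono_right inf_le_right, tendsto_comap_iff.1 (hx.mono_right inf_le_left)⟩

end ClusterValues

section Linear

variable {V W : Type*} [NormedAddCommGroup V] [NormedSpace ℝ V] [NormedAddCommGroup W]
  [NormedSpace ℝ W]

lemma norm_comp_comp_sub_le {S : W →L[ℝ] W} {D : V →L[ℝ] W} {T : V →L[ℝ] V} {ε K : ℝ} (hε : ε ≤ 1)
    (hS : ‖S - ContinuousLinearMap.id ℝ W‖ ≤ ε) (hT : ‖T - ContinuousLinearMap.id ℝ V‖ ≤ ε)
    (hD : ‖D‖ ≤ K) : ‖S.comp (D.comp T) - D‖ ≤ 3 * K * ε := by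
  have hε0 : 0 ≤ ε := (norm_nonneg _).trans hS
  have hK0 : 0 ≤ K := (norm_nonneg _).trans hD
  have e : S.comp (D.comp T) - D = (S - ContinuousLinearMap.id ℝ W).comp
      (D.comp (T - ContinuousLinearMap.id ℝ V)) + (S - ContinuousLinearMap.id ℝ W).comp D
      + D.comp (T - ContinuousLinearMap.id ℝ V) := by
    ext v
    simp
  have h1 : ‖D.comp (T - ContinuousLinearMap.id ℝ V)‖ ≤ K * ε :=
    (ContinuousLinearMap.opNorm_comp_le _ _).trans (by gcongr)
  have h2 : ‖(S - ContinuousLinearMap.id ℝ W).comp D‖ ≤ ε * K :=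
    (ContinuousLinearMap.opNorm_comp_le _ _).trans (by gcongr)
  have h3 : ‖(S - ContinuousLinearMap.id ℝ W).comp (D.comp (T - ContinuousLinearMap.id ℝ V))‖
      ≤ ε * (K * ε) := (ContinuousLinearMap.opNorm_comp_le _ _).trans (by gcongr)
  rw [e]
  refine (norm_add₃_le).trans ?_
  nlinarith [mul_nonneg hK0 hε0, mul_le_of_le_one_right (mul_nonneg hK0 hε0) hε]

lemma map_mem_cthickening_convexHull {S : Set V} {K : Set W} {A : V →L[ℝ] W} {ε : ℝ}
    (h : ∀ G ∈ S, A G ∈ Metric.cthickening ε K) {G : V} (hG : G ∈ convexHull ℝ S) :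
    A G ∈ Metric.cthickening ε (convexHull ℝ K) := by
  have hconv : Convex ℝ (A ⁻¹' Metric.cthickening ε (convexHull ℝ K)) :=
    ((convex_convexHull ℝ K).cthickening ε).linear_preimage A.toLinearMap
  have hsub : S ⊆ A ⁻¹' Metric.cthickening ε (convexHull ℝ K) := fun G hG ↦
    Metric.cthickening_subset_of_subset ε (subset_convexHull ℝ K) (h G hG)
  exact convexHull_min hsub hconv hG

end Linear

section Coordinates

/-- The linear maps of maximal rank. -/
def maximalRank (E E' : Type*) [NormedAddCommGroup E] [NormedSpace ℝ E] [NormedAddCommGroup E']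
    [NormedSpace ℝ E'] : Set (E →L[ℝ] E') :=
  {G | (min (Module.finrank ℝ E) (Module.finrank ℝ E') : ℕ) ≤ (G : E →ₗ[ℝ] E').rank}

variable {E : Type*} [NormedAddCommGroup E] [NormedSpace ℝ E]
  {H : Type*} [TopologicalSpace H] (I : ModelWithCorners ℝ E H)
  {M : Type*} [EMetricSpace M] [ChartedSpace H M]
  {E' : Type*} [NormedAddCommGroup E'] [NormedSpace ℝ E']
  {H' : Type*} [TopologicalSpace H'] (J : ModelWithCorners ℝ E' H')
  {N : Type*} [EMetricSpace N] [ChartedSpace H' N]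

/-- The differential of `F` at `x`, as a map between the model spaces. -/
def modelDeriv (F : M → N) (x : M) : E →L[ℝ] E' := mfderiv I J F x

omit [EMetricSpace M] [EMetricSpace N] in
lemma hasMFDerivAt_comp_of_eq [TopologicalSpace M] [TopologicalSpace N]
    {E₀ : Type*} [NormedAddCommGroup E₀] [NormedSpace ℝ E₀]
    {H₀ : Type*} [TopologicalSpace H₀] {I₀ : ModelWithCorners ℝ E₀ H₀}
    {M₀ : Type*} [TopologicalSpace M₀] [ChartedSpace H₀ M₀] [ChartedSpace H M] [ChartedSpace H' N]
    {g : M → N} {f : M₀ → M} {x : M₀} {y : M} (hy : f x = y) {g' : E →L[ℝ] E'} {f' : E₀ →L[ℝ] E}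
    (hg : HasMFDerivAt I J g y g') (hf : HasMFDerivAt I₀ I f x f') :
    HasMFDerivAt I₀ J (fun z ↦ g (f z)) x (g'.comp f') := by
  subst hy
  exact HasMFDerivAt.comp x hg hf

/-- The differential of `F` at `x` in the charts around `p` and `F p`. -/
def coordDifferential (F : M → N) (p x : M) : E →L[ℝ] E' :=
  (chartDeriv J (F p) (F x)).comp
    ((modelDeriv I J F x).comp (chartSymmDeriv I p (extChartAt I p x)))

/-- The coordinate expression in the charts around `p` and `F p` of a linear map from `T_x M` to
`T_{F x} N`. -/
def coordMap (F : M → N) (p x : M) : (E →L[ℝ] E') →L[ℝ] E →L[ℝ] E' :=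
  (ContinuousLinearMap.compL ℝ E E' E' (chartDeriv J (F p) (F x))).comp
    ((ContinuousLinearMap.compL ℝ E E E').flip (chartSymmDeriv I p (extChartAt I p x)))

lemma coordMap_apply (F : M → N) (p x : M) (G : E →L[ℝ] E') :
    coordMap I J F p x G
      = (chartDeriv J (F p) (F x)).comp (G.comp (chartSymmDeriv I p (extChartAt I p x))) := rfl

lemma rank_coordMap_le (F : M → N) (p x : M) (G : E →L[ℝ] E') :
    (coordMap I J F p x G : E →ₗ[ℝ] E').rank ≤ (G : E →ₗ[ℝ] E').rank :=
  (LinearMap.rank_comp_le_right ((G : E →ₗ[ℝ] E').comp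
    (chartSymmDeriv I p (extChartAt I p x) : E →ₗ[ℝ] E)) _).trans (LinearMap.rank_comp_le_left _ _)

lemma mem_maximalRank_of_coordMap {F : M → N} {p x : M} {G : E →L[ℝ] E'}
    (h : coordMap I J F p x G ∈ maximalRank E E') : G ∈ maximalRank E E' :=
  LE.le.trans (mem_ofPred_eq ▸ h) (rank_coordMap_le I J F p x G)

variable [I.Boundaryless] [IsManifold I ∞ M] [J.Boundaryless] [IsManifold J ∞ N]

omit [J.Boundaryless] in
lemma coordMap_self (F : M → N) (p : M) (G : E →L[ℝ] E') : coordMap I J F p p G = G := by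
  have h1 : chartDeriv I p p = ContinuousLinearMap.id ℝ E := by
    have : IsManifold I 1 M := .of_le (n := ∞) ENat.LEInfty.out
    exact mfderiv_extChartAt_self
  have h2 : chartDeriv J (F p) (F p) = ContinuousLinearMap.id ℝ E' := by
    have : IsManifold J 1 N := .of_le (n := ∞) ENat.LEInfty.out
    exact mfderiv_extChartAt_self
  have h3 := chartSymmDeriv_comp_chartDeriv I (mem_extChartAt_source (I := I) p)
  rw [h1, ContinuousLinearMap.comp_id] at h3
  rw [coordMap_apply, h2, h3, ContinuousLinearMap.id_comp, ContinuousLinearMap.comp_id]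

/-- Composing with linear maps between tangent spaces, in coordinates. -/
lemma coordMap_comp {F : M → N} {p x p' : M} (hx : x ∈ (extChartAt I p).source)
    (hy : F x ∈ (extChartAt J (F p)).source) (S : E' →L[ℝ] E') (T : E →L[ℝ] E) :
    coordMap I J F p p' (S.comp ((modelDeriv I J F x).comp T))
      = ((chartDeriv J (F p) (F p')).comp
          (S.comp (chartSymmDeriv J (F p) (extChartAt J (F p) (F x))))).comp
        ((coordDifferential I J F p x).comp ((chartDeriv I p x).comp
          (T.comp (chartSymmDeriv I p (extChartAt I p p'))))) := by
  ext v
  simp only [coordMap_apply, coordDifferential, ContinuousLinearMap.comp_apply]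
  rw [chartSymmDeriv_chartDeriv_apply I hx, chartSymmDeriv_chartDeriv_apply J hy]

omit [J.Boundaryless] in
lemma coordDifferential_eq_fderiv {F : M → N} {p x : M} (hx : x ∈ (extChartAt I p).source)
    (hy : F x ∈ (extChartAt J (F p)).source) (hF : MDifferentiableAt I J F x) :
    coordDifferential I J F p x
      = fderiv ℝ (fun z ↦ extChartAt J (F p) (F ((extChartAt I p).symm z))) (extChartAt I p x) := by
  have : IsManifold I 1 M := .of_le (n := ∞) ENat.LEInfty.out
  have : IsManifold J 1 N := .of_le (n := ∞) ENat.LEInfty.out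
  have e : (extChartAt I p).symm (extChartAt I p x) = x := (extChartAt I p).left_inv hx
  have h1 : MDifferentiableAt 𝓘(ℝ, E) I (extChartAt I p).symm (extChartAt I p x) := by
    have := mdifferentiableWithinAt_extChartAt_symm ((extChartAt I p).map_source hx)
    rwa [I.range_eq_univ, mdifferentiableWithinAt_univ] at this
  have h2 : HasMFDerivAt 𝓘(ℝ, E) J (fun z ↦ F ((extChartAt I p).symm z)) (extChartAt I p x)
      ((modelDeriv I J F x).comp (chartSymmDeriv I p (extChartAt I p x)) : E →L[ℝ] E') :=
    hasMFDerivAt_comp_of_eq I J e hF.hasMFDerivAt h1.hasMFDerivAt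
  have h3 : MDifferentiableAt J 𝓘(ℝ, E') (extChartAt J (F p)) (F x) :=
    mdifferentiableAt_extChartAt (by rwa [extChartAt_source] at hy)
  have h4 : HasMFDerivAt 𝓘(ℝ, E) 𝓘(ℝ, E')
      (fun z ↦ extChartAt J (F p) (F ((extChartAt I p).symm z))) (extChartAt I p x)
      (coordDifferential I J F p x : E →L[ℝ] E') :=
    hasMFDerivAt_comp_of_eq J 𝓘(ℝ, E')
      (f := fun z ↦ F ((extChartAt I p).symm z)) (congrArg F e) h3.hasMFDerivAt h2
  have h5 : HasFDerivAt (fun z ↦ extChartAt J (F p) (F ((extChartAt I p).symm z)))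
      (coordDifferential I J F p x) (extChartAt I p x) := hasMFDerivAt_iff_hasFDerivAt.1 h4
  exact h5.fderiv.symm

end Coordinates

section ClosedSingularSet

variable {E : Type*} [NormedAddCommGroup E] [NormedSpace ℝ E] [FiniteDimensional ℝ E]
  {H : Type*} [TopologicalSpace H] (I : ModelWithCorners ℝ E H)
  {M : Type*} [EMetricSpace M] [ChartedSpace H M]
  [RiemannianBundle (fun x : M ↦ TangentSpace I x)]
  [I.Boundaryless] [IsManifold I ∞ M]
  [IsContMDiffRiemannianBundle I ∞ E (fun x : M ↦ TangentSpace I x)] [IsRiemannianManifold I M]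
  {E' : Type*} [NormedAddCommGroup E'] [NormedSpace ℝ E'] [FiniteDimensional ℝ E']
  {H' : Type*} [TopologicalSpace H'] (J : ModelWithCorners ℝ E' H')
  {N : Type*} [EMetricSpace N] [ChartedSpace H' N]
  [RiemannianBundle (fun y : N ↦ TangentSpace J y)]
  [J.Boundaryless] [IsManifold J ∞ N]
  [IsContMDiffRiemannianBundle J ∞ E' (fun y : N ↦ TangentSpace J y)] [IsRiemannianManifold J N]

omit [FiniteDimensional ℝ E] [I.Boundaryless] [IsManifold I ∞ M]
  [IsContMDiffRiemannianBundle I ∞ E (fun x : M ↦ TangentSpace I x)] [IsRiemannianManifold I M]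
  [FiniteDimensional ℝ E'] [J.Boundaryless] [IsManifold J ∞ N]
  [IsContMDiffRiemannianBundle J ∞ E' (fun y : N ↦ TangentSpace J y)] [IsRiemannianManifold J N] in
lemma mem_mixture_iff {F : M → N} {p : M} {G : E →L[ℝ] E'} :
    G ∈ (mixture I J F p : Set (E →L[ℝ] E')) ↔ ∃ (x : ℕ → M) (τ : ℕ → E →L[ℝ] E) (σ : ℕ → E' →L[ℝ] E'),
      Tendsto x atTop (𝓝 p) ∧ (∀ i, MDifferentiableAt I J F (x i)) ∧
      (∀ i, IsParallelTranslation I p (x i) (τ i)) ∧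
      (∀ i, IsParallelTranslation J (F (x i)) (F p) (σ i)) ∧
      Tendsto (fun i ↦ (σ i).comp ((modelDeriv I J F (x i)).comp (τ i))) atTop (𝓝 G) :=
  Iff.rfl

/-- The differential of a locally Lipschitz map is locally bounded in charts. -/
lemma exists_eventually_norm_coordDifferential_le {F : M → N} (hF : LocallyLipschitz F) (p : M) :
    ∃ K : ℝ, ∀ᶠ x in 𝓝 p, MDifferentiableAt I J F x → ‖coordDifferential I J F p x‖ ≤ K := by
  obtain ⟨L, t, ht, hL⟩ := hF p
  obtain ⟨U, hU, K, hK⟩ := exists_nhds_edist_comparison I p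
  obtain ⟨U', hU', K', hK'⟩ := exists_nhds_edist_comparison J (F p)
  have hs : (extChartAt I p).source ∩ F ⁻¹' (extChartAt J (F p)).source ∩ (t ∩ (U ∩ F ⁻¹' U'))
      ∈ 𝓝 p := by
    refine inter_mem (inter_mem (extChartAt_source_mem_nhds p) ?_) (inter_mem ht (inter_mem hU ?_))
    · exact hF.continuous.continuousAt (extChartAt_source_mem_nhds (F p))
    · exact hF.continuous.continuousAt hU'
  refine ⟨(K' * L * K : NNReal), ?_⟩
  filter_upwards [eventually_mem_nhds_iff.2 hs] with x hx hdiff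
  obtain ⟨⟨hx1, hx2⟩, -⟩ := mem_of_mem_nhds hx
  have hz : extChartAt I p x ∈ (extChartAt I p).target := (extChartAt I p).map_source hx1
  rw [coordDifferential_eq_fderiv I J hx1 hx2 hdiff]
  set s := (extChartAt I p).target ∩ (extChartAt I p).symm ⁻¹'
    ((extChartAt I p).source ∩ F ⁻¹' (extChartAt J (F p)).source ∩ (t ∩ (U ∩ F ⁻¹' U'))) with hsdef
  have hs' : s ∈ 𝓝 (extChartAt I p x) := by
    refine inter_mem ((isOpen_extChartAt_target p).mem_nhds hz) ?_
    have hc : ContinuousAt (extChartAt I p).symm (extChartAt I p x) :=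
      (continuousOn_extChartAt_symm p).continuousAt ((isOpen_extChartAt_target p).mem_nhds hz)
    refine hc ?_
    rwa [(extChartAt I p).left_inv hx1]
  refine norm_fderiv_le_of_lipschitzOn ℝ hs' fun a ha b hb ↦ ?_
  obtain ⟨ha0, -, hat, haU, haU'⟩ := ha
  obtain ⟨hb0, -, hbt, hbU, hbU'⟩ := hb
  have h1 := (hK _ haU _ hbU).1
  rw [(extChartAt I p).right_inv ha0, (extChartAt I p).right_inv hb0] at h1
  calc _ ≤ K' * edist (F ((extChartAt I p).symm a)) (F ((extChartAt I p).symm b)) :=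
        (hK' _ haU' _ hbU').2
    _ ≤ K' * (L * (K * edist a b)) := by
        gcongr
        refine (hL hat hbt).trans ?_
        gcongr
    _ = _ := by push_cast; ring

/-- Near `p`, translating the differential of `F` in parallel hardly changes its coordinate
expression. -/
lemma exists_nhds_norm_coordMap_sub_le {F : M → N} (hF : LocallyLipschitz F) (p : M) {ε : ℝ}
    (hε : 0 < ε) :
    ∃ U ∈ 𝓝 p, ∀ p' ∈ U, ∀ x ∈ U, MDifferentiableAt I J F x → ∀ (T : E →L[ℝ] E) (S : E' →L[ℝ] E'),
      IsParallelTranslation I p' x T → IsParallelTranslation J (F x) (F p') S →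
      ‖coordMap I J F p p' (S.comp ((modelDeriv I J F x).comp T)) - coordDifferential I J F p x‖
        ≤ ε := by
  obtain ⟨K, hK⟩ := exists_eventually_norm_coordDifferential_le I J hF p
  obtain ⟨η, hη, hη1, hηε⟩ : ∃ η > 0, η ≤ 1 ∧ 3 * K * η ≤ ε := by
    have h1 : ∀ᶠ η in 𝓝[>] (0 : ℝ), 3 * K * η < ε :=
      nhdsWithin_le_nhds (ContinuousAt.eventually_lt (by fun_prop) (by fun_prop) (by simpa using hε))
    have h2 : ∀ᶠ η in 𝓝[>] (0 : ℝ), η < 1 := nhdsWithin_le_nhds (eventually_lt_nhds one_pos)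
    obtain ⟨η, hη⟩ := (h1.and (h2.and self_mem_nhdsWithin)).exists
    exact ⟨η, hη.2.2, hη.2.1.le, hη.1.le⟩
  obtain ⟨U, hU, hUs, hUT⟩ := exists_nhds_norm_parallelTranslation_sub_id_le I p hη
  obtain ⟨U', hU', hUs', hUT'⟩ := exists_nhds_norm_parallelTranslation_sub_id_le J (F p) hη
  refine ⟨U ∩ F ⁻¹' U' ∩ {x | MDifferentiableAt I J F x → ‖coordDifferential I J F p x‖ ≤ K},
    inter_mem (inter_mem hU (hF.continuous.continuousAt hU')) hK, ?_⟩
  rintro p' ⟨⟨hp', hFp'⟩, -⟩ x ⟨⟨hx, hFx⟩, hxK⟩ hd T S hT hS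
  rw [coordMap_comp I J (hUs hx) (hUs' hFx)]
  exact (norm_comp_comp_sub_le hη1 (hUT' _ hFx _ hFp' S hS) (hUT _ hp' _ hx T hT) (hxK hd)).trans
    hηε

/-- The limits at `p` of the coordinate expressions of the differential of `F`. -/
def coordMixture (F : M → N) (p : M) : Set (E →L[ℝ] E') :=
  {G | MapClusterPt G (𝓝 p ⊓ 𝓟 {x | MDifferentiableAt I J F x}) (coordDifferential I J F p)}

lemma isCompact_coordMixture {F : M → N} (hF : LocallyLipschitz F) (p : M) :
    IsCompact (coordMixture I J F p) := by
  have : ProperSpace (E →L[ℝ] E') := FiniteDimensional.proper ℝ _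
  obtain ⟨K, hK⟩ := exists_eventually_norm_coordDifferential_le I J hF p
  refine (isCompact_closedBall (0 : E →L[ℝ] E') K).of_isClosed_subset isClosed_setOfPred_clusterPt
    fun G hG ↦ ?_
  refine Metric.isClosed_closedBall.mem_of_mapClusterPt hG ?_
  rw [eventually_inf_principal]
  filter_upwards [hK] with x hx hd
  simpa using hx hd

lemma eventually_coordDifferential_mem {F : M → N} (hF : LocallyLipschitz F) (p : M)
    {U : Set (E →L[ℝ] E')} (hU : IsOpen U) (hsub : coordMixture I J F p ⊆ U) :
    ∀ᶠ x in 𝓝 p, MDifferentiableAt I J F x → coordDifferential I J F p x ∈ U := by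
  have : ProperSpace (E →L[ℝ] E') := FiniteDimensional.proper ℝ _
  obtain ⟨K, hK⟩ := exists_eventually_norm_coordDifferential_le I J hF p
  have h1 := eventually_mem_of_isCompact (L := 𝓝 p ⊓ 𝓟 {x | MDifferentiableAt I J F x})
    (D := coordDifferential I J F p) (isCompact_closedBall (0 : E →L[ℝ] E') K) (by
      rw [eventually_inf_principal]
      filter_upwards [hK] with x hx hd
      simpa using hx hd) hU fun G hG ↦ hsub hG
  rwa [eventually_inf_principal] at h1

lemma coordMixture_subset_mixture {F : M → N} (hF : LocallyLipschitz F) (p : M) :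
    coordMixture I J F p ⊆ (mixture I J F p : Set (E →L[ℝ] E')) := by
  intro G hG
  obtain ⟨x, hx, hxG⟩ := exists_seq_of_mapClusterPt hG
  rw [tendsto_inf, tendsto_principal] at hx
  have hFx : Tendsto (fun i ↦ F (x i)) atTop (𝓝 (F p)) := (hF.continuous.tendsto p).comp hx.1
  obtain ⟨n, hn⟩ := eventually_atTop.1 (hx.2.and
    ((hx.1.eventually (eventually_exists_isParallelTranslation I p)).and
      (hFx.eventually (eventually_exists_isParallelTranslation J (F p)))))
  have hn' := fun i ↦ hn (i + n) (Nat.le_add_left n i)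
  choose τ hτ using fun i ↦ (hn' i).2.1.1
  choose σ hσ using fun i ↦ (hn' i).2.2.2
  refine (mem_mixture_iff I J).2 ⟨fun i ↦ x (i + n), τ, σ, hx.1.comp (tendsto_add_atTop_nat n),
    fun i ↦ (hn' i).1, hτ, hσ, ?_⟩
  have h1 : Tendsto (fun i ↦ coordDifferential I J F p (x (i + n))) atTop (𝓝 G) :=
    hxG.comp (tendsto_add_atTop_nat n)
  rw [← tendsto_sub_nhds_zero_iff] at h1 ⊢
  have h2 : Tendsto (fun i ↦ (show E' →L[ℝ] E' from σ i).comp ((modelDeriv I J F (x (i + n))).comp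
      (show E →L[ℝ] E from τ i)) - coordDifferential I J F p (x (i + n))) atTop (𝓝 0) := by
    rw [Metric.tendsto_nhds]
    intro ε hε
    obtain ⟨U, hU, h⟩ := exists_nhds_norm_coordMap_sub_le I J hF p (half_pos hε)
    filter_upwards [(hx.1.comp (tendsto_add_atTop_nat n)).eventually_mem hU] with i hi
    have h3 := h p (mem_of_mem_nhds hU) (x (i + n)) hi (hn' i).1 (τ i) (σ i) (hτ i) (hσ i)
    rw [coordMap_self] at h3
    rw [dist_zero_right]
    exact h3.trans_lt (half_lt_self hε)
  simpa using h2.add h1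

/-- Near `p`, the coordinate expressions of the elements of the mixture are close to the mixture
at `p`. -/
lemma eventually_coordMap_mem_cthickening {F : M → N} (hF : LocallyLipschitz F) (p : M) {ε : ℝ}
    (hε : 0 < ε) :
    ∀ᶠ p' in 𝓝 p, ∀ G : E →L[ℝ] E', G ∈ (mixture I J F p' : Set (E →L[ℝ] E')) →
      coordMap I J F p p' G ∈ Metric.cthickening ε (coordMixture I J F p) := by
  obtain ⟨U, hU, h⟩ := exists_nhds_norm_coordMap_sub_le I J hF p (half_pos hε)
  have h1 := eventually_coordDifferential_mem I J hF p (Metric.isOpen_thickening (δ := ε / 2))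
    (Metric.self_subset_thickening (half_pos hε) _)
  filter_upwards [eventually_mem_nhds_iff.2 hU, h1.eventually_nhds] with p' hp' hp'1 G hG
  obtain ⟨x, τ, σ, hx, hd, hτ, hσ, hlim⟩ := (mem_mixture_iff I J).1 hG
  refine Metric.isClosed_cthickening.mem_of_tendsto
    (((coordMap I J F p p').continuous.tendsto G).comp hlim) ?_
  filter_upwards [hx.eventually_mem hp', hx.eventually hp'1] with i hi hi1
  refine Metric.thickening_subset_cthickening _ _ ?_
  obtain ⟨G₀, hG₀, hdist⟩ := Metric.mem_thickening_iff.1 (hi1 (hd i))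
  refine Metric.mem_thickening_iff.2 ⟨G₀, hG₀, (dist_triangle _ _ _).trans_lt
    ((add_lt_add_of_le_of_lt ?_ hdist).trans_eq (add_halves ε))⟩
  rw [dist_eq_norm]
  exact h p' (mem_of_mem_nhds hp') (x i) hi (hd i) (τ i) (σ i) (hτ i) (hσ i)

omit [RiemannianBundle (fun x : M ↦ TangentSpace I x)]
  [IsContMDiffRiemannianBundle I ∞ E (fun x : M ↦ TangentSpace I x)] [IsRiemannianManifold I M] in
lemma finrank_range_eq_min_iff (G : E →L[ℝ] E') :
    Module.finrank ℝ (G : E →ₗ[ℝ] E').range = min (Module.finrank ℝ E) (Module.finrank ℝ E') ↔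
      (min (Module.finrank ℝ E) (Module.finrank ℝ E') : ℕ) ≤ (G : E →ₗ[ℝ] E').rank := by
  rw [LinearMap.rank, ← Module.finrank_eq_rank, Nat.cast_le]
  refine ⟨fun h ↦ h.ge, fun h ↦ le_antisymm (le_min ?_ (Submodule.finrank_le _)) h⟩
  exact LinearMap.finrank_range_le _

omit [I.Boundaryless] [IsManifold I ∞ M]
  [IsContMDiffRiemannianBundle I ∞ E (fun x : M ↦ TangentSpace I x)] [IsRiemannianManifold I M]
  [J.Boundaryless] [IsManifold J ∞ N]
  [IsContMDiffRiemannianBundle J ∞ E' (fun y : N ↦ TangentSpace J y)] [IsRiemannianManifold J N] in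
lemma isNonsingularPoint_iff {F : M → N} {p : M} : IsNonsingularPoint I J F p ↔
    convexHull ℝ (mixture I J F p : Set (E →L[ℝ] E')) ⊆ maximalRank E E' :=
  forall₂_congr fun G _ ↦ finrank_range_eq_min_iff (E := E) (E' := E') G

lemma eventually_isNonsingularPoint {F : M → N} (hF : LocallyLipschitz F) {p : M}
    (hp : IsNonsingularPoint I J F p) : ∀ᶠ p' in 𝓝 p, IsNonsingularPoint I J F p' := by
  have hopen : IsOpen (maximalRank E E') := isOpen_setOfPred_nat_le_rank _
  have hsub : convexHull ℝ (coordMixture I J F p) ⊆ maximalRank E E' :=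
    (convexHull_mono (coordMixture_subset_mixture I J hF p)).trans
      ((isNonsingularPoint_iff I J).1 hp)
  obtain ⟨ε, hε, hεsub⟩ := (isCompact_convexHull_of_isCompact
    (isCompact_coordMixture I J hF p)).exists_cthickening_subset_open hopen hsub
  filter_upwards [eventually_coordMap_mem_cthickening I J hF p hε] with p' hp'
  rw [isNonsingularPoint_iff]
  intro G hG
  exact mem_maximalRank_of_coordMap I J (hεsub (map_mem_cthickening_convexHull hp' hG))

/-- The set of singular points of a locally Lipschitz map is closed. -/
theorem isClosed_singularSet {F : M → N} (hF : LocallyLipschitz F) :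
    IsClosed (singularSet I J F) := by
  rw [← isOpen_compl_iff, isOpen_iff_mem_nhds]
  intro p hp
  filter_upwards [eventually_isNonsingularPoint I J hF (not_not.1 hp)] with p' hp'
  exact not_not.2 hp'

end ClosedSingularSet

end Clarke

end

theorem corollary3p14 (m n : ℕ)
    {M : Type*} [EMetricSpace M] [ChartedSpace (EuclideanSpace ℝ (Fin m)) M]
    [IsManifold (𝓡 m) ∞ M]
    [RiemannianBundle (fun x : M ↦ TangentSpace (𝓡 m) x)]
    [IsContMDiffRiemannianBundle (𝓡 m) ∞ (EuclideanSpace ℝ (Fin m))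
      (fun x : M ↦ TangentSpace (𝓡 m) x)]
    [IsRiemannianManifold (𝓡 m) M]
    {N : Type*} [EMetricSpace N] [ChartedSpace (EuclideanSpace ℝ (Fin n)) N]
    [IsManifold (𝓡 n) ∞ N]
    [RiemannianBundle (fun y : N ↦ TangentSpace (𝓡 n) y)]
    [IsContMDiffRiemannianBundle (𝓡 n) ∞ (EuclideanSpace ℝ (Fin n))
      (fun y : N ↦ TangentSpace (𝓡 n) y)]
    [IsRiemannianManifold (𝓡 n) N]
    (F : M → N) (hF : LocallyLipschitz F) :
    IsClosed (Clarke.singularSet (𝓡 m) (𝓡 n) F) :=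
  Clarke.isClosed_singularSet (𝓡 m) (𝓡 n) hF
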